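/- Let $K$ be an infinite field of arbitrary characteristic, let $m\ge 0$, $d,\tau\ge 1$ be integers, and let $R=K[\![x_1,\dots,x_m]\!]$ (local case) or $R=K[x_1,\dots,x_m]$ (graded case), with $\mathcal M=(x_1,\dots,x_m)$. Let $\mathcal D=K_{DP}[X_1,\dots,X_m]$ be the divided power ring, an $R$-module by contraction: $x^{\mathbf l}\circ X^{\mathbf n}=X^{\mathbf n-\mathbf l}$ if $\mathbf l\le\mathbf n$ and $0$ otherwise. Write $\mathrm{ann}_R(W)=\{f\in R: f\circ F=0\ \forall F\in W\}$. *Admissible submodules.* Let $z_1,\dots,z_d\in\mathcal M$ be part of a system of generators $y_1,\dots,y_m$ of $\mathcal M$ (consisting of linear forms in the graded case), and let $Z^{\mathbf k}$, $\mathbf k\in\mathbb N^m$, be the monomials of $\mathcal D=K_{DP}[Z_1,\dots,Z_m]$ in the coordinates dual to the $y_i$, i.e. $Z^{\mathbf 0}=1$, $Z^{\mathbf k}$ has no constant term for $\mathbf k\ne \mathbf 0$, and $y_i\circ Z^{\mathbf k}=Z^{\mathbf k-\mathbf e_i}$ if $k_i>0$ and $0$ otherwise. An $R$-submodule $W\subseteq\mathcal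 D$ is $L_d^\tau$-admissible with respect to $z_1,\dots,z_d$ if it is generated by elements (homogeneous elements in the graded case) $H^j_{\mathbf n}$, $\mathbf n\in\mathbb N_+^d$, $j=1,\dots,\tau$, such that, with $W_{\mathbf n}=\langle H_{\mathbf n}^1,\dots,H_{\mathbf n}^\tau\rangle$: 1. for every $\mathbf n\in\mathbb N_+^d$ the elements $H_{\mathbf n}^1,\dots,H_{\mathbf n}^\tau$ have the same degree $s_{\mathbf n}$, and their forms of degree $s_{\mathbf n}$ are linearly independent over $K$; 2. $z_i\circ H_{\mathbf n}^j=H_{\mathbf n-\mathbf e_i}^j$ if $n_i\ge 2$, and $z_i\circ H_{\mathbf n}^j=0$ if $n_i=1$; 3. if $n_i\ge 2$, then $W_{\mathbf n}\cap V_{\mathbf n}^i\subseteq W_{\mathbf n-\mathbf e_i}$, where $V^i_{\mathbf n}$ is generated by the $Z^{\mathbf k}$ with $|\mathbf k|\le s_{\mathbf n}$ whose exponent of $Z_i$ (the coordinate dual to $z_i$) is at most $n_i-2$. $W$ is graded $L_d^\tau$-admissible if this holds for some linear forms $z_1,\dots,z_d$ as above. $W$ is local $L_d^\tau$-admissible if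 it holds for some sequence of general elements; here elements $z_i=\sum_j a_{ij}x_j$ with $a_{ij}\in R$ have residues $(\overline{a_{ij}})\in K^{dm}$, and "for some sequence of general elements" means that every Zariski-dense open subset of $K^{dm}$ contains the residues of some $z_1,\dots,z_d$ with respect to which $W$ is $L_d^\tau$-admissible. *Level algebras.* In the local case, $A=R/I$ is level of dimension $d$ and type $\tau$ if it is Cohen–Macaulay of dimension $d$ and type $\tau$, and there is a Zariski-dense open $U\subseteq K^{dm}$ such that for all $(a_{ij})\in R^{dm}$ with residues in $U$ the quotient $B$ of $A$ by the ideal generated by the $d$ elements $\sum_j a_{ij}x_j$ is Artinian level, i.e. $B$ is Artinian and its socle is $\mathfrak n^s$, where $\mathfrak n$ is its maximal ideal and $s$ is the largest integer with $\mathfrak n^s\neq 0$. In the graded case, $A=R/I$ is level of dimension $d$ and type $\tau$ if $I$ is homogeneous, $A$ is Cohen–Macaulay of dimension $d$ and type $\tau$, and the graded canonical module $\omega_A=\mathrm{Ext}_R^{m-d}(A,R(-m))$ is generated by elements of a single degree. The type is $\dim_K\mathrm{Ext}^d_A(K,A)$. **Proposition.** Let $W\neq 0$ be an $R$-submodule of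 $\mathcal D$. If $W$ is local (resp. graded) $L_d^\tau$-admissible, then $R/\mathrm{ann}_R(W)$ is a local (resp. graded) level $K$-algebra of dimension $d$ and type $\tau$. Moreover, in both cases, whenever $W$ is $L_d^\tau$-admissible with respect to a sequence $z_1,\dots,z_d$ as above, with generators $H_{\mathbf n}^j$, one has $\mathrm{ann}_R(W_{\mathbf n})=\mathrm{ann}_R(W)+(z_1^{n_1},\dots,z_d^{n_d})$ for all $\mathbf n\in\mathbb N_+^d$, and $z_1,\dots,z_d$ is a regular sequence on $R/\mathrm{ann}_R(W)$. -/

import Mathlib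

universe u

noncomputable section

/-! ### The divided power ring as a module under contraction -/

/-- The underlying `K`-vector space of the divided power ring `K_DP[X_1, …, X_m]`: finite linear
combinations of the (divided power) monomials `X^n`, `n ∈ ℕ^m`.  Only its module structure under
the contraction action is used. -/
def DividedPower (m : ℕ) (K : Type u) [Field K] : Type u := (Fin m →₀ ℕ) →₀ K

namespace DividedPower

variable {m : ℕ} {K : Type u} [Field K]

instance : AddCommGroup (DividedPower m K) :=
  inferInstanceAs (AddCommGroup ((Fin m →₀ ℕ) →₀ K))

instance : Module K (DividedPower m K) :=
  inferInstanceAs (Module K ((Fin m →₀ ℕ) →₀ K))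

/-- The coefficient of `X^n` in `F`. -/
def coeff (n : Fin m →₀ ℕ) (F : DividedPower m K) : K := Finsupp.toFun F n

/-- The monomial `b X^n`. -/
def monomial (n : Fin m →₀ ℕ) (b : K) : DividedPower m K := Finsupp.single n b

/-- The set of exponents occurring in `F`. -/
def support (F : DividedPower m K) : Finset (Fin m →₀ ℕ) := Finsupp.support F

/-- The contraction action: if `f = ∑ f_l x^l`, then
`f ∘ X^n = ∑_{l ≤ n} f_l X^(n-l) = ∑_{k+l=n} f_l X^k`, extended linearly. -/
def contract (f : MvPowerSeries (Fin m) K) :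
    ((Fin m →₀ ℕ) →₀ K) →ₗ[K] ((Fin m →₀ ℕ) →₀ K) :=
  Finsupp.linearCombination K fun n =>
    ∑ p ∈ Finset.HasAntidiagonal.antidiagonal n, Finsupp.single p.1 (MvPowerSeries.coeff p.2 f)

theorem contract_single (f : MvPowerSeries (Fin m) K) (n : Fin m →₀ ℕ) (b : K) :
    contract f (Finsupp.single n b) =
      b • ∑ p ∈ Finset.HasAntidiagonal.antidiagonal n, Finsupp.single p.1 (MvPowerSeries.coeff p.2 f) := by
  simp [contract]

theorem contract_one (F : (Fin m →₀ ℕ) →₀ K) :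
    contract (1 : MvPowerSeries (Fin m) K) F = F := by
  classical
  induction F using Finsupp.induction_linear with
  | zero => simp
  | add F G hF hG => rw [map_add, hF, hG]
  | single n b =>
    rw [contract_single, Finset.sum_eq_single (n, 0)]
    · simp
    · rintro ⟨k, l⟩ hp hne
      have hl : l ≠ 0 := by
        rintro rfl
        apply hne
        simpa using hp
      simp [MvPowerSeries.coeff_one, hl]
    · intro h
      simp at h

theorem contract_mul (f g : MvPowerSeries (Fin m) K) (F : (Fin m →₀ ℕ) →₀ K) :
    contract (f * g) F = contract f (contract g F) := by
  classical
  induction F using Finsupp.induction_linear with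
  | zero => simp
  | add F G hF hG => simp only [map_add, hF, hG]
  | single n b =>
    rw [contract_single, contract_single, map_smul, map_sum]
    congr 1
    simp only [contract_single, MvPowerSeries.coeff_mul, Finsupp.single_finsetSum,
      Finset.smul_sum, Finset.sum_sigma']
    refine Finset.sum_nbij' (fun x => ⟨(x.1.1 + x.2.1, x.2.2), (x.1.1, x.2.1)⟩)
      (fun x => ⟨(x.2.1, x.2.2 + x.1.2), (x.2.2, x.1.2)⟩) ?_ ?_ ?_ ?_ ?_
    · rintro ⟨⟨k, l⟩, ⟨a, c⟩⟩ h
      simp only [Finset.mem_sigma, Finset.HasAntidiagonal.mem_antidiagonal] at h ⊢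
      exact ⟨by rw [add_assoc, h.2, h.1], trivial⟩
    · rintro ⟨⟨k, l⟩, ⟨a, c⟩⟩ h
      simp only [Finset.mem_sigma, Finset.HasAntidiagonal.mem_antidiagonal] at h ⊢
      exact ⟨by rw [← add_assoc, h.2, h.1], trivial⟩
    · rintro ⟨⟨k, l⟩, ⟨a, c⟩⟩ h
      simp only [Finset.mem_sigma, Finset.HasAntidiagonal.mem_antidiagonal] at h
      obtain ⟨rfl, rfl⟩ := h
      rfl
    · rintro ⟨⟨k, l⟩, ⟨a, c⟩⟩ h
      simp only [Finset.mem_sigma, Finset.HasAntidiagonal.mem_antidiagonal] at h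
      obtain ⟨rfl, rfl⟩ := h
      rfl
    · rintro ⟨⟨k, l⟩, ⟨a, c⟩⟩ h
      simp [mul_comm]

theorem contract_add (f g : MvPowerSeries (Fin m) K) (F : (Fin m →₀ ℕ) →₀ K) :
    contract (f + g) F = contract f F + contract g F := by
  induction F using Finsupp.induction_linear with
  | zero => simp
  | add F G hF hG =>
    simp only [map_add, hF, hG]
    abel
  | single n b =>
    simp only [contract_single, map_add, Finsupp.single_add, Finset.sum_add_distrib, smul_add]

theorem contract_zero (F : (Fin m →₀ ℕ) →₀ K) :
    contract (0 : MvPowerSeries (Fin m) K) F = 0 := by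
  simp [contract, Finsupp.linearCombination_apply]

/-- The divided power ring as a module over `K⟦x_1, …, x_m⟧` under contraction. -/
instance : Module (MvPowerSeries (Fin m) K) (DividedPower m K) where
  smul f F := contract f F
  one_smul F := contract_one F
  mul_smul f g F := contract_mul f g F
  smul_zero f := map_zero (contract f)
  smul_add f F G := map_add (contract f) F G
  add_smul f g F := contract_add f g F
  zero_smul F := contract_zero F

/-- The divided power ring as a module over `K[x_1, …, x_m]` under contraction. -/
instance : Module (MvPolynomial (Fin m) K) (DividedPower m K) :=
  Module.compHom (DividedPower m K)
    (MvPolynomial.coeToMvPowerSeries.ringHom :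
      MvPolynomial (Fin m) K →+* MvPowerSeries (Fin m) K)

/-- The degree of an element of the divided power ring (`0` for the zero element). -/
def degree (F : DividedPower m K) : ℕ := F.support.sup fun k => k.degree

/-- The form of degree `s` of `F`, i.e. its homogeneous component of degree `s`. -/
def form (s : ℕ) (F : DividedPower m K) : DividedPower m K :=
  Finsupp.filter (fun k : Fin m →₀ ℕ => k.degree = s) F

/-- `F` is homogeneous of degree `s` (the zero element is homogeneous of every degree). -/
def IsHomogeneous (F : DividedPower m K) (s : ℕ) : Prop := ∀ k ∈ F.support, k.degree = s

end DividedPower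

/-! ### Admissible submodules -/

section Admissible

variable {m d τ : ℕ} {K : Type u} [Field K]

/-- Let `y_1, …, y_m ∈ R` be a minimal system of generators of the maximal (homogeneous) ideal of
`R`, where `R` is the power series or the polynomial ring.  The family `Z^k`, `k ∈ ℕ^m`, consists
of the monomials of the divided power ring `K_DP[Z_1, …, Z_m]` in the coordinates `Z_1, …, Z_m`
dual to `y_1, …, y_m`: `Z^0 = 1`, all other `Z^k` have no constant term, and `R` acts by
contraction with respect to the `y_i`, i.e. `y_i ∘ Z^k = Z^(k - e_i)` if `k_i > 0`, and
`y_i ∘ Z^k = 0` otherwise.  (These conditions determine the family `Z`.) -/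
structure IsDualMonomials {R : Type u} [CommRing R] [Module R (DividedPower m K)]
    (y : Fin m → R) (Z : (Fin m →₀ ℕ) → DividedPower m K) : Prop where
  one : Z 0 = DividedPower.monomial 0 1
  constant_term : ∀ k, k ≠ 0 → (Z k).coeff 0 = 0
  contract : ∀ i k, y i • Z k = if k i = 0 then 0 else Z (k - Finsupp.single i 1)

/-- `W_n`, the submodule generated by the elements `H_n^1, …, H_n^τ`. -/
def levelSubmodule (R : Type u) [CommRing R] [Module R (DividedPower m K)]
    (H : (Fin d → ℕ) → Fin τ → DividedPower m K) (n : Fin d → ℕ) :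
    Submodule R (DividedPower m K) :=
  Submodule.span R (Set.range (H n))

/-- The submodule generated by the `Z^k` with `k_i ≤ b - 2` and `|k| ≤ s`, for `i = 1, …, m` and
`b ≥ 2`. -/
def boundedSubmodule (R : Type u) [CommRing R] [Module R (DividedPower m K)]
    (Z : (Fin m →₀ ℕ) → DividedPower m K) (i : Fin m) (b s : ℕ) :
    Submodule R (DividedPower m K) :=
  Submodule.span R {F | ∃ k : Fin m →₀ ℕ, k i + 2 ≤ b ∧ k.degree ≤ s ∧ F = Z k}

/-- The defining conditions of an `L_d^τ`-admissible submodule `W`, with all the data made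
explicit.  Here `M` is the maximal (homogeneous) ideal of `R`; the sequence `z_1, …, z_d` is
`z_i = y_{e(i)}`, where `y_1, …, y_m` is a system of generators of `M` to which the sequence is
extended; `Z` is the family of dual monomials; the generators `H_n^j` are indexed by
`n ∈ ℕ_+^d` (values of `H` at other `n` are irrelevant) and `j = 1, …, τ`;
`s_n` is the common degree of the `H_n^j`. -/
structure IsAdmissibleSystem {R : Type u} [CommRing R] [Module R (DividedPower m K)]
    (M : Ideal R) (W : Submodule R (DividedPower m K))
    (y : Fin m → R) (e : Fin d ↪ Fin m) (Z : (Fin m →₀ ℕ) → DividedPower m K)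
    (H : (Fin d → ℕ) → Fin τ → DividedPower m K) (s : (Fin d → ℕ) → ℕ) : Prop where
  generators_maximal : Ideal.span (Set.range y) = M
  dual : IsDualMonomials y Z
  generators : W = Submodule.span R {F | ∃ n : Fin d → ℕ, (∀ i, 0 < n i) ∧ ∃ j, F = H n j}
  degree_eq : ∀ n : Fin d → ℕ, (∀ i, 0 < n i) → ∀ j, (H n j).degree = s n
  linearIndependent : ∀ n : Fin d → ℕ, (∀ i, 0 < n i) →
    LinearIndependent K fun j => (H n j).form (s n)
  contract : ∀ n : Fin d → ℕ, (∀ i, 0 < n i) → ∀ j i,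
    y (e i) • H n j = if 2 ≤ n i then H (n - Pi.single i 1) j else 0
  inter_le : ∀ n : Fin d → ℕ, (∀ i, 0 < n i) → ∀ i, 2 ≤ n i →
    levelSubmodule R H n ⊓ boundedSubmodule R Z (e i) (n i) (s n) ≤
      levelSubmodule R H (n - Pi.single i 1)

variable (m K) in
/-- The maximal ideal `(x_1, …, x_m)` of `K⟦x_1, …, x_m⟧`. -/
def powerSeriesMaximal : Ideal (MvPowerSeries (Fin m) K) :=
  Ideal.span (Set.range MvPowerSeries.X)

variable (m K) in
/-- The maximal homogeneous ideal `(x_1, …, x_m)` of `K[x_1, …, x_m]`. -/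
def polynomialMaximal : Ideal (MvPolynomial (Fin m) K) :=
  Ideal.span (Set.range MvPolynomial.X)

/-- Zariski-open subsets of affine space `K^σ`. -/
def IsZariskiOpen {σ : Type} (U : Set (σ → K)) : Prop :=
  ∃ J : Ideal (MvPolynomial σ K), U = (MvPolynomial.zeroLocus K J)ᶜ

/-- Zariski-dense Zariski-open subsets of affine space `K^σ`. -/
def IsZariskiDenseOpen {σ : Type} (U : Set (σ → K)) : Prop :=
  IsZariskiOpen U ∧ ∀ V : Set (σ → K), IsZariskiOpen V → V.Nonempty → (U ∩ V).Nonempty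

/-- The elements `∑_j a_ij x_j`, `i = 1, …, d`, for a matrix `(a_ij)` of power series. -/
def combination (a : Fin d × Fin m → MvPowerSeries (Fin m) K) (i : Fin d) :
    MvPowerSeries (Fin m) K :=
  ∑ j, a (i, j) * MvPowerSeries.X j

/-- The matrix `(a_ij)` modulo the maximal ideal, a point of `K^(dm)`. -/
def residue (a : Fin d × Fin m → MvPowerSeries (Fin m) K) : Fin d × Fin m → K :=
  fun p => MvPowerSeries.constantCoeff (a p)

variable (d τ) in
/-- Local `L_d^τ`-admissible submodules.  A sequence of general elements is
`z_i = ∑_j a_ij x_j` with the residues `(a_ij)` in a suitable dense open subset of `K^(dm)`.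
As usual, "there is a sequence of general elements `z` such that `P(z)`" means that `P(z)` is not
confined to the complement of a dense open set: every dense open set contains the residues of some
`z` with `P(z)`. -/
def IsLocalAdmissible (W : Submodule (MvPowerSeries (Fin m) K) (DividedPower m K)) : Prop :=
  ∀ U : Set (Fin d × Fin m → K), IsZariskiDenseOpen U →
    ∃ (a : Fin d × Fin m → MvPowerSeries (Fin m) K) (y : Fin m → MvPowerSeries (Fin m) K)
      (e : Fin d ↪ Fin m) (Z : (Fin m →₀ ℕ) → DividedPower m K)
      (H : (Fin d → ℕ) → Fin τ → DividedPower m K) (s : (Fin d → ℕ) → ℕ),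
      residue a ∈ U ∧ (∀ i, y (e i) = combination a i) ∧
        IsAdmissibleSystem (powerSeriesMaximal m K) W y e Z H s

/-- The data of `IsAdmissibleSystem` in the graded case: the `H_n^j` are homogeneous and the
`y_i` are linear forms.  (A sequence of linear forms of the polynomial ring is regular if and only
if it extends to a system of `m` linear forms generating the maximal homogeneous ideal.) -/
structure IsGradedAdmissibleSystem (W : Submodule (MvPolynomial (Fin m) K) (DividedPower m K))
    (y : Fin m → MvPolynomial (Fin m) K) (e : Fin d ↪ Fin m)
    (Z : (Fin m →₀ ℕ) → DividedPower m K)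
    (H : (Fin d → ℕ) → Fin τ → DividedPower m K) (s : (Fin d → ℕ) → ℕ) : Prop
    extends IsAdmissibleSystem (polynomialMaximal m K) W y e Z H s where
  linear : ∀ i, (y i).IsHomogeneous 1
  homogeneous : ∀ n : Fin d → ℕ, (∀ i, 0 < n i) → ∀ j, (H n j).IsHomogeneous (s n)

variable (d τ) in
/-- Graded `L_d^τ`-admissible submodules. -/
def IsGradedAdmissible (W : Submodule (MvPolynomial (Fin m) K) (DividedPower m K)) : Prop :=
  ∃ (y : Fin m → MvPolynomial (Fin m) K) (e : Fin d ↪ Fin m)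
    (Z : (Fin m →₀ ℕ) → DividedPower m K)
    (H : (Fin d → ℕ) → Fin τ → DividedPower m K) (s : (Fin d → ℕ) → ℕ),
    IsGradedAdmissibleSystem W y e Z H s

end Admissible

/-! ### Cohen-Macaulayness and type -/

section CohenMacaulay

open CategoryTheory Abelian

/-- For a Noetherian ring `A` that is local with maximal ideal `m`, or a standard graded `K`-algebra
with maximal homogeneous ideal `m`: `A` has Krull dimension `d`, and there is an `A`-regular
sequence of length `d` in `m`, i.e. `A` is Cohen-Macaulay of dimension `d`. -/
def IsCohenMacaulayOfDim {A : Type u} [CommRing A] (m : Ideal A) (d : ℕ) : Prop :=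
  ringKrullDim A = d ∧
    ∃ rs : List A, rs.length = d ∧ (∀ r ∈ rs, r ∈ m) ∧ RingTheory.Sequence.IsRegular A rs

/-- The (Cohen-Macaulay) type of `A` of dimension `d` is `τ`: the dimension over `A/m` (which is
the length as an `A`-module) of `Ext^d_A(A/m, A)` is `τ`. -/
def HasType {A : Type u} [CommRing A] (m : Ideal A) (d τ : ℕ) : Prop :=
  Module.length A (Ext.{u} (ModuleCat.of A (A ⧸ m)) (ModuleCat.of A A) d) = τ

end CohenMacaulay

/-! ### Local level algebras -/

section Local

variable {m : ℕ} {K : Type u} [Field K]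

/-- For an ideal `Q` of `R = K⟦x_1, …, x_m⟧`, the ring `B = R/Q` is an Artinian level `K`-algebra:
`B` is Artinian, and its socle `(0 :_B n)` equals `n^s`, where `n` is the maximal ideal of `B` and
the socle degree `s` is the largest integer with `n^s ≠ 0`. -/
def IsArtinianLevel (Q : Ideal (MvPowerSeries (Fin m) K)) : Prop :=
  IsArtinianRing (MvPowerSeries (Fin m) K ⧸ Q) ∧
    ∃ s : ℕ,
      (powerSeriesMaximal m K).map (Ideal.Quotient.mk Q) ^ s ≠ ⊥ ∧
      (powerSeriesMaximal m K).map (Ideal.Quotient.mk Q) ^ (s + 1) = ⊥ ∧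
      Submodule.annihilator ((powerSeriesMaximal m K).map (Ideal.Quotient.mk Q)) =
        (powerSeriesMaximal m K).map (Ideal.Quotient.mk Q) ^ s

/-- `A = K⟦x_1, …, x_m⟧/I` is a (local) level `K`-algebra of dimension `d` and type `τ`: it is
Cohen-Macaulay of dimension `d`, has type `τ`, and `A/J` is an Artinian level `K`-algebra for every
general minimal reduction `J` of the maximal ideal of `A`, i.e. for every ideal `J` of `A` generated
by `d` general elements: elements `∑_j a_ij x_j`, `i = 1, …, d`, whose matrix `(a_ij)` of
coefficients has residues in some dense open subset of `K^(dm)`. -/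
def IsLocalLevel (I : Ideal (MvPowerSeries (Fin m) K)) (d τ : ℕ) : Prop :=
  IsCohenMacaulayOfDim ((powerSeriesMaximal m K).map (Ideal.Quotient.mk I)) d ∧
  HasType ((powerSeriesMaximal m K).map (Ideal.Quotient.mk I)) d τ ∧
  ∃ U : Set (Fin d × Fin m → K), IsZariskiDenseOpen U ∧
    ∀ a : Fin d × Fin m → MvPowerSeries (Fin m) K, residue a ∈ U →
      IsArtinianLevel (I ⊔ Ideal.span (Set.range (combination a)))

end Local

/-! ### Graded level algebras -/

section Graded

variable {m : ℕ} {K : Type u} [Field K]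

/-- `p` is zero or homogeneous of the (possibly negative) degree `e`. -/
def IsHomogeneousOfDegree (p : MvPolynomial (Fin m) K) (e : ℤ) : Prop :=
  ∀ k ∈ p.support, (k.degree : ℤ) = e

/-- A graded free resolution `⋯ → F_2 → F_1 → F_0 → R/I → 0` over `R = K[x_1, …, x_m]` by finitely
generated graded free modules `F_i = ⨁_k R(-shift i k)`.  The map `F_{i+1} → F_i` is given by the
matrix `diff i`, and `F_0 → R/I` sends the `k`-th basis element to the class of `aug k`; all maps
are homogeneous of degree `0`. -/
structure GradedFreeResolution (I : Ideal (MvPolynomial (Fin m) K)) where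
  rank : ℕ → ℕ
  shift : (i : ℕ) → Fin (rank i) → ℤ
  diff : (i : ℕ) → Matrix (Fin (rank i)) (Fin (rank (i + 1))) (MvPolynomial (Fin m) K)
  aug : Fin (rank 0) → MvPolynomial (Fin m) K
  diff_homogeneous : ∀ i k l,
    IsHomogeneousOfDegree (diff i k l) (shift (i + 1) l - shift i k)
  aug_homogeneous : ∀ k, IsHomogeneousOfDegree (aug k) (shift 0 k)
  aug_surjective : I ⊔ Ideal.span (Set.range aug) = ⊤
  exact_zero : ∀ v : Fin (rank 0) → MvPolynomial (Fin m) K,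
    (∑ k, v k * aug k ∈ I) ↔ v ∈ LinearMap.range (diff 0).mulVecLin
  exact_succ : ∀ i,
    LinearMap.ker (diff i).mulVecLin = LinearMap.range (diff (i + 1)).mulVecLin

namespace GradedFreeResolution

variable {I : Ideal (MvPolynomial (Fin m) K)} (F : GradedFreeResolution I)

/-- The coboundaries in cohomological degree `p` of the complex `Hom_R(F, R)`. -/
def coboundaries : (p : ℕ) →
    Submodule (MvPolynomial (Fin m) K) (Fin (F.rank p) → MvPolynomial (Fin m) K)
  | 0 => ⊥
  | p + 1 => LinearMap.range (F.diff p).transpose.mulVecLin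

/-- The cocycles in cohomological degree `p` of the complex `Hom_R(F, R)`. -/
def cocycles (p : ℕ) :
    Submodule (MvPolynomial (Fin m) K) (Fin (F.rank p) → MvPolynomial (Fin m) K) :=
  LinearMap.ker (F.diff p).transpose.mulVecLin

/-- The module `Ext^p_R(R/I, R(-m))`, computed as the `p`-th cohomology of `Hom_R(F, R(-m))`.
For `R/I` Cohen-Macaulay of dimension `d` and `p = m - d` this is the canonical module. -/
abbrev ExtModule (p : ℕ) : Type u :=
  F.cocycles p ⧸ (F.coboundaries p).comap (F.cocycles p).subtype

/-- The elements of degree `c` of `Ext^p_R(R/I, R(-m))`.  In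
`Hom_R(F_p, R(-m)) = ⨁_k R(shift p k - m)`, a vector `v` has degree `c` if and only if `v k` has
degree `c + shift p k - m` in `R` for all `k`. -/
def extDegree (p : ℕ) (c : ℤ) : Set (F.ExtModule p) :=
  {w | ∃ v : F.cocycles p,
    (∀ k, IsHomogeneousOfDegree (v.1 k) (c + F.shift p k - m)) ∧ Submodule.Quotient.mk v = w}

end GradedFreeResolution

/-- `A = K[x_1, …, x_m]/I` is a graded level `K`-algebra of dimension `d` and type `τ`: the ideal `I`
is homogeneous, `A` is Cohen-Macaulay of dimension `d` and type `τ`, and the graded canonical module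
`ω_A = Ext^{m-d}_R(A, R(-m))` is generated by elements of one and the same degree. -/
def IsGradedLevel (I : Ideal (MvPolynomial (Fin m) K)) (d τ : ℕ) : Prop :=
  (∀ f ∈ I, ∀ i, MvPolynomial.homogeneousComponent i f ∈ I) ∧
  IsCohenMacaulayOfDim ((polynomialMaximal m K).map (Ideal.Quotient.mk I)) d ∧
  HasType ((polynomialMaximal m K).map (Ideal.Quotient.mk I)) d τ ∧
  ∃ (F : GradedFreeResolution I) (c : ℤ),
    Submodule.span (MvPolynomial (Fin m) K) (F.extDegree (m - d) c) = ⊤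

end Graded

end

/-! ### The contraction pairing -/

namespace DividedPower

variable {m : ℕ} {K : Type u} [Field K]

/-! The pairing (f, F) ↦ (f ∘ F)_0 identifies power series with the K-linear forms on the divided
power ring D. A form F ↦ (f ∘ F)_0 on W that vanishes on the elements killed by g_1, …, g_r factors
through F ↦ (g_i ∘ F)_i and extends to D^r, so f is congruent to some Σ h_i g_i modulo ann(W). This
is `annihilatorDuality_powerSeries`; over polynomials the h_i can be truncated when everything is
homogeneous (`annihilatorDuality_polynomial`).

In dual coordinates, condition 3 says that an element of W_n killed by z_i^(n_i - 1) lies in W_(n -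
e_i) (`mem_levelSubmodule_sub`). Descending index by index, W_n is exactly the part of W killed by
all z_i^(n_i), and duality gives ann(W_n) = ann(W) + (z_1^(n_1), …, z_d^(n_d)). Since each H_n^j is
z_i times H_(n + e_i)^j, the same duality makes z_1, …, z_d a regular sequence (`mem_of_mul_mem`).
Independence of the top forms of the H_1^j says that the socle of R/ann(W_1) is represented by forms
of top degree and has dimension τ (`exists_socle_basis`). Rees' theorem identifies it with Ext^d(K,
A), which gives the type.

In the local case levelness must be shown for all z with residues in a dense open set, whereas
admissibility provides only some z in each such set. The lengths of R/(I, z, M^k), for k up to a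
fixed bound, are constant over a dense open set of residues
(`exists_isZariskiDenseOpen_truncLength`). Such z are systems of parameters, hence regular
sequences, and their socles are all isomorphic to Ext^d(K, A). A comparison of lengths with one
admissible sequence then forces the socle to be the top power of the maximal ideal
(`isArtinianLevel_of_truncLength_eq`).

In the graded case A is free over S = K[z_1, …, z_d], on a homogeneous K-basis of A/(z)
(`IsQuotientBasis.isGradedBasis`). With p = m - d and y_1, …, y_p the remaining coordinates, R ⊗_S A
is A[X_1, …, X_p] with X_i = y_i ⊗ 1 - 1 ⊗ y_i, and it is free over R. The Koszul complex of the X_i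
is therefore a graded free resolution of A over R of length p. Its last dual differential presents
the canonical module by multiplication matrices, and the vanishing of the socle of A/(z) below
degree s eliminates all generators but those dual to degree s (`single_mem_of_level`). -/

theorem ext_coeff {F G : DividedPower m K} (h : ∀ k, F.coeff k = G.coeff k) : F = G :=
  Finsupp.ext h

@[simp] theorem coeff_zero (k : Fin m →₀ ℕ) : (0 : DividedPower m K).coeff k = 0 := rfl

@[simp] theorem coeff_add (k : Fin m →₀ ℕ) (F G : DividedPower m K) :
    (F + G).coeff k = F.coeff k + G.coeff k := rfl

@[simp] theorem coeff_sub (k : Fin m →₀ ℕ) (F G : DividedPower m K) :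
    (F - G).coeff k = F.coeff k - G.coeff k := rfl

@[simp] theorem coeff_smul (k : Fin m →₀ ℕ) (c : K) (F : DividedPower m K) :
    (c • F).coeff k = c * F.coeff k := rfl

theorem coeff_monomial (k n : Fin m →₀ ℕ) (b : K) [Decidable (n = k)] :
    (monomial n b : DividedPower m K).coeff k = if n = k then b else 0 := by
  classical
  have := Finsupp.single_apply (a := n) (a' := k) (b := b)
  refine this.trans ?_
  congr

/-- The coefficient of `X^k`, as a linear form. -/
def coeffLinear (k : Fin m →₀ ℕ) : DividedPower m K →ₗ[K] K := Finsupp.lapply k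

theorem coeff_sum {ι : Type*} (s : Finset ι) (k : Fin m →₀ ℕ) (F : ι → DividedPower m K) :
    (∑ i ∈ s, F i).coeff k = ∑ i ∈ s, (F i).coeff k :=
  map_sum (coeffLinear k) F s

theorem mem_support {F : DividedPower m K} {k : Fin m →₀ ℕ} : k ∈ F.support ↔ F.coeff k ≠ 0 :=
  Finsupp.mem_support_iff

theorem smul_comm_field (f : MvPowerSeries (Fin m) K) (c : K) (F : DividedPower m K) :
    f • (c • F) = c • (f • F) :=
  map_smul (contract f) c F

theorem contract_apply_zero (f : MvPowerSeries (Fin m) K) (F : (Fin m →₀ ℕ) →₀ K) :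
    (contract f F) 0 = ∑ n ∈ F.support, F n * MvPowerSeries.coeff n f := by
  classical
  rw [contract, Finsupp.linearCombination_apply, Finsupp.sum, Finsupp.finsetSum_apply]
  refine Finset.sum_congr rfl fun n _ => ?_
  rw [Finsupp.smul_apply, Finsupp.finsetSum_apply, smul_eq_mul]
  congr 1
  rw [Finset.sum_eq_single (0, n)]
  · simp
  · rintro ⟨a, b⟩ hp hne
    simp only [Finset.HasAntidiagonal.mem_antidiagonal] at hp
    rw [Finsupp.single_apply, if_neg]
    rintro rfl
    apply hne
    simpa using hp
  · intro h
    simp at h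

theorem coeff_zero_smul (f : MvPowerSeries (Fin m) K) (F : DividedPower m K) :
    (f • F).coeff 0 = ∑ n ∈ F.support, F.coeff n * MvPowerSeries.coeff n f :=
  contract_apply_zero f F

/-- All coefficients are constant terms of contractions, so an identity of constant terms that holds
after every contraction is an identity of elements. -/
theorem coeff_smul_monomial (k : Fin m →₀ ℕ) (F : DividedPower m K) :
    ((MvPowerSeries.monomial k (1 : K)) • F).coeff 0 = F.coeff k := by
  classical
  rw [coeff_zero_smul]
  simp only [MvPowerSeries.coeff_monomial, mul_ite, mul_one, mul_zero]
  rw [Finset.sum_ite_eq', ite_eq_left_iff, mem_support, not_not]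
  exact fun h => h.symm

theorem C_smul (c : K) (F : DividedPower m K) :
    (MvPowerSeries.C c : MvPowerSeries (Fin m) K) • F = c • F := by
  refine ext_coeff fun k => ?_
  rw [← coeff_smul_monomial, smul_smul, coeff_smul, mul_comm, mul_smul, coeff_zero_smul,
    ← coeff_smul_monomial k F, Finset.sum_eq_single 0]
  · rw [MvPowerSeries.coeff_zero_C, mul_comm]
  · intro b _ hb
    rw [MvPowerSeries.coeff_C, if_neg hb, mul_zero]
  · intro h
    rw [mem_support, not_not] at h
    rw [h, zero_mul]

theorem X_smul_coeff (i : Fin m) (k : Fin m →₀ ℕ) (F : DividedPower m K) :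
    ((MvPowerSeries.X i : MvPowerSeries (Fin m) K) • F).coeff k =
      F.coeff (k + Finsupp.single i 1) := by
  rw [← coeff_smul_monomial, smul_smul, MvPowerSeries.X, MvPowerSeries.monomial_mul_monomial,
    one_mul, coeff_smul_monomial]

end DividedPower

/-- A ring between the polynomial ring and the power series ring, acting on the divided power
ring through power series; `x` are the variables. -/
structure IsContractionRing {m : ℕ} {K : Type u} [Field K] {R : Type u} [CommRing R]
    [Module R (DividedPower m K)] (x : Fin m → R) (c : K →+* R)
    (ι : R →+* MvPowerSeries (Fin m) K) : Prop where
  smul_eq : ∀ r (F : DividedPower m K), r • F = ι r • F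
  map_x : ∀ i, ι (x i) = MvPowerSeries.X i
  map_c : ∀ a, ι (c a) = MvPowerSeries.C a
  sub_mem : ∀ r, r - c (MvPowerSeries.constantCoeff (ι r)) ∈ Ideal.span (Set.range x)

theorem MvPowerSeries.mem_span_range_X {m : ℕ} {K : Type u} [Field K]
    {f : MvPowerSeries (Fin m) K} (hf : MvPowerSeries.constantCoeff f = 0) :
    f ∈ Ideal.span (Set.range (MvPowerSeries.X : Fin m → MvPowerSeries (Fin m) K)) := by
  classical
  have hex : ∀ k : Fin m →₀ ℕ, k ≠ 0 → ∃ i, k i ≠ 0 := fun k hk => by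
    simpa using Finsupp.ne_iff.mp hk
  -- Each nonzero exponent is assigned to one variable that occurs in it; `g i` collects the terms
  -- of `f` assigned to `i`, divided by that variable.
  let p : (Fin m →₀ ℕ) → Fin m → Prop := fun k i => ∃ h : k ≠ 0, i = (hex k h).choose
  let g : Fin m → MvPowerSeries (Fin m) K := fun i k =>
    if p (k + Finsupp.single i 1) i then MvPowerSeries.coeff (k + Finsupp.single i 1) f else 0
  have hsum : f = ∑ i, g i * MvPowerSeries.X i := by
    ext k
    rw [map_sum]
    by_cases hk : k = 0
    · subst hk
      rw [MvPowerSeries.coeff_zero_eq_constantCoeff_apply, hf]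
      simp
    · set j := (hex k hk).choose with hj
      have hkj : k j ≠ 0 := (hex k hk).choose_spec
      have hle : ∀ i, k i ≠ 0 → Finsupp.single i 1 ≤ k := fun i hi => by
        rw [Finsupp.single_le_iff]; omega
      rw [Finset.sum_eq_single j]
      · rw [MvPowerSeries.X, MvPowerSeries.coeff_mul_monomial, if_pos (hle j hkj), mul_one]
        change _ = if _ then _ else _
        rw [tsub_add_cancel_of_le (hle j hkj), if_pos ⟨hk, hj⟩]
      · intro i _ hi
        rw [MvPowerSeries.X, MvPowerSeries.coeff_mul_monomial]
        split_ifs with h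
        · rw [mul_one]
          change (if _ then _ else _) = _
          rw [tsub_add_cancel_of_le h, if_neg]
          rintro ⟨_, h'⟩
          exact hi h'
        · rfl
      · simp
  rw [hsum]
  exact Ideal.sum_mem _ fun i _ => Ideal.mul_mem_left _ _ (Ideal.subset_span ⟨i, rfl⟩)

theorem isContractionRing_powerSeries (m : ℕ) (K : Type u) [Field K] :
    IsContractionRing (MvPowerSeries.X : Fin m → MvPowerSeries (Fin m) K) MvPowerSeries.C
      (RingHom.id _) :=
  ⟨fun _ _ => rfl, fun _ => rfl, fun _ => rfl, fun r =>
    MvPowerSeries.mem_span_range_X (by simp)⟩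

theorem isContractionRing_polynomial (m : ℕ) (K : Type u) [Field K] :
    IsContractionRing (MvPolynomial.X : Fin m → MvPolynomial (Fin m) K) MvPolynomial.C
      MvPolynomial.coeToMvPowerSeries.ringHom :=
  ⟨fun _ _ => rfl, fun _ => by simp, fun _ => by simp, fun r => by
    rw [← Set.image_univ, MvPolynomial.mem_ideal_span_X_image]
    intro k hk
    by_contra h
    have h0 : k = 0 := Finsupp.ext fun i => by
      by_contra h1
      exact h ⟨i, Set.mem_univ i, h1⟩
    rw [MvPolynomial.mem_support_iff, h0] at hk
    apply hk
    rw [MvPolynomial.coeff_sub, MvPolynomial.coeff_zero_C,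
      MvPolynomial.coeToMvPowerSeries.ringHom_apply,
      ← MvPowerSeries.coeff_zero_eq_constantCoeff_apply, MvPolynomial.coeff_coe, sub_self]⟩

namespace IsContractionRing

open DividedPower

variable {m : ℕ} {K : Type u} [Field K] {R : Type u} [CommRing R] [Module R (DividedPower m K)]
  {x : Fin m → R} {c : K →+* R} {ι : R →+* MvPowerSeries (Fin m) K}
  (hR : IsContractionRing x c ι)

include hR

theorem x_smul_coeff (i : Fin m) (k : Fin m →₀ ℕ) (F : DividedPower m K) :
    (x i • F).coeff k = F.coeff (k + Finsupp.single i 1) := by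
  rw [hR.smul_eq, hR.map_x, X_smul_coeff]

theorem c_smul (a : K) (F : DividedPower m K) : c a • F = a • F := by
  rw [hR.smul_eq, hR.map_c, C_smul]

theorem smul_smul_comm (r : R) (a : K) (F : DividedPower m K) : r • (a • F) = a • (r • F) := by
  rw [hR.smul_eq, smul_comm_field, ← hR.smul_eq]

/-- The action of `r` as a `K`-linear map. -/
noncomputable def smulLinear (r : R) : DividedPower m K →ₗ[K] DividedPower m K where
  toFun F := r • F
  map_add' := smul_add r
  map_smul' a F := hR.smul_smul_comm r a F

theorem smul_sum_smul {α : Type*} (s : Finset α) (r : R) (a : α → K) (F : α → DividedPower m K) :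
    r • ∑ i ∈ s, a i • F i = ∑ i ∈ s, a i • (r • F i) := by
  rw [Finset.smul_sum]
  exact Finset.sum_congr rfl fun i _ => hR.smul_smul_comm _ _ _

theorem field_smul_mem (W : Submodule R (DividedPower m K)) (a : K) {F : DividedPower m K}
    (hF : F ∈ W) : a • F ∈ W := by
  rw [← hR.c_smul]
  exact W.smul_mem _ hF

/-- An `R`-submodule as a `K`-subspace. -/
def toSubspace (W : Submodule R (DividedPower m K)) : Submodule K (DividedPower m K) where
  carrier := W
  add_mem' := W.add_mem
  zero_mem' := W.zero_mem
  smul_mem' a _ hF := hR.field_smul_mem W a hF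

theorem map_monomial (k : Fin m →₀ ℕ) :
    ι (k.prod fun i a => x i ^ a) = MvPowerSeries.monomial k 1 := by
  rw [Finsupp.prod, map_prod, MvPowerSeries.monomial_one_eq, Finsupp.prod]
  simp only [map_pow, hR.map_x]

theorem coeff_monomial_smul (k : Fin m →₀ ℕ) (F : DividedPower m K) :
    ((k.prod fun i a => x i ^ a) • F).coeff 0 = F.coeff k := by
  rw [hR.smul_eq, hR.map_monomial, coeff_smul_monomial]

theorem eq_zero_of_coeff (F : DividedPower m K) (h : ∀ r : R, (r • F).coeff 0 = 0) : F = 0 :=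
  ext_coeff fun k => by rw [← hR.coeff_monomial_smul, h, coeff_zero]

/-- Contraction by a variable lowers every exponent by one degree. The strict bound makes the case
`s = 0` say that `F` vanishes. -/
theorem pow_smul_eq_zero {s : ℕ} {F : DividedPower m K}
    (hF : ∀ k : Fin m →₀ ℕ, F.coeff k ≠ 0 → k.degree < s) {r : R}
    (hr : r ∈ Ideal.span (Set.range x) ^ s) : r • F = 0 := by
  induction s generalizing F r with
  | zero =>
    have : F = 0 := ext_coeff fun k => by
      by_contra h
      exact absurd (hF k h) (Nat.not_lt_zero _)
    rw [this, smul_zero]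
  | succ s ih =>
    rw [pow_succ] at hr
    refine Submodule.smul_induction_on hr ?_ ?_
    · intro a ha b hb
      refine Submodule.span_induction ?_ ?_ ?_ ?_ hb
      · rintro _ ⟨i, rfl⟩
        rw [smul_eq_mul, mul_smul]
        refine ih (fun k hk => ?_) ha
        rw [hR.x_smul_coeff] at hk
        have := hF _ hk
        rw [map_add, Finsupp.degree_single] at this
        omega
      · simp
      · intro u v _ _ hu hv
        rw [smul_add, add_smul, hu, hv, add_zero]
      · intro t u _ hu
        rw [smul_comm, smul_eq_mul t, mul_smul, hu, smul_zero]
    · intro u v hu hv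
      rw [add_smul, hu, hv, add_zero]

theorem pow_smul_eq_zero_of_degree {s : ℕ} {F : DividedPower m K} (hF : F.degree ≤ s) {r : R}
    (hr : r ∈ Ideal.span (Set.range x) ^ (s + 1)) : r • F = 0 := by
  refine hR.pow_smul_eq_zero (fun k hk => ?_) hr
  have : k.degree ≤ F.degree := Finset.le_sup (f := fun k : Fin m →₀ ℕ => k.degree)
    (mem_support.mpr hk)
  omega

omit hR [Module R (DividedPower m K)] in
theorem monomial_mem_pow {y : Fin m → R} {M : Ideal R} (hy : ∀ i, y i ∈ M) (k : Fin m →₀ ℕ) :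
    (k.prod fun i a => y i ^ a) ∈ M ^ k.degree := by
  rw [Finsupp.prod, Finsupp.degree_apply, ← Finset.prod_pow_eq_pow_sum]
  exact Ideal.prod_mem_prod fun i _ => Ideal.pow_mem_pow (hy i) _

/-- A coefficient at `k ≠ 0` is the constant term of a contraction by a monomial in the maximal
ideal, hence zero. The socle of D thus consists of the constants. -/
theorem eq_monomial_of_smul_eq_zero {F : DividedPower m K}
    (hF : ∀ r ∈ Ideal.span (Set.range x), r • F = 0) : F = monomial 0 (F.coeff 0) := by
  classical
  refine ext_coeff fun k => ?_
  rw [coeff_monomial]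
  split_ifs with h
  · rw [h]
  · rw [← hR.coeff_monomial_smul]
    rw [hF, coeff_zero]
    have h1 : 1 ≤ k.degree := by
      rw [Nat.one_le_iff_ne_zero, ne_eq, Finsupp.degree_eq_zero_iff]
      exact fun h' => h h'.symm
    exact Ideal.pow_le_self (by omega)
      (monomial_mem_pow (fun i => Ideal.subset_span (Set.mem_range_self i)) k)

/-- If `y` generates the maximal ideal, an element killed by a power of it is determined by the
constant terms of its contractions with the monomials in `y`. -/
theorem eq_zero_of_coeff_monomial {y : Fin m → R}
    (hy : Ideal.span (Set.range y) = Ideal.span (Set.range x)) {N : ℕ} {F : DividedPower m K}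
    (hN : ∀ r ∈ Ideal.span (Set.range x) ^ N, r • F = 0)
    (hF : ∀ k : Fin m →₀ ℕ, ((k.prod fun i a => y i ^ a) • F).coeff 0 = 0) : F = 0 := by
  induction N generalizing F with
  | zero => simpa using hN 1 (by simp)
  | succ N ih =>
    -- Each `y i • F` is killed by the smaller power, and its pairings with monomials are pairings
    -- of `F` with longer monomials, so induction applies to it.
    have h1 : ∀ i, y i • F = 0 := fun i => by
      refine ih (fun r hr => ?_) (fun k => ?_)
      · rw [smul_smul]
        refine hN _ ?_
        rw [pow_succ]
        exact Ideal.mul_mem_mul hr (hy ▸ Ideal.subset_span ⟨i, rfl⟩)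
      · have := hF (k + Finsupp.single i 1)
        rw [Finsupp.prod_add_index' (by simp) (by intros; exact pow_add _ _ _),
          Finsupp.prod_single_index (by simp), pow_one, mul_smul] at this
        exact this
    have h2 : ∀ r ∈ Ideal.span (Set.range x), r • F = 0 := by
      rw [← hy]
      intro r hr
      refine Submodule.span_induction ?_ (zero_smul _ _) ?_ ?_ hr
      · rintro _ ⟨i, rfl⟩
        exact h1 i
      · intro u v _ _ hu hv
        rw [add_smul, hu, hv, add_zero]
      · intro t u _ hu
        rw [smul_eq_mul, mul_smul, hu, smul_zero]
    have h3 := hR.eq_monomial_of_smul_eq_zero h2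
    have h4 := hF 0
    rw [Finsupp.prod_zero_index, one_smul] at h4
    rw [h3, h4]
    exact Finsupp.single_zero _

end IsContractionRing

/-! ### Monomials in the coordinates dual to a system of generators -/

namespace IsDualMonomials

open DividedPower

variable {m : ℕ} {K : Type u} [Field K] {R : Type u} [CommRing R] [Module R (DividedPower m K)]
  {y : Fin m → R} {Z : (Fin m →₀ ℕ) → DividedPower m K} (hZ : IsDualMonomials y Z)

include hZ

theorem pow_smul (i : Fin m) (a : ℕ) (l : Fin m →₀ ℕ) :
    y i ^ a • Z l = if a ≤ l i then Z (l - Finsupp.single i a) else 0 := by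
  induction a generalizing l with
  | zero => simp
  | succ a ih =>
    rw [pow_succ, mul_smul, hZ.contract]
    split_ifs with h1 h2 h2
    · omega
    · rw [smul_zero]
    · rw [ih, if_pos, tsub_tsub, ← Finsupp.single_add, add_comm]
      simp only [Finsupp.coe_tsub, Pi.sub_apply, Finsupp.single_eq_same]
      omega
    · rw [ih, if_neg]
      simp only [Finsupp.coe_tsub, Pi.sub_apply, Finsupp.single_eq_same]
      omega

theorem monomial_smul (k l : Fin m →₀ ℕ) [Decidable (k ≤ l)] :
    (k.prod fun i a => y i ^ a) • Z l = if k ≤ l then Z (l - k) else 0 := by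
  classical
  suffices h : (k.prod fun i a => y i ^ a) • Z l = @ite _ (k ≤ l) (Classical.dec _) (Z (l - k)) 0 by
    rw [h]; congr
  induction k using Finsupp.induction generalizing l with
  | zero => simp
  | single_add i a k hi ha ih =>
    rw [Finsupp.prod_add_index' (by simp) (by intros; exact pow_add _ _ _),
      Finsupp.prod_single_index (by simp), mul_smul, ih]
    have hk : k i = 0 := by simpa using hi
    have key : Finsupp.single i a + k ≤ l ↔ k ≤ l ∧ a ≤ l i := by
      constructor
      · intro h
        refine ⟨le_trans (le_add_of_nonneg_left zero_le) h, ?_⟩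
        have := h i
        simp only [Finsupp.coe_add, Pi.add_apply, Finsupp.single_eq_same] at this
        omega
      · rintro ⟨h, h'⟩ j
        have := h j
        by_cases hj : j = i
        · subst hj; simp [hk, h']
        · simpa [Finsupp.single_eq_of_ne hj] using this
    by_cases h : k ≤ l
    · rw [if_pos h, hZ.pow_smul]
      have e : (l - k) i = l i := by simp [hk]
      rw [e, tsub_tsub, add_comm k]
      simp only [key, h, true_and]
    · rw [if_neg h, smul_zero, if_neg]
      exact fun h' => h (key.mp h').1

theorem coeff_monomial_smul (k l : Fin m →₀ ℕ) [Decidable (k = l)] :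
    ((k.prod fun i a => y i ^ a) • Z l).coeff 0 = if k = l then 1 else 0 := by
  classical
  rw [hZ.monomial_smul]
  by_cases h : k ≤ l
  · rw [if_pos h]
    by_cases h' : k = l
    · subst h'
      simp [hZ.one, DividedPower.coeff_monomial]
    · rw [if_neg h', hZ.constant_term]
      intro h2
      exact h' (le_antisymm h (tsub_eq_zero_iff_le.mp h2))
  · rw [if_neg h, if_neg, coeff_zero]
    rintro rfl
    exact h le_rfl

/-- The `Z k` are dual to the monomials in `y`, so subtracting the right-hand side annuls all
pairings with these monomials. Those of degree above `s` lie in the power of the maximal ideal that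
kills `F`, so a finite sum suffices. -/
theorem expansion {x : Fin m → R} {c : K →+* R} {ι : R →+* MvPowerSeries (Fin m) K}
    (hR : IsContractionRing x c ι) (hy : Ideal.span (Set.range y) = Ideal.span (Set.range x))
    {s : ℕ} {F : DividedPower m K}
    (hF : ∀ r ∈ Ideal.span (Set.range x) ^ (s + 1), r • F = 0) :
    F = ∑ k ∈ (Finsupp.finite_of_degree_le (σ := Fin m) s).toFinset,
      ((k.prod fun i a => y i ^ a) • F).coeff 0 • Z k := by
  classical
  have hym : ∀ i, y i ∈ Ideal.span (Set.range x) := fun i => hy ▸ Ideal.subset_span ⟨i, rfl⟩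
  rw [← sub_eq_zero]
  refine hR.eq_zero_of_coeff_monomial hy (N := s + 1) ?_ ?_
  · intro r hr
    rw [smul_sub, hF r hr, hR.smul_sum_smul, zero_sub, neg_eq_zero]
    refine Finset.sum_eq_zero fun k hk => ?_
    have hk' : k.degree ≤ s := by simpa using hk
    suffices h : r • Z k = 0 by rw [h, smul_zero]
    rw [← hy] at hr
    -- Each `y i` lowers the degree of `Z k` by one or kills it; the bound is generalised for the
    -- induction.
    have key : ∀ (s : ℕ) (k : Fin m →₀ ℕ), k.degree < s →
        ∀ r ∈ Ideal.span (Set.range y) ^ s, r • Z k = 0 := by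
      intro s
      induction s with
      | zero => intro k hk; omega
      | succ s ih =>
        intro k hk r hr
        rw [pow_succ] at hr
        refine Submodule.smul_induction_on hr ?_ ?_
        · intro a ha b hb
          refine Submodule.span_induction ?_ ?_ ?_ ?_ hb
          · rintro _ ⟨i, rfl⟩
            rw [smul_eq_mul, mul_smul, hZ.contract]
            split_ifs with h
            · rw [smul_zero]
            · refine ih _ ?_ _ ha
              have h1 : Finsupp.single i 1 ≤ k := by
                rw [Finsupp.single_le_iff]; omega
              have h2 : (k - Finsupp.single i 1 + Finsupp.single i 1).degree = k.degree := by
                rw [tsub_add_cancel_of_le h1]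
              rw [map_add, Finsupp.degree_single] at h2
              omega
          · simp
          · intro u v _ _ hu hv
            rw [smul_add, add_smul, hu, hv, add_zero]
          · intro t u _ hu
            rw [smul_comm, smul_eq_mul t, mul_smul, hu, smul_zero]
        · intro u v hu hv
          rw [add_smul, hu, hv, add_zero]
    exact key (s + 1) k (by omega) r hr
  · intro l
    rw [smul_sub, hR.smul_sum_smul, coeff_sub, coeff_sum]
    simp only [coeff_smul, hZ.coeff_monomial_smul, mul_ite, mul_one, mul_zero]
    rw [Finset.sum_ite_eq]
    split_ifs with h
    · exact sub_self _
    · rw [sub_zero]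
      have h' : s + 1 ≤ l.degree := by
        have : ¬ l.degree ≤ s := by simpa using h
        omega
      rw [hF _ (Ideal.pow_le_pow_right h' (IsContractionRing.monomial_mem_pow hym l)), coeff_zero]

end IsDualMonomials

/-! ### Structure of admissible systems -/

namespace IsAdmissibleSystem

open DividedPower

variable {m d τ : ℕ} {K : Type u} [Field K] {R : Type u} [CommRing R]
  [Module R (DividedPower m K)] {M : Ideal R} {W : Submodule R (DividedPower m K)}
  {y : Fin m → R} {e : Fin d ↪ Fin m} {Z : (Fin m →₀ ℕ) → DividedPower m K}
  {H : (Fin d → ℕ) → Fin τ → DividedPower m K} {s : (Fin d → ℕ) → ℕ}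
  (hS : IsAdmissibleSystem M W y e Z H s)

include hS

theorem y_mem (i : Fin m) : y i ∈ M :=
  hS.generators_maximal ▸ Ideal.subset_span ⟨i, rfl⟩

theorem mem_of_pos {n : Fin d → ℕ} (hn : ∀ i, 0 < n i) (j : Fin τ) : H n j ∈ W := by
  rw [hS.generators]
  exact Submodule.subset_span ⟨n, hn, j, rfl⟩

theorem levelSubmodule_le {n : Fin d → ℕ} (hn : ∀ i, 0 < n i) : levelSubmodule R H n ≤ W := by
  refine Submodule.span_le.mpr ?_
  rintro _ ⟨j, rfl⟩
  exact hS.mem_of_pos hn j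

omit hS [Module R (DividedPower m K)] in
theorem prod_pow_add_single (y : Fin m → R) (e : Fin d ↪ Fin m) (α : Fin d → ℕ) (i : Fin d) :
    ∏ l, y (e l) ^ (α + Pi.single i 1 : Fin d → ℕ) l = (∏ l, y (e l) ^ α l) * y (e i) := by
  simp only [Pi.add_apply, pow_add, Finset.prod_mul_distrib]
  congr 1
  rw [Finset.prod_eq_single i]
  · simp
  · intro b _ hb
    simp [Pi.single_eq_of_ne hb]
  · simp

omit hS in
theorem exists_eq_add_single {α : Fin d → ℕ} (h : α ≠ 0) :
    ∃ (β : Fin d → ℕ) (i : Fin d), α = β + Pi.single i 1 ∧ ∑ l, β l < ∑ l, α l := by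
  obtain ⟨i, hi⟩ := Function.ne_iff.mp h
  have h1 : α = α - Pi.single i 1 + Pi.single i 1 := by
    refine (tsub_add_cancel_of_le fun l => ?_).symm
    by_cases hl : l = i
    · subst hl
      simpa [Nat.one_le_iff_ne_zero] using hi
    · simp [Pi.single_eq_of_ne hl]
  refine ⟨α - Pi.single i 1, i, h1, ?_⟩
  conv_rhs => rw [h1]
  simp [Finset.sum_add_distrib]

/-- Peel off the unit vectors of `α` one at a time: positivity of `n` keeps every index at least 2
in the direction being lowered, so the contraction never produces zero. -/
theorem prod_pow_smul {n : Fin d → ℕ} (hn : ∀ i, 0 < n i) (α : Fin d → ℕ) (j : Fin τ) :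
    (∏ l, y (e l) ^ α l) • H (n + α) j = H n j := by
  induction h : ∑ l, α l using Nat.strong_induction_on generalizing α with
  | _ t ih =>
    by_cases hα : α = 0
    · subst hα; simp
    · obtain ⟨β, i, rfl, hlt⟩ := exists_eq_add_single hα
      rw [prod_pow_add_single, mul_smul, hS.contract _ (fun l => by
        have := hn l; simp only [Pi.add_apply]; omega), if_pos, ← add_assoc, add_tsub_cancel_right]
      · exact ih _ (h ▸ hlt) β rfl
      · have := hn i
        simp only [Pi.add_apply, Pi.single_eq_same]; omega

theorem pow_smul {n : Fin d → ℕ} (hn : ∀ i, 0 < n i) (i : Fin d) (j : Fin τ) :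
    y (e i) ^ n i • H n j = 0 := by
  induction h : n i generalizing n with
  | zero => exact absurd (hn i) (by omega)
  | succ t ih =>
    rw [pow_succ, mul_smul, hS.contract n hn]
    split_ifs with h2
    · refine ih (fun l => ?_) ?_
      · by_cases hl : l = i
        · subst hl; simp; omega
        · simpa [Pi.single_eq_of_ne hl] using hn l
      · simp [h]
    · rw [smul_zero]

theorem pow_smul_eq_zero_of_mem {n : Fin d → ℕ} (hn : ∀ i, 0 < n i) (i : Fin d)
    {F : DividedPower m K} (hF : F ∈ levelSubmodule R H n) : y (e i) ^ n i • F = 0 := by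
  refine Submodule.span_induction ?_ (smul_zero _) ?_ ?_ hF
  · rintro _ ⟨j, rfl⟩
    exact hS.pow_smul hn i j
  · intro u v _ _ hu hv
    rw [smul_add, hu, hv, add_zero]
  · intro t u _ hu
    rw [smul_comm, hu, smul_zero]

theorem levelSubmodule_mono {n n' : Fin d → ℕ} (hn : ∀ i, 0 < n i) (h : n ≤ n') :
    levelSubmodule R H n ≤ levelSubmodule R H n' := by
  refine Submodule.span_le.mpr ?_
  rintro _ ⟨j, rfl⟩
  rw [← hS.prod_pow_smul hn (n' - n) j, add_tsub_cancel_of_le h]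
  exact Submodule.smul_mem _ _ (Submodule.subset_span ⟨j, rfl⟩)

/-- The `W_n` form a directed family with union `W`: two indices are both bounded by their supremum.
-/
theorem exists_mem_levelSubmodule (n : Fin d → ℕ) (hn : ∀ i, 0 < n i) {F : DividedPower m K}
    (hF : F ∈ W) : ∃ n', n ≤ n' ∧ F ∈ levelSubmodule R H n' := by
  rw [hS.generators] at hF
  refine Submodule.span_induction ?_ ?_ ?_ ?_ hF
  · rintro _ ⟨n', hn', j, rfl⟩
    refine ⟨n ⊔ n', le_sup_left, hS.levelSubmodule_mono hn' le_sup_right ?_⟩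
    exact Submodule.subset_span ⟨j, rfl⟩
  · exact ⟨n, le_rfl, Submodule.zero_mem _⟩
  · rintro u v _ _ ⟨a, ha, hu⟩ ⟨b, hb, hv⟩
    refine ⟨a ⊔ b, le_trans ha le_sup_left, Submodule.add_mem _
      (hS.levelSubmodule_mono (fun i => lt_of_lt_of_le (hn i) (ha i)) le_sup_left hu)
      (hS.levelSubmodule_mono (fun i => lt_of_lt_of_le (hn i) (hb i)) le_sup_right hv)⟩
  · rintro t u _ ⟨a, ha, hu⟩
    exact ⟨a, ha, Submodule.smul_mem _ _ hu⟩

variable {x : Fin m → R} {c : K →+* R} {ι : R →+* MvPowerSeries (Fin m) K}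
  (hR : IsContractionRing x c ι) (hM : M = Ideal.span (Set.range x))

include hR hM

theorem pow_maximal_smul {n : Fin d → ℕ} (hn : ∀ i, 0 < n i) {F : DividedPower m K}
    (hF : F ∈ levelSubmodule R H n) {r : R} (hr : r ∈ M ^ (s n + 1)) : r • F = 0 := by
  refine Submodule.span_induction ?_ (smul_zero _) ?_ ?_ hF
  · rintro _ ⟨j, rfl⟩
    exact hR.pow_smul_eq_zero_of_degree (hS.degree_eq n hn j).le (hM ▸ hr)
  · intro u v _ _ hu hv
    rw [smul_add, hu, hv, add_zero]
  · intro t u _ hu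
    rw [smul_comm, hu, smul_zero]

/-- A coordinate-free form of condition 3. If z_i^(n_i - 1) kills `F`, its dual expansion contains
no `Z k` with exponent at least n_i - 1 at z_i, which leaves precisely the generators of the bounded
submodule. -/
theorem mem_levelSubmodule_sub {n : Fin d → ℕ} (hn : ∀ i, 0 < n i) {i : Fin d} (hi : 2 ≤ n i)
    {F : DividedPower m K} (hF : F ∈ levelSubmodule R H n) (h0 : y (e i) ^ (n i - 1) • F = 0) :
    F ∈ levelSubmodule R H (n - Pi.single i 1) := by
  refine hS.inter_le n hn i hi ⟨hF, ?_⟩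
  have hy : Ideal.span (Set.range y) = Ideal.span (Set.range x) :=
    hS.generators_maximal.trans hM
  rw [hS.dual.expansion hR hy (s := s n)
    (fun r hr => hS.pow_maximal_smul hR hM hn hF (hM ▸ hr))]
  refine Submodule.sum_mem _ fun k hk => ?_
  have hk' : k.degree ≤ s n := by simpa using hk
  by_cases hki : k (e i) + 2 ≤ n i
  · exact hR.field_smul_mem _ _ (Submodule.subset_span ⟨k, hki, hk', rfl⟩)
  · suffices h : (k.prod fun i a => y i ^ a) • F = 0 by
      rw [h, coeff_zero, zero_smul]
      exact Submodule.zero_mem _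
    have hle : Finsupp.single (e i) (n i - 1) ≤ k := by
      rw [Finsupp.single_le_iff]; omega
    rw [← tsub_add_cancel_of_le hle, Finsupp.prod_add_index' (by simp)
      (by intros; exact pow_add _ _ _), Finsupp.prod_single_index (by simp), mul_smul, h0, smul_zero]

/-- The elements of `W` killed by `z_i ^ n_i`, `i ∈ T`, lie in some `W_n'` with `n'_i = n_i` for
`i ∈ T`. -/
theorem exists_mem_levelSubmodule_of_smul_eq_zero (T : Finset (Fin d)) {n : Fin d → ℕ}
    (hn : ∀ i, 0 < n i) {F : DividedPower m K} (hF : F ∈ W)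
    (h0 : ∀ i ∈ T, y (e i) ^ n i • F = 0) :
    ∃ n', n ≤ n' ∧ (∀ i ∈ T, n' i = n i) ∧ F ∈ levelSubmodule R H n' := by
  obtain ⟨N, hN, hFN⟩ := hS.exists_mem_levelSubmodule n hn hF
  -- Descend on the total excess of `N` over `n` in the directions of `T`.
  induction h : ∑ i ∈ T, (N i - n i) using Nat.strong_induction_on generalizing N with
  | _ t ih =>
    by_cases hT : ∀ i ∈ T, N i = n i
    · exact ⟨N, hN, hT, hFN⟩
    · push Not at hT
      obtain ⟨i, hi, hne⟩ := hT
      have hlt : n i < N i := lt_of_le_of_ne (hN i) (Ne.symm hne)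
      have hle : n ≤ N - Pi.single i 1 := fun l => by
        by_cases hl : l = i
        · subst hl; simp; omega
        · simpa [Pi.single_eq_of_ne hl] using hN l
      refine ih (∑ l ∈ T, ((N - Pi.single i 1 : Fin d → ℕ) l - n l)) ?_ (N - Pi.single i 1) hle
        (hS.mem_levelSubmodule_sub hR hM (fun l => lt_of_lt_of_le (hn l) (hN l))
          (by have := hn i; omega) hFN ?_) rfl
      · rw [← h]
        refine Finset.sum_lt_sum (fun l _ => ?_) ⟨i, hi, ?_⟩
        · simp only [Pi.sub_apply]; omega
        · simp only [Pi.sub_apply, Pi.single_eq_same]; omega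
      -- As `N i > n i`, the exponent `N i - 1` is still at least `n i`.
      · have : N i - 1 = (N i - 1 - n i) + n i := by omega
        rw [this, pow_add, mul_smul, h0 i hi, smul_zero]

end IsAdmissibleSystem

/-- Duality: the annihilator of the elements of `W` killed by `g_1, …, g_r` is the ideal generated
by the annihilator of `W` and by `g_1, …, g_r`. -/
def AnnihilatorDuality {m : ℕ} {K : Type u} [Field K] {R : Type u} [CommRing R]
    [Module R (DividedPower m K)] (W : Submodule R (DividedPower m K)) {r : ℕ}
    (g : Fin r → R) : Prop :=
  ∀ f : R, (∀ F ∈ W, (∀ i, g i • F = 0) → f • F = 0) →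
    f ∈ W.annihilator ⊔ Ideal.span (Set.range g)

/-! ### Annihilators of the W_n and regularity of z_1, …, z_d -/

namespace IsAdmissibleSystem

open DividedPower RingTheory.Sequence

variable {m d τ : ℕ} {K : Type u} [Field K] {R : Type u} [CommRing R]
  [Module R (DividedPower m K)] {M : Ideal R} {W : Submodule R (DividedPower m K)}
  {y : Fin m → R} {e : Fin d ↪ Fin m} {Z : (Fin m →₀ ℕ) → DividedPower m K}
  {H : (Fin d → ℕ) → Fin τ → DividedPower m K} {s : (Fin d → ℕ) → ℕ}
  (hS : IsAdmissibleSystem M W y e Z H s) {x : Fin m → R} {c : K →+* R}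
  {ι : R →+* MvPowerSeries (Fin m) K}
  (hR : IsContractionRing x c ι) (hM : M = Ideal.span (Set.range x))

include hS hR hM

/-- Descent in all directions shows that the elements of `W` killed by every z_i^(n_i) lie in `W_n`;
duality converts this into the inclusion that is not formal. -/
theorem annihilator_levelSubmodule {n : Fin d → ℕ} (hn : ∀ i, 0 < n i)
    (hdual : AnnihilatorDuality W fun i => y (e i) ^ n i) :
    (levelSubmodule R H n).annihilator =
      W.annihilator ⊔ Ideal.span (Set.range fun i => y (e i) ^ n i) := by
  refine le_antisymm (fun f hf => hdual f fun F hF h0 => ?_) (sup_le ?_ ?_)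
  · obtain ⟨n', _, h2, h3⟩ := hS.exists_mem_levelSubmodule_of_smul_eq_zero hR hM Finset.univ hn hF
      (fun i _ => h0 i)
    obtain rfl : n' = n := funext fun i => h2 i (Finset.mem_univ i)
    exact Submodule.mem_annihilator.mp hf F h3
  · exact Submodule.annihilator_mono (hS.levelSubmodule_le hn)
  · rw [Ideal.span_le]
    rintro _ ⟨i, rfl⟩
    exact Submodule.mem_annihilator.mpr fun F hF => hS.pow_smul_eq_zero_of_mem hn i hF

/-- By duality it suffices that `f` kills every `F` in `W` killed by the earlier z_l. Such an `F`
lies in some `W_n` with n_l = 1 for l < i. Its generators are z_i times elements that the earlier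
z_l still kill, and `f * z_i` kills those elements. -/
theorem mem_of_mul_mem (i : Fin d)
    (hdual : ∀ r (g : Fin r → R), Set.range g ⊆ Set.range (fun i => y (e i)) →
      AnnihilatorDuality W g) {f : R}
    (hf : y (e i) * f ∈ W.annihilator ⊔ Ideal.span ((fun l => y (e l)) '' {l | l < i})) :
    f ∈ W.annihilator ⊔ Ideal.span ((fun l => y (e l)) '' {l | l < i}) := by
  have hrange : Set.range (fun l : Fin i => y (e (Fin.castLE i.is_lt.le l))) =
      (fun l => y (e l)) '' {l | l < i} := by
    ext t
    constructor
    · rintro ⟨l, rfl⟩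
      exact ⟨_, Fin.lt_def.mpr l.is_lt, rfl⟩
    · rintro ⟨l, hl, rfl⟩
      exact ⟨⟨l, hl⟩, rfl⟩
  rw [← hrange]
  refine hdual _ _ ?_ f fun F hF h0 => ?_
  · rw [hrange]
    exact Set.image_subset_range _ _
  have h0' : ∀ l ∈ Finset.univ.filter (· < i), y (e l) ^ (1 : Fin d → ℕ) l • F = 0 := by
    intro l hl
    rw [Pi.one_apply, pow_one]
    exact h0 ⟨l, (Finset.mem_filter.mp hl).2⟩
  obtain ⟨n, hn1, hn2, hFn⟩ := hS.exists_mem_levelSubmodule_of_smul_eq_zero hR hM _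
    (n := 1) (by simp) hF h0'
  have hpos : ∀ l, 0 < n l := fun l => hn1 l
  refine Submodule.span_induction ?_ (smul_zero _) ?_ ?_ hFn
  · rintro _ ⟨j, rfl⟩
    have hpos' : ∀ l, 0 < (n + Pi.single i 1 : Fin d → ℕ) l := fun l => by
      have := hpos l; simp only [Pi.add_apply]; omega
    -- Raising the index in direction `i` leaves the entries n_l = 1 for l < i unchanged.
    have h1 : H n j = y (e i) • H (n + Pi.single i 1) j := by
      rw [hS.contract _ hpos', if_pos, add_tsub_cancel_right]
      have := hpos i
      simp only [Pi.add_apply, Pi.single_eq_same]; omega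
    rw [h1, smul_smul, mul_comm]
    suffices h : y (e i) * f ∈ (Submodule.span R {H (n + Pi.single i 1) j}).annihilator from
      Submodule.mem_annihilator.mp h _ (Submodule.mem_span_singleton_self _)
    refine (sup_le ?_ ?_ : W.annihilator ⊔ Ideal.span ((fun l => y (e l)) '' {l | l < i}) ≤ _) hf
    · refine Submodule.annihilator_mono ?_
      rw [Submodule.span_singleton_le_iff_mem]
      exact hS.mem_of_pos hpos' j
    · rw [Ideal.span_le]
      rintro _ ⟨l, hl, rfl⟩
      rw [SetLike.mem_coe, Submodule.mem_annihilator_span_singleton]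
      have h2 : (n + Pi.single i 1 : Fin d → ℕ) l = 1 := by
        have := hn2 l (by simpa using hl)
        simp [this, Pi.single_eq_of_ne (ne_of_lt (show l < i from hl))]
      have := hS.pow_smul hpos' l j
      rwa [h2, pow_one] at this
  · intro u v _ _ hu hv
    rw [smul_add, hu, hv, add_zero]
  · intro t u _ hu
    rw [smul_comm, hu, smul_zero]

end IsAdmissibleSystem

/-- A sequence of ring elements is regular on `R/I` if every element is a nonzerodivisor modulo
`I` and its predecessors. -/
theorem isRegular_quotient_ofFn {R : Type*} [CommRing R] (I : Ideal R) {d : ℕ} (z : Fin d → R)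
    (hz : ∀ i f, z i * f ∈ I ⊔ Ideal.span (z '' {l | l < i}) →
      f ∈ I ⊔ Ideal.span (z '' {l | l < i}))
    (htop : I ⊔ Ideal.span (Set.range z) ≠ ⊤) :
    RingTheory.Sequence.IsRegular (R ⧸ I) (List.ofFn z) := by
  -- Membership in a submodule generated by a sequence on `R ⧸ I` is tested on representatives in
  -- `R`.
  have key : ∀ (S : List R) (f : R), (Ideal.Quotient.mk I f ∈
      (Ideal.ofList S • ⊤ : Submodule R (R ⧸ I))) ↔ f ∈ I ⊔ Ideal.ofList S := by
    intro S f
    have h1 : (Ideal.ofList S • ⊤ : Submodule R (R ⧸ I)) =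
        Submodule.map (Submodule.mkQ I) (Ideal.ofList S) := by
      rw [← Submodule.range_mkQ I, ← Submodule.map_top, ← Submodule.map_smul'', smul_eq_mul,
        Ideal.mul_top]
    rw [h1]
    constructor
    · rintro ⟨g, hg, hgf⟩
      have : f - g ∈ I := by
        rw [← Ideal.Quotient.eq]; exact hgf.symm
      have := Submodule.add_mem_sup this hg
      rwa [sub_add_cancel] at this
    · intro hf
      obtain ⟨a, ha, b, hb, rfl⟩ := Submodule.mem_sup.mp hf
      refine ⟨b, hb, ?_⟩
      refine Ideal.Quotient.eq.mpr ?_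
      simpa using I.neg_mem ha
  refine ⟨⟨fun i hi => ?_⟩, ?_⟩
  · rw [List.length_ofFn] at hi
    have hlist : Ideal.ofList (List.take i (List.ofFn z)) =
        Ideal.span (z '' {l | l < (⟨i, hi⟩ : Fin d)}) := by
      unfold Ideal.ofList
      congr 1
      ext t
      simp only [Set.mem_ofPred_eq, Set.mem_image, List.mem_take_iff_getElem, List.getElem_ofFn]
      constructor
      · rintro ⟨l, hl, rfl⟩
        exact ⟨⟨l, by omega⟩, by rw [Fin.lt_def]; simp; omega, rfl⟩
      · rintro ⟨l, hl, rfl⟩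
        exact ⟨l, by rw [Fin.lt_def] at hl; simp at hl; omega, rfl⟩
    rw [isSMulRegular_iff_right_eq_zero_of_smul]
    intro q hq
    obtain ⟨q, rfl⟩ := Submodule.Quotient.mk_surjective _ q
    obtain ⟨f, rfl⟩ := Ideal.Quotient.mk_surjective q
    rw [← Submodule.Quotient.mk_smul, Submodule.Quotient.mk_eq_zero] at hq
    rw [Submodule.Quotient.mk_eq_zero, key, hlist]
    refine hz ⟨i, hi⟩ f ?_
    rw [← hlist, ← key]
    rw [List.getElem_ofFn] at hq
    exact hq
  · intro h
    apply htop
    have h1 := (key (List.ofFn z) 1).mp (h ▸ Submodule.mem_top)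
    have : Ideal.ofList (List.ofFn z) = Ideal.span (Set.range z) := by
      unfold Ideal.ofList
      congr 1
      ext t
      simp
    rw [this] at h1
    exact (Ideal.eq_top_iff_one _).mpr h1

/-! ### Duality -/

open DividedPower in
/-- A linear form on `W` of the form `F ↦ (f ∘ F)_0` that vanishes on the elements killed by
`g_1, …, g_r` is a combination of the forms `F ↦ (h_i g_i ∘ F)_0`. -/
theorem IsContractionRing.exists_powerSeries {m : ℕ} {K : Type u} [Field K] {R : Type u}
    [CommRing R] [Module R (DividedPower m K)] {x : Fin m → R} {c : K →+* R}
    {ι : R →+* MvPowerSeries (Fin m) K} (hR : IsContractionRing x c ι)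
    (W : Submodule R (DividedPower m K)) {r : ℕ} (g : Fin r → R) (f : R)
    (hf : ∀ F ∈ W, (∀ i, g i • F = 0) → f • F = 0) :
    ∃ h : Fin r → MvPowerSeries (Fin m) K, ∀ F ∈ W,
      (f • F).coeff 0 = ∑ i, ((h i * ι (g i)) • F).coeff 0 := by
  classical
  let T : hR.toSubspace W →ₗ[K] (Fin r → DividedPower m K) :=
    LinearMap.pi fun i => (hR.smulLinear (g i)).comp (hR.toSubspace W).subtype
  let φ : Module.Dual K (hR.toSubspace W) :=
    (coeffLinear 0).comp ((hR.smulLinear f).comp (hR.toSubspace W).subtype)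
  -- Over a field, a linear form vanishing on the kernel of `T` is a linear form pulled back along
  -- `T`.
  have hφ : φ ∈ LinearMap.range T.dualMap := by
    rw [LinearMap.range_dualMap_eq_dualAnnihilator_ker, Submodule.mem_dualAnnihilator]
    rintro ⟨F, hF⟩ hT
    have h0 : ∀ i, g i • F = 0 := fun i => congrFun hT i
    change (f • F).coeff 0 = 0
    rw [hf F hF h0, coeff_zero]
  obtain ⟨ψ, hψ⟩ := hφ
  -- The elements of D are finite combinations of monomials, so the values of `ψ` on monomials are
  -- unrestricted: they are the coefficients of a power series.
  let h : Fin r → MvPowerSeries (Fin m) K := fun i k => ψ (Pi.single i (monomial k 1))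
  refine ⟨h, fun F hF => ?_⟩
  have h1 : (f • F).coeff 0 = ψ fun i => g i • F := (LinearMap.congr_fun hψ ⟨F, hF⟩).symm
  have h2 : ∀ (i : Fin r) (G : DividedPower m K),
      ψ (Pi.single i G) = (h i • G).coeff 0 := by
    intro i G
    rw [coeff_zero_smul]
    have hG : G = ∑ k ∈ G.support, G.coeff k • (monomial k 1 : DividedPower m K) := by
      refine ext_coeff fun l => ?_
      rw [coeff_sum]
      simp only [coeff_smul, coeff_monomial, mul_ite, mul_one, mul_zero]
      rw [Finset.sum_ite_eq', eq_comm, ite_eq_left_iff, mem_support, not_not]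
      exact fun h => h.symm
    conv_lhs => rw [hG]
    have h3 := map_sum (ψ.comp (LinearMap.single K (fun _ => DividedPower m K) i))
      (fun k => G.coeff k • (monomial k 1 : DividedPower m K)) G.support
    refine h3.trans (Finset.sum_congr rfl fun k _ => ?_)
    rw [map_smul]
    rfl
  rw [h1]
  have h4 : (fun i => g i • F) = ∑ i, Pi.single i (g i • F) := by
    rw [Finset.univ_sum_single]
  rw [h4, map_sum]
  refine Finset.sum_congr rfl fun i _ => ?_
  rw [h2, mul_smul, ← hR.smul_eq]

open DividedPower in
-- `W` is stable under `R`, so the equality of constant terms holds on all contractions of `F`, and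
-- hence `f - Σ h_i g_i` kills `F` itself.
theorem annihilatorDuality_powerSeries {m : ℕ} {K : Type u} [Field K]
    (W : Submodule (MvPowerSeries (Fin m) K) (DividedPower m K)) {r : ℕ}
    (g : Fin r → MvPowerSeries (Fin m) K) : AnnihilatorDuality W g := by
  intro f hf
  have hR := isContractionRing_powerSeries m K
  obtain ⟨h, hh⟩ := hR.exists_powerSeries W g f hf
  have h1 : f - ∑ i, h i * g i ∈ W.annihilator := by
    refine Submodule.mem_annihilator.mpr fun F hF => hR.eq_zero_of_coeff _ fun r => ?_
    rw [smul_comm, sub_smul, coeff_sub, hh _ (W.smul_mem r hF), Finset.sum_smul, coeff_sum]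
    exact sub_self _
  rw [← sub_add_cancel f (∑ i, h i * g i)]
  exact Submodule.add_mem_sup h1 (Ideal.sum_mem _ fun i _ =>
    Ideal.mul_mem_left _ _ (Ideal.subset_span ⟨i, rfl⟩))

/-! ### Homogeneous submodules and duality over the polynomial ring -/

namespace DividedPower

variable {m : ℕ} {K : Type u} [Field K]

/-- `W` is spanned over `K` by its homogeneous elements. -/
def IsHomogeneousSubmodule (W : Submodule (MvPolynomial (Fin m) K) (DividedPower m K)) : Prop :=
  ∀ F ∈ W, F ∈ Submodule.span K {G : DividedPower m K | G ∈ W ∧ ∃ t, G.IsHomogeneous t}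

theorem isHomogeneousSubmodule_span {S : Set (DividedPower m K)}
    (hS : ∀ F ∈ S, ∃ t, F.IsHomogeneous t) :
    IsHomogeneousSubmodule (Submodule.span (MvPolynomial (Fin m) K) S) := by
  have hR := isContractionRing_polynomial m K
  intro F hF
  refine Submodule.span_induction ?_ (Submodule.zero_mem _) ?_ ?_ hF
  · intro G hG
    exact Submodule.subset_span ⟨Submodule.subset_span hG, hS G hG⟩
  · intro u v _ _ hu hv
    exact Submodule.add_mem _ hu hv
  · intro p u _ hu
    refine Submodule.span_induction ?_ (by rw [smul_zero]; exact Submodule.zero_mem _) ?_ ?_ hu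
    · rintro G ⟨hG, t, ht⟩
      -- Membership in the submodule is carried along, since the step for a product with a variable
      -- needs it.
      suffices h : p • G ∈ Submodule.span K {G : DividedPower m K |
          G ∈ Submodule.span (MvPolynomial (Fin m) K) S ∧ ∃ t, G.IsHomogeneous t} ∧
          p • G ∈ Submodule.span (MvPolynomial (Fin m) K) S from h.1
      induction p using MvPolynomial.induction_on with
      | C a =>
        rw [hR.c_smul]
        exact ⟨Submodule.smul_mem _ _ (Submodule.subset_span ⟨hG, t, ht⟩),
          hR.field_smul_mem _ _ hG⟩
      | add a b ha hb =>
        rw [add_smul]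
        exact ⟨Submodule.add_mem _ ha.1 hb.1, Submodule.add_mem _ ha.2 hb.2⟩
      | mul_X a i ha =>
        obtain ⟨ha, ha'⟩ := ha
        rw [mul_comm, mul_smul]
        refine ⟨?_, Submodule.smul_mem _ _ ha'⟩
        refine Submodule.span_induction (p := fun v _ => (MvPolynomial.X i :
          MvPolynomial (Fin m) K) • v ∈ _) ?_ (by rw [smul_zero]; exact Submodule.zero_mem _)
          ?_ ?_ ha
        · rintro v ⟨hv, t, ht⟩
          -- If `t = 0` the contraction by a variable vanishes, so the truncated `t - 1` is
          -- harmless.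
          refine Submodule.subset_span ⟨Submodule.smul_mem _ _ hv, t - 1, fun k hk => ?_⟩
          rw [mem_support, hR.x_smul_coeff] at hk
          have := ht _ (mem_support.mpr hk)
          rw [map_add, Finsupp.degree_single] at this
          omega
        · intro v w _ _ hv hw
          rw [smul_add]
          exact Submodule.add_mem _ hv hw
        · intro a v _ hv
          rw [hR.smul_smul_comm]
          exact Submodule.smul_mem _ _ hv
    · intro v w _ _ hv hw
      rw [smul_add]
      exact Submodule.add_mem _ hv hw
    · intro a v _ hv
      rw [hR.smul_smul_comm]
      exact Submodule.smul_mem _ _ hv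

/-- Constant terms on homogeneous elements determine those on all of `W` by linearity, and `W`
contains all contractions of its elements. -/
theorem mem_annihilator_of_homogeneous
    {W : Submodule (MvPolynomial (Fin m) K) (DividedPower m K)} (hW : IsHomogeneousSubmodule W)
    {f : MvPolynomial (Fin m) K} (hf : ∀ G ∈ W, ∀ t, G.IsHomogeneous t → (f • G).coeff 0 = 0) :
    f ∈ W.annihilator := by
  have hR := isContractionRing_polynomial m K
  have key : ∀ F ∈ W, (f • F).coeff 0 = 0 := by
    intro F hF
    refine Submodule.span_induction ?_ (by rw [smul_zero, coeff_zero]) ?_ ?_ (hW F hF)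
    · rintro G ⟨hG, t, ht⟩
      exact hf G hG t ht
    · intro u v _ _ hu hv
      rw [smul_add, coeff_add, hu, hv, add_zero]
    · intro a u _ hu
      rw [hR.smul_smul_comm, coeff_smul, hu, mul_zero]
  refine Submodule.mem_annihilator.mpr fun F hF => hR.eq_zero_of_coeff _ fun r => ?_
  rw [smul_comm]
  exact key _ (W.smul_mem r hF)

theorem coeff_zero_smul_congr {f g : MvPowerSeries (Fin m) K} {G : DividedPower m K} {t : ℕ}
    (hG : G.IsHomogeneous t)
    (h : ∀ k : Fin m →₀ ℕ, k.degree = t → MvPowerSeries.coeff k f = MvPowerSeries.coeff k g) :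
    (f • G).coeff 0 = (g • G).coeff 0 := by
  rw [coeff_zero_smul, coeff_zero_smul]
  exact Finset.sum_congr rfl fun k hk => by rw [h k (hG k hk)]

theorem coeff_mul_congr {f g : MvPowerSeries (Fin m) K} {q : MvPolynomial (Fin m) K} {a t : ℕ}
    (hq : q.IsHomogeneous a)
    (h : ∀ k : Fin m →₀ ℕ, k.degree + a = t → MvPowerSeries.coeff k f = MvPowerSeries.coeff k g)
    {k : Fin m →₀ ℕ} (hk : k.degree = t) :
    MvPowerSeries.coeff k (f * (q : MvPowerSeries (Fin m) K)) =
      MvPowerSeries.coeff k (g * (q : MvPowerSeries (Fin m) K)) := by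
  classical
  rw [MvPowerSeries.coeff_mul, MvPowerSeries.coeff_mul]
  refine Finset.sum_congr rfl fun p hp => ?_
  rw [Finset.HasAntidiagonal.mem_antidiagonal] at hp
  by_cases h2 : p.2.degree = a
  · rw [h p.1]
    rw [← hk, ← hp, map_add, h2]
  · rw [MvPolynomial.coeff_coe, hq.coeff_eq_zero h2, mul_zero, mul_zero]

/-- Duality yields power series `h i`, which need not be polynomials. Against a homogeneous `G` of
degree `t` only coefficients of degree `t` matter, so each `h i` may be cut off at degree deg f -
a_i: for `t` at most deg f nothing changes, and for larger `t` both sides vanish. -/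
theorem annihilatorDuality_polynomial
    {W : Submodule (MvPolynomial (Fin m) K) (DividedPower m K)} (hW : IsHomogeneousSubmodule W)
    {r : ℕ} (g : Fin r → MvPolynomial (Fin m) K) (a : Fin r → ℕ)
    (hg : ∀ i, (g i).IsHomogeneous (a i)) : AnnihilatorDuality W g := by
  classical
  intro f hf
  have hR := isContractionRing_polynomial m K
  obtain ⟨h, hh⟩ := hR.exists_powerSeries W g f hf
  let h' : Fin r → MvPolynomial (Fin m) K := fun i =>
    ∑ k ∈ (Finsupp.finite_of_degree_le (σ := Fin m) f.totalDegree).toFinset with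
      k.degree + a i ≤ f.totalDegree, MvPolynomial.monomial k (MvPowerSeries.coeff k (h i))
  have hcoeff : ∀ i k, (h' i).coeff k =
      if k.degree + a i ≤ f.totalDegree then MvPowerSeries.coeff k (h i) else 0 := by
    intro i k
    simp only [h', MvPolynomial.coeff_sum, MvPolynomial.coeff_monomial]
    rw [Finset.sum_ite_eq']
    refine if_congr ?_ rfl rfl
    simp only [Finset.mem_filter, Set.Finite.mem_toFinset, Set.mem_ofPred_eq,
      and_iff_right_iff_imp]
    omega
  have h1 : f - ∑ i, h' i * g i ∈ W.annihilator := by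
    refine mem_annihilator_of_homogeneous hW fun G hG t ht => ?_
    rw [sub_smul, coeff_sub, Finset.sum_smul, coeff_sum, sub_eq_zero]
    simp only [hR.smul_eq, MvPolynomial.coeToMvPowerSeries.ringHom_apply, MvPolynomial.coe_mul]
    by_cases htf : t ≤ f.totalDegree
    · rw [← MvPolynomial.coeToMvPowerSeries.ringHom_apply, ← hR.smul_eq, hh G hG]
      refine Finset.sum_congr rfl fun i _ => coeff_zero_smul_congr ht fun k hk => ?_
      refine coeff_mul_congr (hg i) (fun l hl => ?_) hk
      rw [MvPolynomial.coeff_coe, hcoeff, if_pos (by omega)]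
    · have hz : ((0 : MvPowerSeries (Fin m) K) • G).coeff 0 = 0 := by rw [zero_smul, coeff_zero]
      rw [coeff_zero_smul_congr (g := 0) ht, hz, eq_comm]
      · refine Finset.sum_eq_zero fun i _ => ?_
        rw [coeff_zero_smul_congr (g := 0) ht, hz]
        intro k hk
        rw [← zero_mul (g i : MvPowerSeries (Fin m) K)]
        refine coeff_mul_congr (hg i) (fun l hl => ?_) hk
        rw [MvPolynomial.coeff_coe, hcoeff, if_neg (by omega), map_zero]
      · intro k hk
        rw [MvPolynomial.coeff_coe, map_zero]
        refine MvPolynomial.coeff_eq_zero_of_totalDegree_lt ?_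
        change _ < k.degree
        omega
  rw [← sub_add_cancel f (∑ i, h' i * g i)]
  exact Submodule.add_mem_sup h1 (Ideal.sum_mem _ fun i _ =>
    Ideal.mul_mem_left _ _ (Ideal.subset_span ⟨i, rfl⟩))

theorem homogeneousComponent_mem_annihilator
    {W : Submodule (MvPolynomial (Fin m) K) (DividedPower m K)} (hW : IsHomogeneousSubmodule W)
    {f : MvPolynomial (Fin m) K} (hf : f ∈ W.annihilator) (i : ℕ) :
    MvPolynomial.homogeneousComponent i f ∈ W.annihilator := by
  have hR := isContractionRing_polynomial m K
  refine mem_annihilator_of_homogeneous hW fun G hG t ht => ?_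
  rw [hR.smul_eq]
  by_cases hti : t = i
  · rw [coeff_zero_smul_congr (g := (f : MvPowerSeries (Fin m) K)) ht]
    · exact congrArg (coeff 0) (Submodule.mem_annihilator.mp hf G hG)
    · intro k hk
      rw [MvPolynomial.coeToMvPowerSeries.ringHom_apply, MvPolynomial.coeff_coe,
        MvPolynomial.coeff_coe, MvPolynomial.coeff_homogeneousComponent, if_pos (hk.trans hti)]
  · rw [coeff_zero_smul_congr (g := 0) ht, zero_smul, coeff_zero]
    intro k hk
    rw [MvPolynomial.coeToMvPowerSeries.ringHom_apply, MvPolynomial.coeff_coe,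
      MvPolynomial.coeff_homogeneousComponent, if_neg (hk ▸ hti), map_zero]

end DividedPower

/-! ### The socle of `R / ann(W_n)` -/

namespace DividedPower

variable {m : ℕ} {K : Type u} [Field K]

theorem monomial_zero_injective {a b : K}
    (h : (monomial 0 a : DividedPower m K) = monomial 0 b) : a = b :=
  Finsupp.single_injective 0 h

theorem monomial_zero_right (k : Fin m →₀ ℕ) : (monomial k 0 : DividedPower m K) = 0 :=
  Finsupp.single_zero _

theorem _root_.IsContractionRing.smul_monomial {R : Type u} [CommRing R]
    [Module R (DividedPower m K)] {x : Fin m → R} {c : K →+* R}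
    {ι : R →+* MvPowerSeries (Fin m) K} (hR : IsContractionRing x c ι) (r : R) (a : K) :
    r • (monomial 0 a : DividedPower m K) =
      monomial 0 (MvPowerSeries.constantCoeff (ι r) * a) := by
  classical
  have h1 : ∀ t ∈ Ideal.span (Set.range x), t • (monomial 0 a : DividedPower m K) = 0 := by
    intro t ht
    refine hR.pow_smul_eq_zero (s := 1) (fun k hk => ?_) (by rwa [pow_one])
    rw [coeff_monomial] at hk
    split_ifs at hk with h
    · rw [← h]; simp
    · exact absurd rfl hk
  have h2 := h1 _ (hR.sub_mem r)
  rw [sub_smul, sub_eq_zero, hR.c_smul] at h2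
  rw [h2]
  exact Finsupp.smul_single _ _ _

end DividedPower

namespace IsAdmissibleSystem

open DividedPower

variable {m d τ : ℕ} {K : Type u} [Field K] {R : Type u} [CommRing R]
  [Module R (DividedPower m K)] {M : Ideal R} {W : Submodule R (DividedPower m K)}
  {y : Fin m → R} {e : Fin d ↪ Fin m} {Z : (Fin m →₀ ℕ) → DividedPower m K}
  {H : (Fin d → ℕ) → Fin τ → DividedPower m K} {s : (Fin d → ℕ) → ℕ}
  (hS : IsAdmissibleSystem M W y e Z H s) {x : Fin m → R} {c : K →+* R}
  {ι : R →+* MvPowerSeries (Fin m) K}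
  (hR : IsContractionRing x c ι) (hM : M = Ideal.span (Set.range x))

include hS hR hM

theorem pow_le_annihilator {n : Fin d → ℕ} (hn : ∀ i, 0 < n i) :
    M ^ (s n + 1) ≤ (levelSubmodule R H n).annihilator := fun _ hr =>
  Submodule.mem_annihilator.mpr fun _ hF => hS.pow_maximal_smul hR hM hn hF hr

theorem exists_smul_eq_monomial {n : Fin d → ℕ} (hn : ∀ i, 0 < n i) (a : Fin τ → K) :
    ∃ f ∈ M ^ s n, ∀ j, f • H n j = monomial 0 (a j) := by
  classical
  have hli := hS.linearIndependent n hn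
  obtain ⟨φ, hφ⟩ := LinearMap.exists_extend ((Module.Basis.span hli).constr K a)
  have hφ' : ∀ j, φ ((H n j).form (s n)) = a j := by
    intro j
    have h1 := LinearMap.congr_fun hφ (Module.Basis.span hli j)
    rw [Module.Basis.constr_basis, LinearMap.comp_apply, Submodule.subtype_apply,
      Module.Basis.span_apply] at h1
    exact h1
  let P := (Finsupp.finite_of_degree_le (σ := Fin m) (s n)).toFinset.filter
    fun k => k.degree = s n
  have hf : ∑ k ∈ P, c (φ (monomial k 1)) * (k.prod fun i a => x i ^ a) ∈ M ^ s n := by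
    refine Ideal.sum_mem _ fun k hk => Ideal.mul_mem_left _ _ ?_
    rw [← (Finset.mem_filter.mp hk).2]
    exact IsContractionRing.monomial_mem_pow
      (fun i => hM ▸ Ideal.subset_span (Set.mem_range_self i)) k
  refine ⟨_, hf, fun j => ?_⟩
  have h1 := hR.eq_monomial_of_smul_eq_zero
    (F := (∑ k ∈ P, c (φ (monomial k 1)) * (k.prod fun i a => x i ^ a)) • H n j) (fun r hr => by
      rw [smul_smul]
      refine hS.pow_maximal_smul hR hM hn (Submodule.subset_span ⟨j, rfl⟩) ?_
      rw [pow_succ']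
      exact Ideal.mul_mem_mul (hM ▸ hr) hf)
  rw [h1]
  congr 1
  rw [Finset.sum_smul, coeff_sum, ← hφ' j]
  have h2 : (H n j).form (s n) = ∑ k ∈ P, (H n j).coeff k • (monomial k 1 : DividedPower m K) := by
    refine ext_coeff fun l => ?_
    rw [coeff_sum]
    simp only [coeff_smul, coeff_monomial, mul_ite, mul_one, mul_zero]
    rw [Finset.sum_ite_eq']
    refine (Finsupp.filter_apply _ _ _).trans (if_congr ?_ rfl rfl)
    simp only [P, Finset.mem_filter, Set.Finite.mem_toFinset, Set.mem_ofPred_eq]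
    exact ⟨fun h => ⟨h.le, h⟩, fun h => h.2⟩
  rw [h2, map_sum]
  refine Finset.sum_congr rfl fun k _ => ?_
  rw [mul_smul, hR.c_smul, coeff_smul, hR.coeff_monomial_smul, map_smul, smul_eq_mul, mul_comm]

omit hS hR hM in
theorem mem_annihilator_iff {n : Fin d → ℕ} {g : R} :
    g ∈ (levelSubmodule R H n).annihilator ↔ ∀ j, g • H n j = 0 := by
  constructor
  · exact fun h j => Submodule.mem_annihilator.mp h _ (Submodule.subset_span ⟨j, rfl⟩)
  · intro h
    refine Submodule.mem_annihilator.mpr fun F hF => ?_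
    refine Submodule.span_induction ?_ (smul_zero _) ?_ ?_ hF
    · rintro _ ⟨j, rfl⟩
      exact h j
    · intro u v _ _ hu hv
      rw [smul_add, hu, hv, add_zero]
    · intro t u _ hu
      rw [smul_comm, hu, smul_zero]

omit hS in
-- Modulo the annihilator of `W_n`, a socle element is thus recorded by τ constants.
theorem smul_eq_monomial_of_socle {n : Fin d → ℕ} {g : R}
    (hg : ∀ r ∈ M, r * g ∈ (levelSubmodule R H n).annihilator) (j : Fin τ) :
    g • H n j = monomial 0 ((g • H n j).coeff 0) := by
  refine hR.eq_monomial_of_smul_eq_zero fun r hr => ?_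
  rw [smul_smul]
  exact mem_annihilator_iff.mp (hg r (hM ▸ hr)) j

/-- The socle of `R / ann(W_n)` consists of the forms of top degree. -/
theorem exists_sub_mem_of_socle {n : Fin d → ℕ} (hn : ∀ i, 0 < n i) {g : R}
    (hg : ∀ r ∈ M, r * g ∈ (levelSubmodule R H n).annihilator) :
    ∃ f ∈ M ^ s n, g - f ∈ (levelSubmodule R H n).annihilator := by
  obtain ⟨f, hf, hfH⟩ := hS.exists_smul_eq_monomial hR hM hn fun j => (g • H n j).coeff 0
  refine ⟨f, hf, mem_annihilator_iff.mpr fun j => ?_⟩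
  rw [sub_smul, hfH, ← smul_eq_monomial_of_socle hR hM hg, sub_self]

/-- The socle of `R / ann(W_n)` has a basis of length `τ` over the residue field. -/
theorem exists_socle_basis {n : Fin d → ℕ} (hn : ∀ i, 0 < n i) :
    ∃ b : Fin τ → R, (∀ j, b j ∈ M ^ s n) ∧
      (∀ j, ∀ r ∈ M, r * b j ∈ (levelSubmodule R H n).annihilator) ∧
      (∀ g, (∀ r ∈ M, r * g ∈ (levelSubmodule R H n).annihilator) →
        ∃ a : Fin τ → R, g - ∑ j, a j * b j ∈ (levelSubmodule R H n).annihilator) ∧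
      (∀ a : Fin τ → R, ∑ j, a j * b j ∈ (levelSubmodule R H n).annihilator →
        ∀ j, a j ∈ M) := by
  classical
  -- The `b j` are chosen dual to the `H n l`, so coefficients of socle elements can be read off on
  -- the generators.
  choose b hb hbH using fun j : Fin τ =>
    hS.exists_smul_eq_monomial hR hM hn (Pi.single j (1 : K))
  have hsum : ∀ (a : Fin τ → R) (l : Fin τ), (∑ j, a j * b j) • H n l =
      monomial 0 (MvPowerSeries.constantCoeff (ι (a l))) := by
    intro a l
    rw [Finset.sum_smul, Finset.sum_eq_single l]
    · rw [mul_smul, hbH, hR.smul_monomial, Pi.single_eq_same, mul_one]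
    · intro j _ hj
      rw [mul_smul, hbH, hR.smul_monomial, Pi.single_eq_of_ne hj.symm, mul_zero]
      exact monomial_zero_right 0
    · simp
  refine ⟨b, hb, fun j r hr => ?_, fun g hg => ⟨fun j => c ((g • H n j).coeff 0), ?_⟩,
    fun a ha j => ?_⟩
  · refine hS.pow_le_annihilator hR hM hn ?_
    rw [pow_succ']
    exact Ideal.mul_mem_mul hr (hb j)
  · refine mem_annihilator_iff.mpr fun l => ?_
    rw [sub_smul, hsum, hR.map_c, MvPowerSeries.constantCoeff_C,
      smul_eq_monomial_of_socle hR hM hg, coeff_monomial, if_pos rfl, sub_self]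
  · have h1 := mem_annihilator_iff.mp ha j
    rw [hsum] at h1
    have h2 : MvPowerSeries.constantCoeff (ι (a j)) = 0 :=
      monomial_zero_injective (h1.trans (monomial_zero_right 0).symm)
    have h3 := hR.sub_mem (a j)
    rwa [h2, map_zero, sub_zero, ← hM] at h3

omit hR hM in
theorem one_notMem_annihilator {n : Fin d → ℕ} (hn : ∀ i, 0 < n i) (hτ : 0 < τ) :
    (1 : R) ∉ (levelSubmodule R H n).annihilator := by
  intro h
  have h1 := mem_annihilator_iff.mp h ⟨0, hτ⟩
  rw [one_smul] at h1
  refine (hS.linearIndependent n hn).ne_zero ⟨0, hτ⟩ ?_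
  simp only [h1]
  exact Finsupp.filter_zero _

theorem exists_mem_pow_notMem_annihilator {n : Fin d → ℕ} (hn : ∀ i, 0 < n i) (hτ : 0 < τ) :
    ∃ f ∈ M ^ s n, f ∉ (levelSubmodule R H n).annihilator := by
  obtain ⟨f, hf, hfH⟩ := hS.exists_smul_eq_monomial hR hM hn fun _ => 1
  refine ⟨f, hf, fun h => one_ne_zero (α := K) ?_⟩
  have h1 := mem_annihilator_iff.mp h ⟨0, hτ⟩
  rw [hfH] at h1
  exact monomial_zero_injective (h1.trans (monomial_zero_right 0).symm)

end IsAdmissibleSystem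

/-! ### Ext and regular sequences -/

section Ext

open CategoryTheory Abelian RingTheory.Sequence

variable {A : Type u} [CommRing A]

/-- Multiplication by `x` on `Ext` may be computed on the first argument, which `x` kills. -/
theorem ext_comp_smulShortComplex_f (N M : ModuleCat.{u} A) {x : A}
    (hx : x ∈ Module.annihilator A N) {i : ℕ} (α : Ext.{u} N M i) :
    α.comp (Ext.mk₀ (M.smulShortComplex x).f) (add_zero i) = 0 := by
  have h := Ext.postcomp_smul_id_eq_zero_of_mem_annihilator (M := M) (N := N) hx i
  exact congrArg (fun f => f.hom α) h

/-- If `x` is regular on `M` and kills `N`, the connecting homomorphism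
`Ext^i(N, M/xM) → Ext^{i+1}(N, M)` is surjective; it is bijective if `Ext^i(N, M) = 0`. -/
theorem extClass_postcomp_surjective (N M : ModuleCat.{u} A) {x : A}
    (hx : x ∈ Module.annihilator A N) (hreg : IsSMulRegular M x) (i : ℕ) :
    Function.Surjective (hreg.smulShortComplex_shortExact.extClass.postcompOfLinear A N
      (rfl : i + 1 = i + 1)) := fun α =>
  Ext.covariant_sequence_exact₁ N hreg.smulShortComplex_shortExact α
    (ext_comp_smulShortComplex_f N M hx α) rfl

theorem extClass_postcomp_injective (N M : ModuleCat.{u} A) {x : A} (hreg : IsSMulRegular M x)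
    (i : ℕ) [Subsingleton (Ext.{u} N M i)] :
    Function.Injective (hreg.smulShortComplex_shortExact.extClass.postcompOfLinear A N
      (rfl : i + 1 = i + 1)) := by
  rw [injective_iff_map_eq_zero]
  intro α hα
  obtain ⟨β, rfl⟩ := Ext.covariant_sequence_exact₃ N hreg.smulShortComplex_shortExact α rfl hα
  have hβ : β = 0 := Subsingleton.elim (α := Ext.{u} N M i) β 0
  rw [hβ]
  exact ((Ext.mk₀ (M.smulShortComplex x).g).postcomp N (add_zero i)).map_zero

/-- The connecting homomorphism embeds this group into `Ext` of degree `i + 1`. Vanishing thus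
passes to `M/xM` with the loss of one degree. -/
theorem subsingleton_ext_quotSMulTop (N M : ModuleCat.{u} A) {x : A} (hreg : IsSMulRegular M x)
    (i : ℕ) [Subsingleton (Ext.{u} N M i)] [Subsingleton (Ext.{u} N M (i + 1))] :
    Subsingleton (Ext.{u} N (ModuleCat.of A (QuotSMulTop x M)) i) :=
  have : Subsingleton (Ext.{u} N (M.smulShortComplex x).X₁ (i + 1)) :=
    inferInstanceAs (Subsingleton (Ext.{u} N M (i + 1)))
  (extClass_postcomp_injective N M hreg i).subsingleton

theorem subsingleton_ext_zero (N M : ModuleCat.{u} A) {x : A}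
    (hx : x ∈ Module.annihilator A N) (hreg : IsSMulRegular M x) :
    Subsingleton (Ext.{u} N M 0) := by
  have := hreg.linearMap_subsingleton_of_mem_annihilator hx
  exact ((Ext.linearEquiv₀ (R := A)).trans ModuleCat.homLinearEquiv).toEquiv.subsingleton

theorem subsingleton_ext_succ (N M : ModuleCat.{u} A) {x : A}
    (hx : x ∈ Module.annihilator A N) (hreg : IsSMulRegular M x) (i : ℕ)
    [Subsingleton (Ext.{u} N (ModuleCat.of A (QuotSMulTop x M)) i)] :
    Subsingleton (Ext.{u} N M (i + 1)) :=
  have : Subsingleton (Ext.{u} N (M.smulShortComplex x).X₃ i) :=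
    inferInstanceAs (Subsingleton (Ext.{u} N (ModuleCat.of A (QuotSMulTop x M)) i))
  (extClass_postcomp_surjective N M hx hreg i).subsingleton

/-- Rees' theorem. -/
theorem ext_of_isWeaklyRegular (N : ModuleCat.{u} A) (rs : List A)
    (hrs : ∀ r ∈ rs, r ∈ Module.annihilator A N) (M : ModuleCat.{u} A)
    (hreg : IsWeaklyRegular M rs) :
    (∀ i < rs.length, Subsingleton (Ext.{u} N M i)) ∧
      Nonempty (Ext.{u} N M rs.length ≃ₗ[A]
        (N →ₗ[A] M ⧸ (Ideal.ofList rs • ⊤ : Submodule A M))) := by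
  induction rs generalizing M with
  | nil =>
    refine ⟨fun i hi => absurd hi (by simp), ⟨?_⟩⟩
    refine ((Ext.linearEquiv₀ (R := A)).trans ModuleCat.homLinearEquiv).trans
      (LinearEquiv.congrRight (Submodule.quotEquivOfEqBot _ ?_).symm)
    rw [Ideal.ofList_nil, Submodule.bot_smul]
  | cons x rs ih =>
    rw [isWeaklyRegular_cons_iff] at hreg
    have hx := hrs x (by simp)
    obtain ⟨h1, ⟨h2⟩⟩ := ih (fun r hr => hrs r (by simp [hr]))
      (ModuleCat.of A (QuotSMulTop x M)) hreg.2
    have h3 : ∀ i < (x :: rs).length, Subsingleton (Ext.{u} N M i) := by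
      rintro (_ | i) hi
      · exact subsingleton_ext_zero N M hx hreg.1
      · have := h1 i (by simpa using hi)
        exact subsingleton_ext_succ N M hx hreg.1 i
    refine ⟨h3, ⟨?_⟩⟩
    -- The length of `rs` is one less than that of `x :: rs`, so the vanishing already proved makes
    -- the connecting homomorphism bijective.
    have := h3 rs.length (by simp)
    exact (LinearEquiv.ofBijective _ ⟨extClass_postcomp_injective N M hreg.1 rs.length,
      extClass_postcomp_surjective N M hx hreg.1 rs.length⟩).symm.trans
      (h2.trans (LinearEquiv.congrRight
        (Submodule.quotOfListConsSMulTopEquivQuotSMulTopInner M x rs).symm))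

end Ext

/-! ### The length of the socle -/

section Length

variable {A : Type*} [CommRing A]

/-- The length of `Hom(A/m, N)`, the socle of `N`, from a basis of the socle. -/
theorem length_linearMap_quotient {N : Type*} [AddCommGroup N] [Module A N] (m : Ideal A)
    [m.IsMaximal] {τ : ℕ} (b : Fin τ → N) (hb : ∀ j, ∀ r ∈ m, r • b j = 0)
    (hspan : ∀ n : N, (∀ r ∈ m, r • n = 0) → ∃ a : Fin τ → A, n = ∑ j, a j • b j)
    (hind : ∀ a : Fin τ → A, ∑ j, a j • b j = 0 → ∀ j, a j ∈ m) :
    Module.length A ((A ⧸ m) →ₗ[A] N) = τ := by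
  let β : Fin τ → ((A ⧸ m) →ₗ[A] N) := fun j =>
    Submodule.liftQ m (LinearMap.toSpanSingleton A N (b j)) fun r hr => by
      rw [LinearMap.mem_ker, LinearMap.toSpanSingleton_apply]
      exact hb j r hr
  have hβ : ∀ j r, β j (Ideal.Quotient.mk m r) = r • b j := fun j r => rfl
  let Θ : (Fin τ → A) →ₗ[A] ((A ⧸ m) →ₗ[A] N) := Fintype.linearCombination A β
  have hΘ : ∀ a r, Θ a (Ideal.Quotient.mk m r) = r • ∑ j, a j • b j := by
    intro a r
    rw [Fintype.linearCombination_apply, LinearMap.sum_apply, Finset.smul_sum]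
    refine Finset.sum_congr rfl fun j _ => ?_
    rw [LinearMap.smul_apply, hβ, smul_comm]
  -- Combinations of the `β j` give a surjection from A^τ with kernel m^τ, so the module is (A/m)^τ.
  have hker : LinearMap.ker Θ = Submodule.pi Set.univ fun _ => m := by
    ext a
    rw [LinearMap.mem_ker, Submodule.mem_pi]
    constructor
    · intro h j _
      refine hind a ?_ j
      rw [← one_smul A (∑ j, a j • b j), ← hΘ, h, LinearMap.zero_apply]
    · intro h
      refine LinearMap.ext fun q => ?_
      obtain ⟨r, rfl⟩ := Ideal.Quotient.mk_surjective q
      rw [hΘ, LinearMap.zero_apply, Finset.sum_eq_zero, smul_zero]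
      exact fun j _ => hb j _ (h j (Set.mem_univ j))
  have hsurj : Function.Surjective Θ := by
    intro f
    obtain ⟨a, ha⟩ := hspan (f (Ideal.Quotient.mk m 1)) fun r hr => by
      rw [← map_smul]
      have : r • Ideal.Quotient.mk m 1 = 0 := by
        change Ideal.Quotient.mk m (r * 1) = 0
        rw [mul_one, Ideal.Quotient.eq_zero_iff_mem]
        exact hr
      rw [this, map_zero]
    refine ⟨a, LinearMap.ext fun q => ?_⟩
    obtain ⟨r, rfl⟩ := Ideal.Quotient.mk_surjective q
    rw [hΘ, ← ha, ← map_smul]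
    congr 1
    change Ideal.Quotient.mk m (r * 1) = _
    rw [mul_one]
  have e := (Θ.quotKerEquivOfSurjective hsurj).symm.trans
    ((Submodule.quotEquivOfEq _ _ hker).trans (Submodule.quotientPi fun _ => m))
  rw [e.length_eq, Module.length_pi]
  have : IsSimpleModule A (A ⧸ m) := by
    rw [isSimpleModule_iff_isCoatom]
    exact Ideal.isMaximal_def.mp inferInstance
  rw [Module.length_eq_one]
  simp

end Length

open RingTheory.Sequence in
/-- The type of `R/I` can be computed from the socle of its quotient by a regular sequence. -/
theorem hasType_quotient {R : Type u} [CommRing R] (I M : Ideal R) [M.IsMaximal] (hIM : I ≤ M)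
    {d τ : ℕ} (z : Fin d → R) (hzM : ∀ i, z i ∈ M)
    (hreg : IsRegular (R ⧸ I) (List.ofFn z)) (b : Fin τ → R)
    (hb : ∀ j, ∀ r ∈ M, r * b j ∈ I ⊔ Ideal.span (Set.range z))
    (hspan : ∀ g, (∀ r ∈ M, r * g ∈ I ⊔ Ideal.span (Set.range z)) →
      ∃ a : Fin τ → R, g - ∑ j, a j * b j ∈ I ⊔ Ideal.span (Set.range z))
    (hind : ∀ a : Fin τ → R, ∑ j, a j * b j ∈ I ⊔ Ideal.span (Set.range z) → ∀ j, a j ∈ M) :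
    HasType (M.map (Ideal.Quotient.mk I)) d τ := by
  set A := R ⧸ I
  set π : R →+* A := Ideal.Quotient.mk I
  have hπ : Function.Surjective π := Ideal.Quotient.mk_surjective
  have hmem : ∀ g : R, π g ∈ M.map π ↔ g ∈ M := by
    intro g
    rw [Ideal.mem_map_iff_of_surjective π hπ]
    constructor
    · rintro ⟨t, ht, htg⟩
      rw [Ideal.Quotient.eq] at htg
      have := M.sub_mem ht (hIM htg)
      rwa [sub_sub_cancel] at this
    · exact fun h => ⟨g, h, rfl⟩
  have hmax : (M.map π).IsMaximal := by
    refine Ideal.IsMaximal.map_of_surjective_of_ker_le hπ ?_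
    rwa [Ideal.mk_ker]
  set rs : List A := (List.ofFn z).map π
  have hreg' : IsWeaklyRegular A rs :=
    (isWeaklyRegular_map_algebraMap_iff (S := A) (M := A) (rs := List.ofFn z)).mpr
      hreg.toIsWeaklyRegular
  have hlen : rs.length = d := by simp [rs]
  have hann : ∀ r ∈ rs, r ∈ Module.annihilator A (ModuleCat.of A (A ⧸ M.map π)) := by
    intro r hr
    rw [show Module.annihilator A (ModuleCat.of A (A ⧸ M.map π)) = M.map π from
      Ideal.annihilator_quotient]
    simp only [rs, List.mem_map, List.mem_ofFn] at hr
    obtain ⟨_, ⟨i, rfl⟩, rfl⟩ := hr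
    exact Ideal.mem_map_of_mem _ (hzM i)
  obtain ⟨-, ⟨e⟩⟩ := ext_of_isWeaklyRegular (ModuleCat.of A (A ⧸ M.map π)) rs hann
    (ModuleCat.of A A) hreg'
  have hofList : Ideal.ofList rs = (Ideal.span (Set.range z)).map π := by
    rw [Ideal.map_span]
    unfold Ideal.ofList
    congr 1
    ext t
    simp [rs]
  have hsm : ∀ r g : R, π r • π g = π (r * g) := fun r g => (map_mul π r g).symm
  have hzero : ∀ g : R, (π g ∈ (Ideal.ofList rs • ⊤ : Submodule A A)) ↔
      g ∈ I ⊔ Ideal.span (Set.range z) := by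
    intro g
    rw [smul_eq_mul, Ideal.mul_top, hofList, ← Ideal.mem_comap,
      Ideal.comap_map_of_surjective π hπ, sup_comm]
    rw [← RingHom.ker_eq_comap_bot, Ideal.mk_ker]
  have hsum : ∀ a b' : Fin τ → R, ∑ j, π (a j) • (Submodule.Quotient.mk (π (b' j)) :
      A ⧸ (Ideal.ofList rs • ⊤ : Submodule A A)) =
        Submodule.Quotient.mk (π (∑ j, a j * b' j)) := by
    intro a b'
    rw [map_sum, ← Submodule.mkQ_apply, map_sum]
    refine Finset.sum_congr rfl fun j _ => ?_
    rw [← Submodule.Quotient.mk_smul, hsm, Submodule.mkQ_apply]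
  -- The remaining goals transport the socle basis from representatives in `R` to the quotient of
  -- `A` by the sequence.
  have hlength := length_linearMap_quotient (M.map π)
    (N := A ⧸ (Ideal.ofList rs • ⊤ : Submodule A A))
    (fun j => Submodule.Quotient.mk (π (b j))) ?_ ?_ ?_
  · unfold HasType
    have e' := e.length_eq
    rw [hlen] at e'
    exact e'.trans hlength
  · intro j r hr
    obtain ⟨r, rfl⟩ := hπ r
    rw [← Submodule.Quotient.mk_smul, Submodule.Quotient.mk_eq_zero, hsm,
      hzero]
    exact hb j r ((hmem r).mp hr)
  · intro n hn
    obtain ⟨g, rfl⟩ := Submodule.Quotient.mk_surjective _ n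
    obtain ⟨g, rfl⟩ := hπ g
    obtain ⟨a, ha⟩ := hspan g fun r hr => by
      have := hn (π r) ((hmem r).mpr hr)
      rwa [← Submodule.Quotient.mk_smul, Submodule.Quotient.mk_eq_zero, hsm,
        hzero] at this
    refine ⟨fun j => π (a j), ?_⟩
    rw [hsum, ← sub_eq_zero, ← Submodule.Quotient.mk_sub, Submodule.Quotient.mk_eq_zero,
      ← map_sub, hzero]
    exact ha
  · intro a ha j
    choose a' ha' using fun j => hπ (a j)
    obtain rfl : (fun j => π (a' j)) = a := funext ha'
    rw [hsum, Submodule.Quotient.mk_eq_zero, hzero] at ha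
    exact (hmem _).mpr (hind a' ha j)

/-! ### Systems of parameters in Cohen-Macaulay local rings -/

section Local

open CategoryTheory Abelian RingTheory.Sequence IsLocalRing Pointwise

/-- Every prime of `C` pulls back to a prime containing a power of the maximal ideal, hence to the
maximal ideal. -/
theorem krullDimLE_zero_of_pow_maximalIdeal {A C : Type*} [CommRing A] [IsLocalRing A]
    [CommRing C] (f : A →+* C) (hf : Function.Surjective f) {N : ℕ}
    (hN : maximalIdeal A ^ N ≤ RingHom.ker f) : ringKrullDim C ≤ 0 := by
  have : Ring.KrullDimLE 0 C := by
    rw [Ring.krullDimLE_zero_iff]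
    intro I hI
    have h1 : maximalIdeal A ≤ I.comap f :=
      Ideal.IsPrime.le_of_pow_le (hN.trans (Ideal.comap_mono bot_le))
    have h2 : I.comap f = maximalIdeal A :=
      ((maximalIdeal.isMaximal A).eq_of_le (Ideal.IsPrime.comap f).ne_top h1).symm
    have h3 := Ideal.map_comap_of_surjective f hf I
    rw [h2] at h3
    rcases Ideal.map_eq_top_or_isMaximal_of_surjective f hf (maximalIdeal.isMaximal A) with h | h
    · exact absurd (h3.symm.trans h) hI.ne_top
    · rwa [h3] at h
  exact_mod_cast Ring.krullDimLE_iff.mp this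

variable {A : Type u} [CommRing A] [IsLocalRing A] [IsNoetherianRing A]

/-- Dividing `A ⧸ P` by the images of `rs` leaves dimension at most zero, and dividing by c elements
of the Jacobson radical lowers the dimension by at most c. -/
theorem ringKrullDim_quotient_le_length {N : ℕ} (P : Ideal A) (hP : P ≠ ⊤) (rs : List A)
    (hrs : ∀ r ∈ rs, r ∈ maximalIdeal A) (hN : maximalIdeal A ^ N ≤ P ⊔ Ideal.ofList rs) :
    ringKrullDim (A ⧸ P) ≤ rs.length := by
  classical
  have hPm : P ≤ maximalIdeal A := le_maximalIdeal hP
  have : Nontrivial (A ⧸ P) := Ideal.Quotient.nontrivial_iff.mpr hP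
  have : IsLocalRing (A ⧸ P) :=
    IsLocalRing.of_surjective' (Ideal.Quotient.mk P) Ideal.Quotient.mk_surjective
  let S : Finset (A ⧸ P) := rs.toFinset.image (Ideal.Quotient.mk P)
  have hS : (S : Set (A ⧸ P)) ⊆ Ring.jacobson (A ⧸ P) := by
    rw [IsLocalRing.ringJacobson_eq_maximalIdeal]
    intro t ht
    obtain ⟨r, hr, rfl⟩ := Finset.mem_image.mp ht
    rw [SetLike.mem_coe, mem_maximalIdeal, mem_nonunits_iff]
    intro hu
    obtain ⟨v, hv⟩ := hu.exists_right_inv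
    obtain ⟨v, rfl⟩ := Ideal.Quotient.mk_surjective v
    rw [← map_mul, ← map_one (Ideal.Quotient.mk P), Ideal.Quotient.eq] at hv
    have h1 := (maximalIdeal A).sub_mem
      (Ideal.mul_mem_right v _ (hrs r (List.mem_toFinset.mp hr))) (hPm hv)
    rw [sub_sub_cancel] at h1
    exact (Ideal.ne_top_iff_one _).mp (maximalIdeal.isMaximal A).ne_top h1
  refine (ringKrullDim_le_ringKrullDim_quotient_add_card S hS).trans ?_
  have h0 : ringKrullDim ((A ⧸ P) ⧸ Ideal.span (S : Set (A ⧸ P))) ≤ 0 := by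
    refine krullDimLE_zero_of_pow_maximalIdeal
      ((Ideal.Quotient.mk (Ideal.span (S : Set (A ⧸ P)))).comp (Ideal.Quotient.mk P))
      (Ideal.Quotient.mk_surjective.comp Ideal.Quotient.mk_surjective) (N := N) ?_
    refine hN.trans (sup_le ?_ ?_)
    · intro r hr
      rw [RingHom.mem_ker, RingHom.comp_apply, Ideal.Quotient.eq_zero_iff_mem.mpr hr, map_zero]
    · unfold Ideal.ofList
      rw [Ideal.span_le]
      intro r hr
      rw [SetLike.mem_coe, RingHom.mem_ker, RingHom.comp_apply, Ideal.Quotient.eq_zero_iff_mem]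
      exact Ideal.subset_span (Finset.mem_coe.mpr
        (Finset.mem_image_of_mem _ (List.mem_toFinset.mpr hr)))
  have hcard : S.card ≤ rs.length :=
    Finset.card_image_le.trans (List.toFinset_card_le rs)
  calc _ ≤ (0 : WithBot ℕ∞) + (rs.length : ℕ) := add_le_add h0 (by exact_mod_cast hcard)
    _ = rs.length := zero_add _

/-- The residue field as an object of the category of modules. -/
abbrev residueObj (A : Type u) [CommRing A] [IsLocalRing A] : ModuleCat.{u} A :=
  ModuleCat.of A (A ⧸ maximalIdeal A)

omit [IsNoetherianRing A] in
theorem annihilator_residueObj : Module.annihilator A (residueObj A) = maximalIdeal A :=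
  Ideal.annihilator_quotient

/-- Depth is at most dim A/P for each associated prime P. For the induction, a regular `x` in the
maximal ideal lowers the depth condition by one, and some associated prime of M/xM contains both P
and `x`, hence is strictly larger than P. -/
theorem le_ringKrullDim_quotient_of_isAssociatedPrime {d : ℕ} (M : ModuleCat.{u} A)
    [Module.Finite A M] (hM : ∀ i < d, Subsingleton (Ext.{u} (residueObj A) M i))
    {P : Ideal A} (hP : IsAssociatedPrime P M) : (d : WithBot ℕ∞) ≤ ringKrullDim (A ⧸ P) := by
  induction d generalizing M P with
  | zero =>
    have := Ideal.Quotient.nontrivial_iff.mpr hP.isPrime.ne_top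
    exact_mod_cast ringKrullDim_nonneg_of_nontrivial
  | succ d ih =>
    have hHom : Subsingleton (residueObj A →ₗ[A] M) := by
      have := hM 0 (by omega)
      exact ((Ext.linearEquiv₀ (R := A)).trans
        ModuleCat.homLinearEquiv).symm.toEquiv.subsingleton
    obtain ⟨x, hx, hreg⟩ := IsSMulRegular.subsingleton_linearMap_iff.mp hHom
    have hxm : x ∈ maximalIdeal A := by rwa [annihilator_residueObj] at hx
    have hxP : x ∉ P := by
      intro h
      have h1 : x ∈ ⋃ p ∈ associatedPrimes A M, (p : Set A) :=
        Set.mem_biUnion (x := P) hP h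
      rw [biUnion_associatedPrimes_eq_compl_regular] at h1
      exact h1 hreg
    have hPprime := hP.isPrime
    obtain ⟨-, v, hv⟩ := isAssociatedPrime_iff.mp hP
    -- `T` is the part of `M` killed by `P`. If x w lies in `T`, so does w, since `x` is regular;
    -- hence `T ≤ xM` would give `T = xT` and `T = 0` by Nakayama.
    let T : Submodule A M :=
      { carrier := {t | ∀ p ∈ P, p • t = 0}
        add_mem' := fun ha hb p hp => by rw [smul_add, ha p hp, hb p hp, add_zero]
        zero_mem' := fun p _ => smul_zero p
        smul_mem' := fun a t ht p hp => by rw [smul_comm, ht p hp, smul_zero] }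
    have hvT : v ∈ T := fun p hp => by
      rw [hv, Submodule.mem_colon_singleton] at hp
      exact hp
    have hT : T ≠ ⊥ := by
      intro h
      rw [h, Submodule.mem_bot] at hvT
      apply hPprime.ne_top
      rw [hv, Ideal.eq_top_iff_one, Submodule.mem_colon_singleton, one_smul, hvT]
      exact Submodule.zero_mem _
    have hTx : ¬ T ≤ x • (⊤ : Submodule A M) := by
      intro h
      apply hT
      refine Submodule.eq_bot_of_le_smul_of_le_jacobson_bot (Ideal.span {x}) T
        (IsNoetherian.noetherian T) ?_ ?_
      · intro t ht
        obtain ⟨w, -, rfl⟩ := (Submodule.mem_smul_pointwise_iff_exists _ _ _).mp (h ht)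
        refine Submodule.smul_mem_smul (Ideal.mem_span_singleton_self x) fun p hp => ?_
        apply hreg
        change x • p • w = x • (0 : M)
        rw [smul_zero, smul_comm]
        exact ht p hp
      · rw [Ideal.span_singleton_le_iff_mem]
        exact maximalIdeal_le_jacobson _ hxm
    -- The class of `u` in M/xM is nonzero and killed by `P` and `x`; an associated prime containing
    -- its annihilator is the one sought.
    obtain ⟨u, huT, hux⟩ := SetLike.not_le_iff_exists.mp hTx
    have hu0 : (Submodule.Quotient.mk u : QuotSMulTop x M) ≠ 0 := by
      rwa [ne_eq, Submodule.Quotient.mk_eq_zero]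
    obtain ⟨Q, hQ, hQle⟩ := exists_le_isAssociatedPrime_of_isNoetherianRing A _ hu0
    have hPQ : P ≤ Q := fun p hp => hQle (by
      rw [Submodule.mem_colon_singleton, ← Submodule.Quotient.mk_smul, huT p hp]
      exact Submodule.zero_mem _)
    have hxQ : x ∈ Q := hQle (by
      rw [Submodule.mem_colon_singleton, ← Submodule.Quotient.mk_smul, Submodule.mem_bot,
        Submodule.Quotient.mk_eq_zero]
      exact Submodule.smul_mem_pointwise_smul _ _ _ Submodule.mem_top)
    have hfin : Module.Finite A (ModuleCat.of A (QuotSMulTop x M)) :=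
      inferInstanceAs (Module.Finite A (M ⧸ x • (⊤ : Submodule A M)))
    have h1 := ih (ModuleCat.of A (QuotSMulTop x M)) (fun i hi => by
      have := hM i (by omega)
      have := hM (i + 1) (by omega)
      exact subsingleton_ext_quotSMulTop _ M hreg i) hQ
    have h2 := ringKrullDim_succ_le_of_surjective (Ideal.Quotient.factor hPQ)
      (Ideal.Quotient.factor_surjective hPQ) (r := Ideal.Quotient.mk P x)
      (mem_nonZeroDivisors_of_ne_zero (by rwa [ne_eq, Ideal.Quotient.eq_zero_iff_mem]))
      (by rw [Ideal.Quotient.factor_mk]; exact Ideal.Quotient.eq_zero_iff_mem.mpr hxQ)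
    refine le_trans ?_ h2
    push_cast
    gcongr

/-- A system of parameters of a Cohen-Macaulay module (characterised by the vanishing of `Ext`)
is a regular sequence. -/
theorem isWeaklyRegular_of_pow_maximalIdeal_le {N : ℕ} (rs : List A)
    (hrs : ∀ r ∈ rs, r ∈ maximalIdeal A) (M : ModuleCat.{u} A) [Module.Finite A M]
    (hM : ∀ i < rs.length, Subsingleton (Ext.{u} (residueObj A) M i))
    (hN : maximalIdeal A ^ N ≤ Module.annihilator A M ⊔ Ideal.ofList rs) :
    IsWeaklyRegular M rs := by
  induction rs generalizing M with
  | nil => exact IsWeaklyRegular.nil _ _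
  | cons w rs ih =>
    -- Otherwise `w` lies in an associated prime P. Then A/P has dimension at least the length of `w
    -- :: rs`, yet P and `rs` alone contain a power of the maximal ideal.
    have hreg : IsSMulRegular M w := by
      by_contra h
      have h1 : w ∈ ⋃ p ∈ associatedPrimes A M, (p : Set A) := by
        rw [biUnion_associatedPrimes_eq_compl_regular]
        exact h
      simp only [Set.mem_iUnion] at h1
      obtain ⟨P, hP, hwP⟩ := h1
      have hP' : IsAssociatedPrime P M := hP
      have h2 := le_ringKrullDim_quotient_of_isAssociatedPrime M hM hP'
      have h3 := ringKrullDim_quotient_le_length (N := N) P hP'.isPrime.ne_top rs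
        (fun r hr => hrs r (by simp [hr])) (by
          refine hN.trans (sup_le ?_ ?_)
          · obtain ⟨-, v, hv⟩ := isAssociatedPrime_iff.mp hP'
            refine le_sup_of_le_left fun r hr => ?_
            rw [hv, Submodule.mem_colon_singleton, Module.mem_annihilator.mp hr]
            exact Submodule.zero_mem _
          · rw [Ideal.ofList_cons]
            refine sup_le_sup_right ?_ _
            rwa [Ideal.span_singleton_le_iff_mem])
      have h4 := h2.trans h3
      rw [List.length_cons] at h4
      have h5 : rs.length + 1 ≤ rs.length := by exact_mod_cast h4
      omega
    rw [isWeaklyRegular_cons_iff]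
    refine ⟨hreg, ?_⟩
    have hfin : Module.Finite A (ModuleCat.of A (QuotSMulTop w M)) :=
      inferInstanceAs (Module.Finite A (M ⧸ w • (⊤ : Submodule A M)))
    refine ih (fun r hr => hrs r (by simp [hr])) (ModuleCat.of A (QuotSMulTop w M))
      (fun i hi => ?_) ?_
    · have := hM i (by simp; omega)
      have := hM (i + 1) (by simpa using hi)
      exact subsingleton_ext_quotSMulTop _ M hreg i
    · refine hN.trans (sup_le ?_ ?_)
      · refine le_sup_of_le_left fun r hr => Module.mem_annihilator.mpr fun q => ?_
        obtain ⟨q, rfl⟩ := Submodule.Quotient.mk_surjective _ q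
        rw [← Submodule.Quotient.mk_smul, Module.mem_annihilator.mp hr, Submodule.Quotient.mk_zero]
      · rw [Ideal.ofList_cons]
        refine sup_le_sup_right ?_ _
        rw [Ideal.span_singleton_le_iff_mem, Module.mem_annihilator]
        intro q
        obtain ⟨q, rfl⟩ := Submodule.Quotient.mk_surjective _ q
        rw [← Submodule.Quotient.mk_smul, Submodule.Quotient.mk_eq_zero]
        exact Submodule.smul_mem_pointwise_smul _ _ _ Submodule.mem_top

end Local

/-! ### Lengths modulo general elements -/

section LinearAlgebra

variable {K V : Type*} [Field K] [AddCommGroup V] [Module K V]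

theorem exists_adapted_complement {Q' Q S : Submodule K V} (hle : Q' ≤ Q) (hS : S ⊔ Q' = Q)
    [FiniteDimensional K (V ⧸ Q')] :
    ∃ v : Fin (Module.finrank K (V ⧸ Q') - Module.finrank K (V ⧸ Q)) → V,
      (∀ j, v j ∈ S) ∧ Q ≤ Q' ⊔ Submodule.span K (Set.range v) := by
  have hmap : Submodule.map Q'.mkQ S = Submodule.map Q'.mkQ Q := by
    rw [← hS, Submodule.map_sup]
    simp
  have hdim : Module.finrank K (Submodule.map Q'.mkQ S) =
      Module.finrank K (V ⧸ Q') - Module.finrank K (V ⧸ Q) := by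
    have h1 := Submodule.finrank_quotient_add_finrank (Submodule.map Q'.mkQ Q)
    rw [(Submodule.quotientQuotientEquivQuotient Q' Q hle).finrank_eq] at h1
    rw [hmap]
    omega
  let b := Module.finBasisOfFinrankEq K (Submodule.map Q'.mkQ S) hdim
  have hb : ∀ j, ∃ w ∈ S, Q'.mkQ w = b j := fun j => Submodule.mem_map.mp (b j).2
  choose v hvS hv using hb
  refine ⟨v, hvS, fun q hq => ?_⟩
  have h1 : Q'.mkQ q ∈ Submodule.map Q'.mkQ S := hmap ▸ Submodule.mem_map_of_mem hq
  have h2 := b.sum_repr ⟨Q'.mkQ q, h1⟩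
  have h3 : Q'.mkQ (∑ j, b.repr ⟨Q'.mkQ q, h1⟩ j • v j) = Q'.mkQ q := by
    rw [map_sum]
    simp only [map_smul, hv]
    have h4 := congrArg (Submodule.map Q'.mkQ S).subtype h2
    rw [map_sum] at h4
    exact h4
  rw [← sub_add_cancel q (∑ j, b.repr ⟨Q'.mkQ q, h1⟩ j • v j)]
  refine Submodule.add_mem_sup ?_ (Submodule.sum_mem _ fun j _ =>
    Submodule.smul_mem _ _ (Submodule.subset_span ⟨j, rfl⟩))
  refine (Submodule.Quotient.mk_eq_zero Q').mp ?_
  rw [← Submodule.mkQ_apply, map_sub, h3, sub_self]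

variable {ι : Type*} {Q : Submodule K V} {v : ι → V} {s : Finset ι}

theorem span_mkQ_eq_top (h : ⊤ ≤ Q ⊔ Submodule.span K (v '' s)) :
    ⊤ ≤ Submodule.span K (Set.range fun i : s => Q.mkQ (v i)) := by
  intro q _
  obtain ⟨q, rfl⟩ := Submodule.mkQ_surjective Q q
  obtain ⟨a, ha, b, hb, rfl⟩ := Submodule.mem_sup.mp (h (Submodule.mem_top (x := q)))
  have h1 : Q.mkQ a = 0 := by rwa [← LinearMap.mem_ker, Submodule.ker_mkQ]
  rw [map_add, h1, zero_add]
  have h2 := Submodule.mem_map_of_mem (f := Q.mkQ) hb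
  rw [Submodule.map_span] at h2
  refine Submodule.span_mono ?_ h2
  rintro _ ⟨_, ⟨i, hi, rfl⟩, rfl⟩
  exact ⟨⟨i, hi⟩, rfl⟩

theorem finrank_quotient_le_card (h : ⊤ ≤ Q ⊔ Submodule.span K (v '' s)) :
    Module.finrank K (V ⧸ Q) ≤ s.card := by
  have h1 := finrank_range_le_card (R := K) (fun i : s => Q.mkQ (v i))
  rw [Set.finrank, top_le_iff.mp (span_mkQ_eq_top h), finrank_top] at h1
  simpa using h1

/-- A spanning family with as many members as the dimension is independent. -/
theorem coeff_eq_zero_of_card_eq (h : ⊤ ≤ Q ⊔ Submodule.span K (v '' s))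
    (hcard : Module.finrank K (V ⧸ Q) = s.card) {c : ι → K} (hc : ∑ i ∈ s, c i • v i ∈ Q)
    {i : ι} (hi : i ∈ s) : c i = 0 := by
  have hli := linearIndependent_of_top_le_span_of_card_eq_finrank (span_mkQ_eq_top h)
    (by rw [hcard]; simp)
  have h1 : ∑ j : s, c j • Q.mkQ (v j) = 0 := by
    rw [Finset.sum_coe_sort s fun j => c j • Q.mkQ (v j)]
    simp only [← map_smul, ← map_sum]
    rwa [← LinearMap.mem_ker, Submodule.ker_mkQ]
  exact Fintype.linearIndependent_iff.mp hli (fun j => c j) h1 ⟨i, hi⟩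

end LinearAlgebra

/-! ### Truncated quotients of the power series ring -/

namespace PowerSeriesReduction

variable {m d : ℕ} {K : Type u} [Field K]

theorem sub_C_mem (r : MvPowerSeries (Fin m) K) :
    r - MvPowerSeries.C (MvPowerSeries.constantCoeff r) ∈ powerSeriesMaximal m K :=
  MvPowerSeries.mem_span_range_X (by simp)

theorem mem_maximal_iff {r : MvPowerSeries (Fin m) K} :
    r ∈ powerSeriesMaximal m K ↔ MvPowerSeries.constantCoeff r = 0 := by
  refine ⟨fun h => ?_, fun h => MvPowerSeries.mem_span_range_X h⟩
  have : powerSeriesMaximal m K ≤ RingHom.ker MvPowerSeries.constantCoeff := by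
    unfold powerSeriesMaximal
    rw [Ideal.span_le]
    rintro _ ⟨i, rfl⟩
    simp
  exact this h

theorem C_mul_eq_smul (c : K) (r : MvPowerSeries (Fin m) K) : MvPowerSeries.C c * r = c • r :=
  (MvPowerSeries.smul_eq_C_mul r c).symm

/-- Every power series is, modulo `M ^ n`, in the span of a finite set. -/
theorem exists_finset_span (n : ℕ) : ∃ s : Finset (MvPowerSeries (Fin m) K),
    ∀ r, r ∈ (powerSeriesMaximal m K ^ n).restrictScalars K ⊔ Submodule.span K (s : Set _) := by
  classical
  induction n with
  | zero => exact ⟨∅, fun r => by simp⟩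
  | succ n ih =>
    obtain ⟨s, hs⟩ := ih
    have hfg : (powerSeriesMaximal m K ^ n).FG :=
      Ideal.FG.pow ⟨Finset.univ.image MvPowerSeries.X, by simp [powerSeriesMaximal]⟩
    obtain ⟨t, ht⟩ := hfg
    refine ⟨s ∪ t, fun r => ?_⟩
    have hle : (powerSeriesMaximal m K ^ n).restrictScalars K ≤
        (powerSeriesMaximal m K ^ (n + 1)).restrictScalars K ⊔
          Submodule.span K (t : Set (MvPowerSeries (Fin m) K)) := by
      intro q hq
      have hq' : q ∈ Ideal.span (t : Set (MvPowerSeries (Fin m) K)) := by rw [ht]; exact hq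
      refine Submodule.span_induction ?_ (Submodule.zero_mem _) ?_ ?_ hq'
      · intro g hg
        exact Submodule.mem_sup_right (Submodule.subset_span hg)
      · intro a b _ _ ha hb
        exact Submodule.add_mem _ ha hb
      · intro a b hb hb'
        have hbM : b ∈ powerSeriesMaximal m K ^ n := by rw [← ht]; exact hb
        rw [smul_eq_mul, ← sub_add_cancel a (MvPowerSeries.C (MvPowerSeries.constantCoeff a)),
          add_mul]
        refine Submodule.add_mem _ (Submodule.mem_sup_left ?_) ?_
        · change _ ∈ powerSeriesMaximal m K ^ (n + 1)
          rw [pow_succ']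
          exact Ideal.mul_mem_mul (sub_C_mem a) hbM
        · rw [C_mul_eq_smul]
          exact Submodule.smul_mem _ _ hb'
    have h1 : (powerSeriesMaximal m K ^ n).restrictScalars K ⊔
        Submodule.span K (s : Set (MvPowerSeries (Fin m) K)) ≤
        (powerSeriesMaximal m K ^ (n + 1)).restrictScalars K ⊔
          Submodule.span K ((s ∪ t : Finset _) : Set (MvPowerSeries (Fin m) K)) := by
      rw [Finset.coe_union, Submodule.span_union]
      refine sup_le (hle.trans (sup_le_sup_left le_sup_right _)) ?_
      exact le_sup_of_le_right le_sup_left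
    exact h1 (hs r)

variable (I : Ideal (MvPowerSeries (Fin m) K))

/-- The ideal generated by `I`, the combinations with coefficients `a`, and `M ^ k`. -/
noncomputable def truncIdeal (a : Fin d × Fin m → MvPowerSeries (Fin m) K) (k : ℕ) :
    Ideal (MvPowerSeries (Fin m) K) :=
  I ⊔ Ideal.span (Set.range (combination a)) ⊔ powerSeriesMaximal m K ^ k

/-- The length of `R / (I, z_1, …, z_d, M ^ k)`, `z_i = ∑_j a_ij x_j`. -/
noncomputable def truncLength (a : Fin d × Fin m → MvPowerSeries (Fin m) K) (k : ℕ) : ℕ :=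
  Module.finrank K (MvPowerSeries (Fin m) K ⧸ (truncIdeal I a k).restrictScalars K)

theorem finite_quotient {Q : Ideal (MvPowerSeries (Fin m) K)} {k : ℕ}
    (hQ : powerSeriesMaximal m K ^ k ≤ Q) :
    FiniteDimensional K (MvPowerSeries (Fin m) K ⧸ Q.restrictScalars K) := by
  classical
  obtain ⟨s, hs⟩ := exists_finset_span (m := m) (K := K) k
  refine Module.finite_def.mpr ⟨s.image (Q.restrictScalars K).mkQ, ?_⟩
  rw [eq_top_iff, Finset.coe_image]
  have h1 : ⊤ ≤ Q.restrictScalars K ⊔ Submodule.span K (id '' (s : Set _)) := by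
    intro r _
    rw [Set.image_id]
    exact sup_le_sup_right (show (powerSeriesMaximal m K ^ k).restrictScalars K ≤ _ from hQ) _ (hs r)
  refine (span_mkQ_eq_top h1).trans (Submodule.span_mono ?_)
  rintro _ ⟨i, rfl⟩
  exact ⟨i, i.2, rfl⟩

theorem pow_le_truncIdeal (a : Fin d × Fin m → MvPowerSeries (Fin m) K) (k : ℕ) :
    powerSeriesMaximal m K ^ k ≤ truncIdeal I a k := le_sup_right

theorem truncIdeal_anti (a : Fin d × Fin m → MvPowerSeries (Fin m) K) {k l : ℕ} (h : k ≤ l) :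
    truncIdeal I a l ≤ truncIdeal I a k :=
  sup_le_sup_left (Ideal.pow_le_pow_right h) _

theorem truncLength_zero (a : Fin d × Fin m → MvPowerSeries (Fin m) K) :
    truncLength I a 0 = 0 := by
  have : (truncIdeal I a 0).restrictScalars K = ⊤ := by
    simp [truncIdeal]
  unfold truncLength
  rw [this]
  exact Module.finrank_zero_of_subsingleton

theorem finrank_quotient_anti {Q' Q : Ideal (MvPowerSeries (Fin m) K)} {k : ℕ}
    (hQ : powerSeriesMaximal m K ^ k ≤ Q') (hle : Q' ≤ Q) :
    Module.finrank K (MvPowerSeries (Fin m) K ⧸ Q.restrictScalars K) ≤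
      Module.finrank K (MvPowerSeries (Fin m) K ⧸ Q'.restrictScalars K) := by
  have := finite_quotient hQ
  exact LinearMap.finrank_le_finrank_of_surjective
    (f := Submodule.factor (show Q'.restrictScalars K ≤ Q.restrictScalars K from hle))
    (Submodule.factor_surjective _)

theorem truncLength_mono (a : Fin d × Fin m → MvPowerSeries (Fin m) K) {k l : ℕ} (h : k ≤ l) :
    truncLength I a k ≤ truncLength I a l :=
  finrank_quotient_anti (pow_le_truncIdeal I a l) (truncIdeal_anti I a h)

end PowerSeriesReduction

/-! ### The generic family of truncated quotients -/

namespace PowerSeriesReduction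

open MvPolynomial

variable {m d : ℕ} {K : Type u} [Field K] (I : Ideal (MvPowerSeries (Fin m) K))

section Family

attribute [local instance] MvPolynomial.algebraMvPolynomial

variable (b : Fin d × Fin m → MvPowerSeries (Fin m) K)

/-- The `i`-th generic combination, shifted by `b`. -/
noncomputable def genericCombination (i : Fin d) :
    MvPolynomial (Fin d × Fin m) (MvPowerSeries (Fin m) K) :=
  ∑ j, (X (i, j) + C (b (i, j))) * C (MvPowerSeries.X j)

/-- The ideal of the generic family of quotients `R / (I, z_1, …, z_d, M ^ n)`. -/
noncomputable def genericIdeal (n : ℕ) :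
    Ideal (MvPolynomial (Fin d × Fin m) (MvPowerSeries (Fin m) K)) :=
  (I ⊔ powerSeriesMaximal m K ^ n).map C ⊔ Ideal.span (Set.range (genericCombination b))

/-- Specialisation of the generic family at `a`. -/
noncomputable def specialize (a : Fin d × Fin m → MvPowerSeries (Fin m) K) :
    MvPolynomial (Fin d × Fin m) (MvPowerSeries (Fin m) K) →+* MvPowerSeries (Fin m) K :=
  eval₂Hom (RingHom.id _) (a - b)

theorem specialize_C (a : Fin d × Fin m → MvPowerSeries (Fin m) K)
    (r : MvPowerSeries (Fin m) K) : specialize b a (C r) = r := by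
  simp [specialize]

theorem specialize_smul (a : Fin d × Fin m → MvPowerSeries (Fin m) K)
    (p : MvPolynomial (Fin d × Fin m) K)
    (ρ : MvPolynomial (Fin d × Fin m) (MvPowerSeries (Fin m) K)) :
    specialize b a (p • ρ) = aeval (a - b) p * specialize b a ρ := by
  rw [Algebra.smul_def, map_mul, MvPolynomial.algebraMap_def]
  congr 1
  rw [specialize, coe_eval₂Hom, eval₂_map, RingHom.id_comp]
  rfl

/-- Since `b` has residue zero, substituting `a - b` agrees modulo the maximal ideal with
substituting the residue of `a`. Open conditions therefore depend on residues only. -/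
theorem constantCoeff_aeval (a : Fin d × Fin m → MvPowerSeries (Fin m) K)
    (p : MvPolynomial (Fin d × Fin m) K) (hb : residue b = 0) :
    MvPowerSeries.constantCoeff (aeval (a - b) p) = eval (residue a) p := by
  induction p using MvPolynomial.induction_on with
  | C c =>
    rw [aeval_C, eval_C]
    exact MvPowerSeries.constantCoeff_C c
  | add p q hp hq => rw [map_add, map_add, map_add, hp, hq]
  | mul_X p i hp =>
    rw [map_mul, map_mul, map_mul, hp, aeval_X, eval_X, Pi.sub_apply, map_sub]
    have : MvPowerSeries.constantCoeff (b i) = 0 := congrFun hb i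
    rw [this, sub_zero]
    rfl

theorem specialize_mem (a : Fin d × Fin m → MvPowerSeries (Fin m) K) {n : ℕ}
    {ρ : MvPolynomial (Fin d × Fin m) (MvPowerSeries (Fin m) K)} (hρ : ρ ∈ genericIdeal I b n) :
    specialize b a ρ ∈ truncIdeal I a n := by
  have : genericIdeal I b n ≤ (truncIdeal I a n).comap (specialize b a) := by
    refine sup_le ?_ ?_
    · rw [Ideal.map_le_iff_le_comap]
      intro r hr
      rw [Ideal.mem_comap, Ideal.mem_comap, specialize_C]
      exact (sup_le_sup_right le_sup_left _ : I ⊔ _ ≤ truncIdeal I a n) hr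
    · rw [Ideal.span_le]
      rintro _ ⟨i, rfl⟩
      refine Submodule.mem_sup_left (Submodule.mem_sup_right (Ideal.subset_span ⟨i, ?_⟩))
      rw [genericCombination, map_sum]
      refine Finset.sum_congr rfl fun j _ => ?_
      rw [map_mul, map_add, specialize_C, specialize_C]
      simp [specialize]
  exact this hρ

variable {ι : Type*} (v : ι → MvPowerSeries (Fin m) K) (s : Finset ι) (n : ℕ)

/-- The submodule of the generic family spanned by `v i`, `i ∈ s`. -/
noncomputable def genericSpan : Submodule (MvPolynomial (Fin d × Fin m) K)
    (MvPolynomial (Fin d × Fin m) (MvPowerSeries (Fin m) K)) :=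
  (genericIdeal I b n).restrictScalars _ ⊔
    Submodule.span _ ((fun i => (C (v i) :
      MvPolynomial (Fin d × Fin m) (MvPowerSeries (Fin m) K))) '' s)

theorem mem_of_forall_C_mem (L : Submodule (MvPolynomial (Fin d × Fin m) K)
    (MvPolynomial (Fin d × Fin m) (MvPowerSeries (Fin m) K))) (hL : ∀ r, C r ∈ L)
    (ρ : MvPolynomial (Fin d × Fin m) (MvPowerSeries (Fin m) K)) : ρ ∈ L := by
  induction ρ using MvPolynomial.induction_on with
  | C r => exact hL r
  | add p q hp hq => exact L.add_mem hp hq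
  | mul_X p i hp =>
    have : p * X i = (X i : MvPolynomial (Fin d × Fin m) K) • p := by
      rw [Algebra.smul_def, MvPolynomial.algebraMap_def, map_X, mul_comm]
    rw [this]
    exact L.smul_mem _ hp

theorem C_smul_C (c : K) (r : MvPowerSeries (Fin m) K) :
    (C (c • r) : MvPolynomial (Fin d × Fin m) (MvPowerSeries (Fin m) K)) =
      (C c : MvPolynomial (Fin d × Fin m) K) • C r := by
  conv_rhs => rw [Algebra.smul_def, MvPolynomial.algebraMap_def, map_C, ← C_mul]
  rw [Algebra.smul_def]

theorem C_mem_of_mem_span {L : Submodule (MvPolynomial (Fin d × Fin m) K)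
    (MvPolynomial (Fin d × Fin m) (MvPowerSeries (Fin m) K))}
    {S : Set (MvPowerSeries (Fin m) K)} (hS : ∀ r ∈ S, C r ∈ L) {r : MvPowerSeries (Fin m) K}
    (hr : r ∈ Submodule.span K S) : C r ∈ L := by
  refine Submodule.span_induction hS (by simp) ?_ ?_ hr
  · intro x y _ _ hx hy
    rw [C_add]
    exact L.add_mem hx hy
  · intro c x _ hx
    rw [C_smul_C]
    exact L.smul_mem _ hx

/-- The ideal contains M^n, modulo which finitely many power series span over K; their images
generate over the parameter ring. -/
theorem finite_genericQuotient : Module.Finite (MvPolynomial (Fin d × Fin m) K)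
    (MvPolynomial (Fin d × Fin m) (MvPowerSeries (Fin m) K) ⧸ genericSpan I b v s n) := by
  classical
  obtain ⟨t, ht⟩ := exists_finset_span (m := m) (K := K) n
  refine Module.finite_def.mpr ⟨t.image fun r => (genericSpan I b v s n).mkQ (C r), ?_⟩
  rw [eq_top_iff]
  intro q _
  obtain ⟨ρ, rfl⟩ := Submodule.mkQ_surjective _ q
  refine mem_of_forall_C_mem ((Submodule.span _ _).comap (genericSpan I b v s n).mkQ)
    (fun r => ?_) ρ
  obtain ⟨x, hx, y, hy, rfl⟩ := Submodule.mem_sup.mp (ht r)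
  rw [C_add]
  refine Submodule.add_mem _ ?_ (C_mem_of_mem_span (fun r hr => ?_) hy)
  · rw [Submodule.mem_comap, Submodule.mkQ_apply, (Submodule.Quotient.mk_eq_zero _).mpr]
    · exact Submodule.zero_mem _
    · refine Submodule.mem_sup_left (Submodule.mem_sup_left (Ideal.mem_map_of_mem _ ?_))
      exact Submodule.mem_sup_right hx
  · exact Submodule.subset_span (Finset.mem_coe.mpr (Finset.mem_image_of_mem _ hr))

/-- If the `v i` span the fibre at `t + b`, then they span the family near `t`. -/
theorem exists_eval_eq_one (t : Fin d × Fin m → K)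
    (ht : ∀ r, r ∈ (truncIdeal I (fun p => MvPowerSeries.C (t p) + b p) n).restrictScalars K ⊔
      Submodule.span K (v '' s)) :
    ∃ f : MvPolynomial (Fin d × Fin m) K, eval t f = 1 ∧
      ∀ r, f • C r ∈ genericSpan I b v s n := by
  have hfin := finite_genericQuotient I b v s n
  let 𝔪 : Ideal (MvPolynomial (Fin d × Fin m) K) := RingHom.ker (eval t)
  have hX : ∀ p, X p - C (t p) ∈ 𝔪 := fun p => by simp [𝔪, RingHom.mem_ker]
  -- Hypothesis of Nakayama's lemma: modulo the maximal ideal of the parameter point `t`, the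
  -- generic family becomes its fibre, which the `v i` span.
  have key : (⊤ : Submodule (MvPolynomial (Fin d × Fin m) K)
      (MvPolynomial (Fin d × Fin m) (MvPowerSeries (Fin m) K) ⧸ genericSpan I b v s n)) ≤
      𝔪 • ⊤ := by
    intro q _
    obtain ⟨ρ, rfl⟩ := Submodule.mkQ_surjective _ q
    refine mem_of_forall_C_mem ((𝔪 • ⊤ : Submodule _ _).comap (genericSpan I b v s n).mkQ)
      (fun r => ?_) ρ
    have hzero : genericSpan I b v s n ≤
        (𝔪 • ⊤ : Submodule _ _).comap (genericSpan I b v s n).mkQ := by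
      intro σ hσ
      rw [Submodule.mem_comap, Submodule.mkQ_apply, (Submodule.Quotient.mk_eq_zero _).mpr hσ]
      exact Submodule.zero_mem _
    have hsmul : ∀ p ∈ 𝔪, ∀ σ : MvPolynomial (Fin d × Fin m) (MvPowerSeries (Fin m) K),
        p • σ ∈ (𝔪 • ⊤ : Submodule _ _).comap (genericSpan I b v s n).mkQ := by
      intro p hp σ
      rw [Submodule.mem_comap, map_smul]
      exact Submodule.smul_mem_smul hp Submodule.mem_top
    obtain ⟨x, hx, y, hy, rfl⟩ := Submodule.mem_sup.mp (ht r)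
    rw [C_add]
    refine Submodule.add_mem _ ?_ (C_mem_of_mem_span (fun r hr => ?_) hy)
    · obtain ⟨w, hw, x', hx', rfl⟩ := Submodule.mem_sup.mp
        (show x ∈ truncIdeal I (fun p => MvPowerSeries.C (t p) + b p) n from hx)
      obtain ⟨w', hxI, x'', hx'', rfl⟩ := Submodule.mem_sup.mp hw
      rw [C_add, C_add]
      refine Submodule.add_mem _ (Submodule.add_mem _ ?_ ?_) ?_
      · exact hzero (Submodule.mem_sup_left (Submodule.mem_sup_left
          (Ideal.mem_map_of_mem _ (Submodule.mem_sup_left hxI))))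
      · suffices h : ∀ g : MvPowerSeries (Fin m) K, C (g * x'') ∈
            (𝔪 • ⊤ : Submodule _ _).comap (genericSpan I b v s n).mkQ by
          simpa using h 1
        refine Submodule.span_induction ?_ ?_ ?_ ?_ hx''
        · rintro _ ⟨i, rfl⟩ g
          -- The combination at `t` differs from the generic one by terms with a factor X - t.
          have h1 : (C (g * combination (fun p => MvPowerSeries.C (t p) + b p) i) :
              MvPolynomial (Fin d × Fin m) (MvPowerSeries (Fin m) K)) =
              C g * genericCombination b i -
                ∑ j, (X (i, j) - C (t (i, j)) : MvPolynomial (Fin d × Fin m) K) •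
                  C (g * MvPowerSeries.X j) := by
            rw [genericCombination, combination, Finset.mul_sum, Finset.mul_sum,
              ← Finset.sum_sub_distrib, map_sum]
            refine Finset.sum_congr rfl fun j _ => ?_
            rw [Algebra.smul_def, MvPolynomial.algebraMap_def, map_sub, map_X, map_C]
            simp only [C_mul, C_add]
            have : algebraMap K (MvPowerSeries (Fin m) K) (t (i, j)) =
              MvPowerSeries.C (t (i, j)) := rfl
            rw [this]
            ring
          rw [h1]
          refine Submodule.sub_mem _ (hzero (Submodule.mem_sup_left ?_))
            (Submodule.sum_mem _ fun j _ => hsmul _ (hX _) _)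
          exact Submodule.mem_sup_right
            (Ideal.mul_mem_left _ _ (Ideal.subset_span ⟨i, rfl⟩))
        · intro g
          simp
        · intro x y _ _ hx hy g
          rw [mul_add, C_add]
          exact Submodule.add_mem _ (hx g) (hy g)
        · intro c x _ hx g
          rw [smul_eq_mul, ← mul_assoc]
          exact hx _
      · exact hzero (Submodule.mem_sup_left (Submodule.mem_sup_left
          (Ideal.mem_map_of_mem _ (Submodule.mem_sup_right hx'))))
    · obtain ⟨i, hi, rfl⟩ := hr
      exact hzero (Submodule.mem_sup_right (Submodule.subset_span ⟨i, hi, rfl⟩))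
  -- Nakayama's lemma in the form with an element congruent to 1 modulo the maximal ideal that kills
  -- the finite quotient.
  obtain ⟨f, hf1, hf⟩ := Submodule.exists_sub_one_mem_and_smul_eq_zero_of_fg_of_le_smul 𝔪 ⊤
    hfin.fg_top key
  refine ⟨f, ?_, fun r => ?_⟩
  · rw [RingHom.mem_ker, map_sub, map_one, sub_eq_zero] at hf1
    exact hf1
  · have := hf ((genericSpan I b v s n).mkQ (C r)) Submodule.mem_top
    rwa [← map_smul, Submodule.mkQ_apply, Submodule.Quotient.mk_eq_zero] at this

theorem exists_coefficients {ρ : MvPolynomial (Fin d × Fin m) (MvPowerSeries (Fin m) K)}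
    (hρ : ρ ∈ genericSpan I b v s n) : ∃ p : ι → MvPolynomial (Fin d × Fin m) K,
      ρ - ∑ i ∈ s, p i • C (v i) ∈ genericIdeal I b n := by
  obtain ⟨x, hx, y, hy, rfl⟩ := Submodule.mem_sup.mp hρ
  obtain ⟨p, rfl⟩ := (Submodule.mem_span_image_finset_iff_exists_fun _).mp hy
  classical
  refine ⟨fun i => if h : i ∈ s then p ⟨i, h⟩ else 0, ?_⟩
  rw [← Finset.sum_coe_sort s]
  simp only [Finset.coe_mem, dite_true, Subtype.coe_eta, add_sub_cancel_right]
  exact hx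

end Family

end PowerSeriesReduction

/-! ### Constancy of the truncated lengths on a dense open set -/

namespace PowerSeriesReduction

variable {m d : ℕ} {K : Type u} [Field K]

/-- A nonempty open set contains the nonvanishing locus of a nonzero g, and over an infinite field
the product f g is nonzero at some point. -/
theorem isZariskiDenseOpen_eval_ne_zero [Infinite K] {σ : Type} (f : MvPolynomial σ K)
    (hf : f ≠ 0) : IsZariskiDenseOpen {t : σ → K | MvPolynomial.eval t f ≠ 0} := by
  refine ⟨⟨Ideal.span {f}, ?_⟩, ?_⟩
  · ext t
    simp [MvPolynomial.zeroLocus_span]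
  · rintro _ ⟨J, rfl⟩ ⟨t, ht⟩
    have : ∃ g ∈ J, MvPolynomial.eval t g ≠ 0 := by
      by_contra h
      push Not at h
      exact ht fun g hg => h g hg
    obtain ⟨g, hg, hgt⟩ := this
    have hg0 : g ≠ 0 := by
      rintro rfl
      exact hgt (map_zero _)
    obtain ⟨u, hu⟩ : ∃ u, MvPolynomial.eval u (f * g) ≠ 0 := by
      by_contra h
      push Not at h
      exact mul_ne_zero hf hg0 (MvPolynomial.funext fun u => by rw [h u, map_zero])
    rw [map_mul] at hu
    exact ⟨u, left_ne_zero_of_mul hu, fun h => right_ne_zero_of_mul hu (h g hg)⟩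

variable (I : Ideal (MvPowerSeries (Fin m) K))

/-- Indices of level less than `k`. -/
def levels (r : ℕ → ℕ) (k : ℕ) : Finset (Σ i : ℕ, Fin (r i)) :=
  (Finset.range k).sigma fun _ => Finset.univ

theorem mem_levels {r : ℕ → ℕ} {k : ℕ} {i : Σ i : ℕ, Fin (r i)} : i ∈ levels r k ↔ i.1 < k := by
  simp [levels]

theorem card_levels (r : ℕ → ℕ) (k : ℕ) : (levels r k).card = ∑ i ∈ Finset.range k, r i := by
  simp [levels]

variable {I} {r : ℕ → ℕ} {w : (Σ i : ℕ, Fin (r i)) → MvPowerSeries (Fin m) K}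
  {a : Fin d × Fin m → MvPowerSeries (Fin m) K} {n : ℕ}

/-- Climb the filtration by powers of `M`: the vectors of level `i` supply what is missing between
the truncations at `i` and `i + 1`. -/
theorem top_le_of_levels
    (h : ∀ i < n, (powerSeriesMaximal m K ^ i).restrictScalars K ≤
      (truncIdeal I a (i + 1)).restrictScalars K ⊔
        Submodule.span K (Set.range fun j => w ⟨i, j⟩)) {k : ℕ} (hk : k ≤ n) :
    ⊤ ≤ (truncIdeal I a k).restrictScalars K ⊔ Submodule.span K (w '' levels r k) := by
  induction k with
  | zero =>
    refine le_sup_of_le_left fun x _ => ?_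
    change x ∈ truncIdeal I a 0
    simp [truncIdeal]
  | succ k ih =>
    refine (ih (by omega)).trans (sup_le ?_ ?_)
    · intro x hx
      obtain ⟨y, hy, z, hz, rfl⟩ := Submodule.mem_sup.mp (show x ∈ truncIdeal I a k from hx)
      refine Submodule.add_mem _ (Submodule.mem_sup_left (Submodule.mem_sup_left hy)) ?_
      have hle : Submodule.span K (Set.range fun j => w ⟨k, j⟩) ≤
          Submodule.span K (w '' levels r (k + 1)) := by
        refine Submodule.span_mono ?_
        rintro _ ⟨j, rfl⟩
        exact ⟨⟨k, j⟩, by rw [Finset.mem_coe, mem_levels]; simp, rfl⟩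
      exact sup_le_sup_left hle _ (h k (by omega) hz)
    · refine le_sup_of_le_right (Submodule.span_mono (Set.image_mono fun i hi => ?_))
      rw [Finset.mem_coe, mem_levels] at hi ⊢
      omega

theorem sum_levels_mem (hw : ∀ i, w i ∈ powerSeriesMaximal m K ^ i.1) {k : ℕ} (hk : k ≤ n)
    (q : (Σ i : ℕ, Fin (r i)) → MvPowerSeries (Fin m) K) :
    ∑ i ∈ levels r n, q i * w i - ∑ i ∈ levels r k, q i * w i ∈ powerSeriesMaximal m K ^ k := by
  have hsub : levels r k ⊆ levels r n := fun i hi => by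
    rw [mem_levels] at hi ⊢
    omega
  rw [← Finset.sum_sdiff hsub, add_sub_cancel_right]
  refine Ideal.sum_mem _ fun i hi => Ideal.mul_mem_left _ _ ?_
  rw [Finset.mem_sdiff, mem_levels, mem_levels] at hi
  exact Ideal.pow_le_pow_right (by omega) (hw i)

theorem aeval_C_eq (t : Fin d × Fin m → K) (p : MvPolynomial (Fin d × Fin m) K) :
    MvPolynomial.aeval (fun i => (MvPowerSeries.C (t i) : MvPowerSeries (Fin m) K)) p =
      MvPowerSeries.C (MvPolynomial.eval t p) := by
  induction p using MvPolynomial.induction_on with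
  | C c =>
    rw [MvPolynomial.aeval_C, MvPolynomial.eval_C]
    rfl
  | add p q hp hq => rw [map_add, map_add, map_add, hp, hq]
  | mul_X p i hp => rw [map_mul, map_mul, map_mul, hp, MvPolynomial.aeval_X, MvPolynomial.eval_X]

variable (I d n)

/-- The lengths of `R / (I, z_1, …, z_d, M ^ k)`, `k ≤ n`, are the same for all general
`z_1, …, z_d`, and depend only on the residues of their coefficients. -/
theorem exists_isZariskiDenseOpen_truncLength [Infinite K] :
    ∃ (h : ℕ → ℕ) (U : Set (Fin d × Fin m → K)), IsZariskiDenseOpen U ∧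
      (∀ a, residue a ∈ U → ∀ k ≤ n, truncLength I a k = h k) ∧
      ∀ a : Fin d × Fin m → MvPowerSeries (Fin m) K,
        ∑ k ∈ Finset.range (n + 1), h k ≤ ∑ k ∈ Finset.range (n + 1), truncLength I a k := by
  -- Choose `a₀` minimising the sum of all the lengths. Termwise upper bounds by the lengths at `a₀`
  -- are then equalities, so only spanning statements are needed elsewhere.
  obtain ⟨a₀, hmin⟩ : ∃ a₀ : Fin d × Fin m → MvPowerSeries (Fin m) K, ∀ a,
      ∑ k ∈ Finset.range (n + 1), truncLength I a₀ k ≤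
        ∑ k ∈ Finset.range (n + 1), truncLength I a k := by
    obtain ⟨_, ⟨a₀, rfl⟩, h⟩ := WellFounded.has_min (wellFounded_lt (α := ℕ))
      (Set.range fun a : Fin d × Fin m → MvPowerSeries (Fin m) K =>
        ∑ k ∈ Finset.range (n + 1), truncLength I a k) (Set.range_nonempty _)
    exact ⟨a₀, fun a => not_lt.mp (h _ ⟨a, rfl⟩)⟩
  have heq : ∀ a : Fin d × Fin m → MvPowerSeries (Fin m) K,
      (∀ k ≤ n, truncLength I a k ≤ truncLength I a₀ k) →
      ∀ k ≤ n, truncLength I a k = truncLength I a₀ k := by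
    intro a ha k hk
    have hle : ∀ k ∈ Finset.range (n + 1), truncLength I a k ≤ truncLength I a₀ k :=
      fun k hk => ha k (Nat.lt_succ_iff.mp (Finset.mem_range.mp hk))
    exact (Finset.sum_eq_sum_iff_of_le hle).mp (le_antisymm (Finset.sum_le_sum hle) (hmin a)) k
      (Finset.mem_range.mpr (by omega))
  set t₀ := residue a₀ with ht₀
  -- Removing the residue of `a₀` makes it the member at the point `t₀` of the family `t + b`.
  set b : Fin d × Fin m → MvPowerSeries (Fin m) K := fun p => a₀ p - MvPowerSeries.C (t₀ p)
  have hb : residue b = 0 := by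
    funext p
    simp [residue, b, ht₀]
  -- The jumps of the length at `a₀`; level `i` receives `r i` vectors from M^i, so levels below `k`
  -- form a basis of the truncation at `k`.
  let r : ℕ → ℕ := fun i => truncLength I a₀ (i + 1) - truncLength I a₀ i
  have hcard : ∀ k, (levels r k).card = truncLength I a₀ k := by
    intro k
    rw [card_levels, Finset.sum_range_tsub (monotone_nat_of_le_succ fun i =>
      truncLength_mono I a₀ (Nat.le_succ i)), truncLength_zero, tsub_zero]
  have hv : ∀ i, ∃ v : Fin (r i) → MvPowerSeries (Fin m) K,
      (∀ j, v j ∈ (powerSeriesMaximal m K ^ i).restrictScalars K) ∧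
      (truncIdeal I a₀ i).restrictScalars K ≤ (truncIdeal I a₀ (i + 1)).restrictScalars K ⊔
        Submodule.span K (Set.range v) := by
    intro i
    have := finite_quotient (pow_le_truncIdeal I a₀ (i + 1))
    refine exists_adapted_complement (truncIdeal_anti I a₀ (Nat.le_succ i)) (le_antisymm ?_ ?_)
    · exact sup_le (pow_le_truncIdeal I a₀ i) (truncIdeal_anti I a₀ (Nat.le_succ i))
    · intro x hx
      obtain ⟨y, hy, z, hz, rfl⟩ := Submodule.mem_sup.mp (show x ∈ truncIdeal I a₀ i from hx)
      exact Submodule.add_mem _ (Submodule.mem_sup_right (Submodule.mem_sup_left hy))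
        (Submodule.mem_sup_left hz)
  choose v hvM hvspan using hv
  let w : (Σ i : ℕ, Fin (r i)) → MvPowerSeries (Fin m) K := fun i => v i.1 i.2
  have hw : ∀ i, w i ∈ powerSeriesMaximal m K ^ i.1 := fun i => hvM i.1 i.2
  have htop₀ := top_le_of_levels (w := w) (n := n) (I := I) (a := a₀) (k := n)
    (fun i _ => le_trans (pow_le_truncIdeal I a₀ i : (powerSeriesMaximal m K ^ i) ≤ _)
      (hvspan i)) le_rfl
  have ha₀ : (fun p => MvPowerSeries.C (t₀ p) + b p) = a₀ := by
    funext p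
    simp [b]
  obtain ⟨f, hf1, hf⟩ := exists_eval_eq_one I b w (levels r n) n t₀ (fun x => by
    rw [ha₀]
    exact htop₀ Submodule.mem_top)
  have hf0 : f ≠ 0 := by
    rintro rfl
    simp at hf1
  choose p hp using fun x => exists_coefficients I b w (levels r n) n (hf x)
  have hspec : ∀ (a : Fin d × Fin m → MvPowerSeries (Fin m) K) (x : MvPowerSeries (Fin m) K),
      MvPolynomial.aeval (a - b) f * x -
        ∑ i ∈ levels r n, MvPolynomial.aeval (a - b) (p x i) * w i ∈ truncIdeal I a n := by
    intro a x
    have := specialize_mem I b a (hp x)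
    rw [map_sub, map_sum, specialize_smul, specialize_C] at this
    simpa only [specialize_smul, specialize_C] using this
  -- Elements of M^k need no vectors of level below `k`, as polynomials in the parameters. At a
  -- point where `f` is nonzero, the vectors of level below `k` span the truncation and, by
  -- minimality, form a basis of it; all other terms lie in M^k, so these coefficients vanish there.
  -- As K is infinite and `f ≠ 0`, they vanish identically.
  have hpzero : ∀ k ≤ n, ∀ x ∈ powerSeriesMaximal m K ^ k, ∀ i ∈ levels r k, p x i = 0 := by
    intro k hk x hx i hi
    have hprod : p x i * f = 0 := by
      refine MvPolynomial.funext fun t => ?_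
      rw [map_mul, map_zero]
      by_cases hft : MvPolynomial.eval t f = 0
      · rw [hft, mul_zero]
      · have hab : (fun p => MvPowerSeries.C (t p) + b p) - b =
            fun p => (MvPowerSeries.C (t p) : MvPowerSeries (Fin m) K) := by
          funext p
          simp
        have hspec' := hspec (fun p => MvPowerSeries.C (t p) + b p)
        rw [hab] at hspec'
        simp only [aeval_C_eq, C_mul_eq_smul] at hspec'
        set a : Fin d × Fin m → MvPowerSeries (Fin m) K := fun p => MvPowerSeries.C (t p) + b p
        have hsum : ∀ l ≤ n, ∀ y,
            ∑ i ∈ levels r n, MvPolynomial.eval t (p y i) • w i -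
              ∑ i ∈ levels r l, MvPolynomial.eval t (p y i) • w i ∈
                powerSeriesMaximal m K ^ l := by
          intro l hl y
          simp only [← C_mul_eq_smul]
          exact sum_levels_mem hw hl _
        have htop : ∀ l ≤ n, ⊤ ≤ (truncIdeal I a l).restrictScalars K ⊔
            Submodule.span K (w '' levels r l) := by
          intro l hl y _
          have h1 := Submodule.add_mem _ (truncIdeal_anti I a hl (hspec' y))
            (pow_le_truncIdeal I a l (hsum l hl y))
          rw [sub_add_sub_cancel] at h1
          have h2 : MvPolynomial.eval t f • y ∈ (truncIdeal I a l).restrictScalars K ⊔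
              Submodule.span K (w '' levels r l) := by
            rw [← sub_add_cancel (MvPolynomial.eval t f • y)
              (∑ i ∈ levels r l, MvPolynomial.eval t (p y i) • w i)]
            exact Submodule.add_mem_sup h1 (Submodule.sum_mem _ fun i hi =>
              Submodule.smul_mem _ _ (Submodule.subset_span ⟨i, hi, rfl⟩))
          rw [← inv_smul_smul₀ hft y]
          exact Submodule.smul_mem _ _ h2
        have hlen := heq a (fun l hl =>
          (finrank_quotient_le_card (htop l hl)).trans (hcard l).le) k hk
        have h1 := Submodule.add_mem _ (truncIdeal_anti I a hk (hspec' x))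
          (pow_le_truncIdeal I a k (hsum k hk x))
        rw [sub_add_sub_cancel] at h1
        have h2 : MvPolynomial.eval t f • x ∈ truncIdeal I a k := by
          rw [← C_mul_eq_smul]
          exact Ideal.mul_mem_left _ _ (pow_le_truncIdeal I a k hx)
        have h3 := Submodule.sub_mem _ h2 h1
        rw [sub_sub_cancel] at h3
        rw [coeff_eq_zero_of_card_eq (htop k hk) (hlen.trans (hcard k).symm)
          (c := fun i => MvPolynomial.eval t (p x i)) h3 hi, zero_mul]
    exact (mul_eq_zero.mp hprod).resolve_right hf0
  refine ⟨truncLength I a₀, {t | MvPolynomial.eval t f ≠ 0},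
    isZariskiDenseOpen_eval_ne_zero f hf0, fun a ha => heq a fun k hk => ?_, hmin⟩
  -- From here `a` has arbitrary power series entries: only the constant term of the specialised `f`
  -- matters, and it is the value at the residue.
  have hunit : IsUnit (MvPolynomial.aeval (a - b) f) := by
    rw [MvPowerSeries.isUnit_iff_constantCoeff, constantCoeff_aeval b a f hb]
    exact isUnit_iff_ne_zero.mpr ha
  refine (finrank_quotient_le_card (top_le_of_levels (w := w) (n := n) (fun i hi y hy => ?_)
    hk)).trans (hcard k).le
  obtain ⟨u, hu⟩ := hunit.exists_left_inv
  -- Applied to `u * y`, the generic relation expresses `y` itself. Levels below `i` drop out by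
  -- `hpzero`, and at level `i` the coefficients are constants modulo M^(i+1).
  have hx : u * y ∈ powerSeriesMaximal m K ^ i := Ideal.mul_mem_left _ _ hy
  have h1 := hspec a (u * y)
  rw [← mul_assoc, mul_comm _ u, hu, one_mul] at h1
  have h2 := Submodule.add_mem _ (truncIdeal_anti I a (Nat.succ_le_of_lt hi) h1)
    (pow_le_truncIdeal I a (i + 1) (sum_levels_mem hw (Nat.succ_le_of_lt hi)
      fun j => MvPolynomial.aeval (a - b) (p (u * y) j)))
  rw [sub_add_sub_cancel] at h2
  rw [← sub_add_cancel y (∑ j ∈ levels r (i + 1),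
    MvPolynomial.aeval (a - b) (p (u * y) j) * w j)]
  refine Submodule.add_mem _ (Submodule.mem_sup_left h2) (Submodule.sum_mem _ fun j hj => ?_)
  by_cases hji : j ∈ levels r i
  · rw [hpzero i hi.le _ hx j hji, map_zero, zero_mul]
    exact Submodule.zero_mem _
  · rw [mem_levels] at hj hji
    obtain ⟨j1, j2⟩ := j
    obtain rfl : j1 = i := by simp only at hj hji; omega
    set q := MvPolynomial.aeval (a - b) (p (u * y) ⟨j1, j2⟩)
    rw [← sub_add_cancel q (MvPowerSeries.C (MvPowerSeries.constantCoeff q)), add_mul]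
    refine Submodule.add_mem_sup (pow_le_truncIdeal I a (j1 + 1) ?_) ?_
    · rw [pow_succ']
      exact Ideal.mul_mem_mul (sub_C_mem q) (hw ⟨j1, j2⟩)
    · rw [C_mul_eq_smul]
      exact Submodule.smul_mem _ _ (Submodule.subset_span ⟨j2, rfl⟩)

end PowerSeriesReduction

/-! ### Local level algebras -/

section CohenMacaulay

open RingTheory.Sequence

theorem isRegular_map_quotient_mk {R : Type*} [CommRing R] (I : Ideal R) {rs : List R}
    (h : IsRegular (R ⧸ I) rs) : IsRegular (R ⧸ I) (rs.map (Ideal.Quotient.mk I)) := by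
  refine ⟨(isWeaklyRegular_map_algebraMap_iff (S := R ⧸ I) (M := R ⧸ I) (rs := rs)).mpr
    h.toIsWeaklyRegular, fun htop => h.top_ne_smul ?_⟩
  rw [Ideal.smul_top_eq_map]
  rw [smul_eq_mul, Ideal.mul_top, ← Ideal.map_ofList] at htop
  refine Eq.trans ?_ (congrArg (Submodule.restrictScalars R) htop)
  exact (Submodule.restrictScalars_top (S := R) (R := R ⧸ I) (M := R ⧸ I)).symm

end CohenMacaulay

/-! ### Regularity and type from an admissible system -/

namespace IsAdmissibleSystem

open DividedPower RingTheory.Sequence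

variable {m d τ : ℕ} {K : Type u} [Field K] {R : Type u} [CommRing R]
  [Module R (DividedPower m K)] {M : Ideal R} {W : Submodule R (DividedPower m K)}
  {y : Fin m → R} {e : Fin d ↪ Fin m} {Z : (Fin m →₀ ℕ) → DividedPower m K}
  {H : (Fin d → ℕ) → Fin τ → DividedPower m K} {s : (Fin d → ℕ) → ℕ}
  (hS : IsAdmissibleSystem M W y e Z H s) {x : Fin m → R} {c : K →+* R}
  {ι : R →+* MvPowerSeries (Fin m) K}
  (hR : IsContractionRing x c ι) (hM : M = Ideal.span (Set.range x))

include hS hR hM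

theorem annihilator_levelSubmodule_one (hdual : AnnihilatorDuality W fun i => y (e i)) :
    (levelSubmodule R H 1).annihilator =
      W.annihilator ⊔ Ideal.span (Set.range fun i => y (e i)) := by
  have h := hS.annihilator_levelSubmodule hR hM (n := 1) (fun _ => Nat.one_pos)
    (by simpa using hdual)
  simpa using h

theorem isRegular (hτ : 0 < τ)
    (hdual : ∀ r (g : Fin r → R), Set.range g ⊆ Set.range (fun i => y (e i)) →
      AnnihilatorDuality W g) :
    IsRegular (R ⧸ W.annihilator) (List.ofFn fun i => y (e i)) := by
  refine isRegular_quotient_ofFn W.annihilator (fun i => y (e i))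
    (fun i f hf => hS.mem_of_mul_mem hR hM i hdual hf) fun htop => ?_
  refine hS.one_notMem_annihilator (n := 1) (fun _ => Nat.one_pos) hτ ?_
  rw [hS.annihilator_levelSubmodule_one hR hM (hdual _ _ subset_rfl), htop]
  exact Submodule.mem_top

theorem hasType [M.IsMaximal] (hτ : 0 < τ)
    (hdual : ∀ r (g : Fin r → R), Set.range g ⊆ Set.range (fun i => y (e i)) →
      AnnihilatorDuality W g) :
    HasType (M.map (Ideal.Quotient.mk W.annihilator)) d τ := by
  obtain ⟨b, -, h1, h2, h3⟩ := hS.exists_socle_basis hR hM (n := 1) (fun _ => Nat.one_pos)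
  rw [hS.annihilator_levelSubmodule_one hR hM (hdual _ _ subset_rfl)] at h1 h2 h3
  -- If `f` kills `W`, then `f` times one socle generator lies in the ideal, so independence of the
  -- generators puts `f` in `M`; this needs τ > 0.
  have hann : W.annihilator ≤ M := by
    intro f hf
    have h4 := h3 (Pi.single ⟨0, hτ⟩ f) ?_ ⟨0, hτ⟩
    · rwa [Pi.single_eq_same] at h4
    · refine Ideal.sum_mem _ fun j _ => Ideal.mul_mem_right _ _ (Ideal.mem_sup_left ?_)
      by_cases hj : j = ⟨0, hτ⟩
      · rwa [hj, Pi.single_eq_same]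
      · rw [Pi.single_eq_of_ne hj]
        exact Submodule.zero_mem _
  exact hasType_quotient W.annihilator M hann (fun i => y (e i)) (fun i => hS.y_mem _)
    (hS.isRegular hR hM hτ hdual) b h1 h2 h3

end IsAdmissibleSystem

/-- The canonical surjections identify the cokernel of a sequence on `R / I` with a quotient
of `R`. -/
noncomputable def quotientOfListEquiv {R : Type*} [CommRing R] (I : Ideal R) (rs : List R) :
    ((R ⧸ I) ⧸ (Ideal.ofList rs • ⊤ : Submodule R (R ⧸ I))) ≃ₗ[R] R ⧸ (I ⊔ Ideal.ofList rs) :=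
  (Submodule.quotEquivOfEq _ _ (by
    rw [← Submodule.range_mkQ I, ← Submodule.map_top, ← Submodule.map_smul'', smul_eq_mul,
      Ideal.mul_top, Submodule.map_sup]
    have : Submodule.map I.mkQ I = ⊥ := by simp
    rw [this, bot_sup_eq])).trans
    (Submodule.quotientQuotientEquivQuotient I (I ⊔ Ideal.ofList rs) le_sup_left)

/-! ### Socles and lengths of Artinian quotients -/

namespace PowerSeriesReduction

open CategoryTheory Abelian RingTheory.Sequence IsLocalRing

variable {m d : ℕ} {K : Type u} [Field K]

theorem maximalIdeal_eq : maximalIdeal (MvPowerSeries (Fin m) K) = powerSeriesMaximal m K := by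
  ext r
  rw [mem_maximalIdeal, mem_nonunits_iff, MvPowerSeries.isUnit_iff_constantCoeff, isUnit_iff_ne_zero,
    not_not, mem_maximal_iff]

instance : (powerSeriesMaximal m K).IsMaximal := maximalIdeal_eq (m := m) (K := K) ▸ inferInstance

theorem combination_mem (a : Fin d × Fin m → MvPowerSeries (Fin m) K) (i : Fin d) :
    combination a i ∈ powerSeriesMaximal m K :=
  Ideal.sum_mem _ fun j _ => Ideal.mul_mem_left _ _ (Ideal.subset_span ⟨j, rfl⟩)

/-- The preimage in `R` of the socle of `R / J`. -/
noncomputable def socleIdeal (J : Ideal (MvPowerSeries (Fin m) K)) :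
    Ideal (MvPowerSeries (Fin m) K) :=
  J.colon (powerSeriesMaximal m K : Set (MvPowerSeries (Fin m) K))

theorem mem_socleIdeal {J : Ideal (MvPowerSeries (Fin m) K)} {g : MvPowerSeries (Fin m) K} :
    g ∈ socleIdeal J ↔ ∀ r ∈ powerSeriesMaximal m K, r * g ∈ J := by
  unfold socleIdeal
  rw [Submodule.mem_colon]
  simp only [smul_eq_mul, mul_comm g, SetLike.mem_coe]

theorem le_socleIdeal (J : Ideal (MvPowerSeries (Fin m) K)) : J ≤ socleIdeal J := fun _ hg =>
  mem_socleIdeal.mpr fun _ _ => Ideal.mul_mem_left _ _ hg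

/-- Evaluation at 1 embeds Hom(R/M, R/J) as the socle of R/J, which is the kernel of the projection
from R/J to R/socle ideal. -/
theorem finrank_socle {J : Ideal (MvPowerSeries (Fin m) K)} {k : ℕ}
    (hJ : powerSeriesMaximal m K ^ k ≤ J) :
    Module.finrank K (MvPowerSeries (Fin m) K ⧸ (socleIdeal J).restrictScalars K) +
      Module.finrank K ((MvPowerSeries (Fin m) K ⧸ powerSeriesMaximal m K)
        →ₗ[MvPowerSeries (Fin m) K] (MvPowerSeries (Fin m) K ⧸ J)) =
      Module.finrank K (MvPowerSeries (Fin m) K ⧸ J.restrictScalars K) := by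
  set R := MvPowerSeries (Fin m) K
  set M := powerSeriesMaximal m K
  have := finite_quotient hJ
  let ρ : (R ⧸ J) ≃ₗ[K] (R ⧸ J.restrictScalars K) :=
    (Submodule.Quotient.restrictScalarsEquiv K J).symm
  let ev : ((R ⧸ M) →ₗ[R] (R ⧸ J)) →ₗ[K] (R ⧸ J.restrictScalars K) :=
    { toFun := fun f => ρ (f (Submodule.Quotient.mk 1))
      map_add' := fun f g => by rw [LinearMap.add_apply, map_add]
      map_smul' := fun t f => by rw [LinearMap.smul_apply, map_smul, RingHom.id_apply] }
  have hinj : Function.Injective ev := by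
    intro f g hfg
    have h1 : f (Submodule.Quotient.mk 1) = g (Submodule.Quotient.mk 1) := ρ.injective hfg
    refine LinearMap.ext fun q => ?_
    obtain ⟨r, rfl⟩ := Submodule.Quotient.mk_surjective _ q
    have h2 : (Submodule.Quotient.mk r : R ⧸ M) = r • Submodule.Quotient.mk 1 := by
      rw [← Submodule.Quotient.mk_smul, smul_eq_mul, mul_one]
    rw [h2, map_smul, map_smul, h1]
  have hrange : LinearMap.range ev =
      Submodule.map (J.restrictScalars K).mkQ ((socleIdeal J).restrictScalars K) := by
    ext q
    constructor
    · rintro ⟨f, rfl⟩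
      obtain ⟨g, hg⟩ := Submodule.Quotient.mk_surjective _ (f (Submodule.Quotient.mk 1))
      refine ⟨g, mem_socleIdeal.mpr fun r hr => ?_, ?_⟩
      · rw [← Submodule.Quotient.mk_eq_zero J, ← smul_eq_mul, Submodule.Quotient.mk_smul, hg,
          ← map_smul, ← Submodule.Quotient.mk_smul, smul_eq_mul, mul_one,
          (Submodule.Quotient.mk_eq_zero M).mpr hr, map_zero]
      · change _ = ρ (f (Submodule.Quotient.mk 1))
        rw [← hg]
        rfl
    · rintro ⟨g, hg, rfl⟩
      refine ⟨Submodule.liftQ M (LinearMap.toSpanSingleton R (R ⧸ J) (Submodule.Quotient.mk g))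
        fun r hr => ?_, ?_⟩
      · rw [LinearMap.mem_ker, LinearMap.toSpanSingleton_apply, ← Submodule.Quotient.mk_smul,
          Submodule.Quotient.mk_eq_zero]
        exact mem_socleIdeal.mp hg r hr
      · change ρ (LinearMap.toSpanSingleton R (R ⧸ J) (Submodule.Quotient.mk g) 1) = _
        rw [LinearMap.toSpanSingleton_apply, one_smul]
        rfl
  have hle : J.restrictScalars K ≤ (socleIdeal J).restrictScalars K := le_socleIdeal J
  have h1 := Submodule.finrank_quotient_add_finrank
    (Submodule.map (J.restrictScalars K).mkQ ((socleIdeal J).restrictScalars K))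
  rw [(Submodule.quotientQuotientEquivQuotient _ _ hle).finrank_eq, ← hrange,
    LinearMap.finrank_range_of_inj hinj] at h1
  exact h1

theorem eq_of_finrank_eq {Q' Q : Ideal (MvPowerSeries (Fin m) K)} {k : ℕ}
    (hQ : powerSeriesMaximal m K ^ k ≤ Q') (hle : Q' ≤ Q)
    (h : Module.finrank K (MvPowerSeries (Fin m) K ⧸ Q.restrictScalars K) =
      Module.finrank K (MvPowerSeries (Fin m) K ⧸ Q'.restrictScalars K)) : Q' = Q := by
  refine le_antisymm hle fun q hq => ?_
  have := finite_quotient hQ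
  have := finite_quotient (hQ.trans hle)
  have hle' : Q'.restrictScalars K ≤ Q.restrictScalars K := hle
  have hinj := (LinearMap.injective_iff_surjective_of_finrank_eq_finrank h.symm).mpr
    (Submodule.factor_surjective hle')
  have h1 : Submodule.factor hle' (Submodule.Quotient.mk q) = Submodule.factor hle' 0 := by
    rw [map_zero]
    exact (Submodule.Quotient.mk_eq_zero _).mpr hq
  exact (Submodule.Quotient.mk_eq_zero _).mp (hinj h1)

/-- Only one inclusion has to be assumed: the class of M^s lies in the socle because M^(s+1) is
contained in `Q`. -/
theorem isArtinianLevel_of_socleIdeal_le {Q : Ideal (MvPowerSeries (Fin m) K)} {s : ℕ}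
    (h1 : powerSeriesMaximal m K ^ (s + 1) ≤ Q) (h2 : ¬ powerSeriesMaximal m K ^ s ≤ Q)
    (h3 : socleIdeal Q ≤ Q ⊔ powerSeriesMaximal m K ^ s) : IsArtinianLevel Q := by
  have hbot : ∀ k, (powerSeriesMaximal m K).map (Ideal.Quotient.mk Q) ^ k = ⊥ ↔
      powerSeriesMaximal m K ^ k ≤ Q := fun k => by
    rw [← Ideal.map_pow, Ideal.map_eq_bot_iff_le_ker, Ideal.mk_ker]
  refine ⟨?_, s, fun h => h2 ((hbot s).mp h), (hbot _).mpr h1, le_antisymm ?_ ?_⟩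
  · have := finite_quotient h1
    have : Module.Finite K (MvPowerSeries (Fin m) K ⧸ Q) :=
      Module.Finite.equiv (Submodule.Quotient.restrictScalarsEquiv K Q)
    exact IsArtinianRing.of_finite K _
  · intro q hq
    obtain ⟨g, rfl⟩ := Ideal.Quotient.mk_surjective q
    have hg : g ∈ socleIdeal Q := by
      refine mem_socleIdeal.mpr fun r hr => ?_
      rw [← Ideal.Quotient.eq_zero_iff_mem, map_mul, mul_comm]
      exact Submodule.mem_annihilator.mp hq _ (Ideal.mem_map_of_mem _ hr)
    obtain ⟨u, hu, v, hv, rfl⟩ := Submodule.mem_sup.mp (h3 hg)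
    rw [map_add, Ideal.Quotient.eq_zero_iff_mem.mpr hu, zero_add, ← Ideal.map_pow]
    exact Ideal.mem_map_of_mem _ hv
  · intro q hq
    refine Submodule.mem_annihilator.mpr fun t ht => ?_
    rw [← Ideal.map_pow] at hq
    obtain ⟨u, hu, rfl⟩ := (Ideal.mem_map_iff_of_surjective _ Ideal.Quotient.mk_surjective).mp hq
    obtain ⟨v, hv, rfl⟩ := (Ideal.mem_map_iff_of_surjective _ Ideal.Quotient.mk_surjective).mp ht
    rw [smul_eq_mul, ← map_mul, Ideal.Quotient.eq_zero_iff_mem]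
    exact h1 (pow_succ (powerSeriesMaximal m K) s ▸ Ideal.mul_mem_mul hu hv)

end PowerSeriesReduction

/-! ### Transfer of levelness to general elements -/

namespace PowerSeriesReduction

open CategoryTheory Abelian RingTheory.Sequence IsLocalRing

variable {m d τ : ℕ} {K : Type u} [Field K]

theorem ofList_ofFn {R : Type*} [CommRing R] (z : Fin d → R) :
    Ideal.ofList (List.ofFn z) = Ideal.span (Set.range z) := by
  unfold Ideal.ofList
  congr 1
  ext t
  simp

theorem ringKrullDim_quotient_of_isRegular {R : Type*} [CommRing R] [IsLocalRing R]
    [IsNoetherianRing R] (I : Ideal R) (z : Fin d → R) (hreg : IsRegular (R ⧸ I) (List.ofFn z))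
    {N : ℕ} (hN : maximalIdeal R ^ N ≤ I ⊔ Ideal.span (Set.range z)) :
    ringKrullDim (R ⧸ I) = d := by
  have hne : I ≠ ⊤ := Ideal.Quotient.nontrivial_iff.mp hreg.nontrivial
  have : Nontrivial (R ⧸ I) := Ideal.Quotient.nontrivial_iff.mpr hne
  have : IsLocalRing (R ⧸ I) :=
    IsLocalRing.of_surjective' (Ideal.Quotient.mk _) Ideal.Quotient.mk_surjective
  have h2 := isRegular_map_quotient_mk _ hreg
  have h3 := ringKrullDim_add_length_eq_ringKrullDim_of_isRegular _ h2
  rw [List.length_map, List.length_ofFn] at h3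
  set J : Ideal (R ⧸ I) := Ideal.ofList ((List.ofFn z).map (Ideal.Quotient.mk I)) with hJ
  have h4 : ringKrullDim ((R ⧸ I) ⧸ J) = 0 := by
    refine le_antisymm (krullDimLE_zero_of_pow_maximalIdeal
      ((Ideal.Quotient.mk J).comp (Ideal.Quotient.mk I))
      (Ideal.Quotient.mk_surjective.comp Ideal.Quotient.mk_surjective) (N := N) ?_) ?_
    · refine hN.trans (sup_le (fun r hr => ?_) fun r hr => ?_)
      · rw [RingHom.mem_ker, RingHom.comp_apply, Ideal.Quotient.eq_zero_iff_mem.mpr hr, map_zero]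
      · rw [RingHom.mem_ker, RingHom.comp_apply, Ideal.Quotient.eq_zero_iff_mem, hJ,
          ← Ideal.map_ofList, ofList_ofFn]
        exact Ideal.mem_map_of_mem _ hr
    · have : Nontrivial ((R ⧸ I) ⧸ J) := by
        refine Ideal.Quotient.nontrivial_iff.mpr fun h => h2.top_ne_smul ?_
        rw [← hJ, h, Submodule.top_smul]
      exact ringKrullDim_nonneg_of_nontrivial
  rw [← h3, h4, zero_add]

/-- The socles of the quotients of a Cohen-Macaulay ring by two systems of parameters are
isomorphic. -/
theorem nonempty_socle_equiv (I : Ideal (MvPowerSeries (Fin m) K))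
    (z₁ z : Fin d → MvPowerSeries (Fin m) K) (hz₁ : ∀ i, z₁ i ∈ powerSeriesMaximal m K)
    (hz : ∀ i, z i ∈ powerSeriesMaximal m K)
    (hreg : IsWeaklyRegular (MvPowerSeries (Fin m) K ⧸ I) (List.ofFn z₁)) {k : ℕ}
    (hk : powerSeriesMaximal m K ^ k ≤ I ⊔ Ideal.span (Set.range z)) :
    Nonempty (((MvPowerSeries (Fin m) K ⧸ powerSeriesMaximal m K)
        →ₗ[MvPowerSeries (Fin m) K] (MvPowerSeries (Fin m) K ⧸ I ⊔ Ideal.span (Set.range z)))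
      ≃ₗ[MvPowerSeries (Fin m) K]
      ((MvPowerSeries (Fin m) K ⧸ powerSeriesMaximal m K)
        →ₗ[MvPowerSeries (Fin m) K] (MvPowerSeries (Fin m) K ⧸ I ⊔ Ideal.span (Set.range z₁)))) := by
  let R := MvPowerSeries (Fin m) K
  let N : ModuleCat.{u} R := ModuleCat.of R (R ⧸ powerSeriesMaximal m K)
  let A : ModuleCat.{u} R := ModuleCat.of R (R ⧸ I)
  have hN : Module.annihilator R N = powerSeriesMaximal m K := Ideal.annihilator_quotient
  have hres : residueObj R = N := by
    change ModuleCat.of R (R ⧸ maximalIdeal R) = _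
    rw [maximalIdeal_eq]
  have hmem : ∀ z : Fin d → R, (∀ i, z i ∈ powerSeriesMaximal m K) →
      ∀ r ∈ List.ofFn z, r ∈ powerSeriesMaximal m K := by
    intro z hz r hr
    obtain ⟨i, rfl⟩ := (List.mem_ofFn' _ _).mp hr
    exact hz i
  have hfin : Module.Finite R A := inferInstanceAs (Module.Finite R (R ⧸ I))
  have hA : Module.annihilator R A = I := Ideal.annihilator_quotient
  obtain ⟨h1, h2⟩ := ext_of_isWeaklyRegular N (List.ofFn z₁)
    (fun r hr => hN ▸ hmem z₁ hz₁ r hr) A hreg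
  rw [List.length_ofFn] at h1 h2
  -- The first sequence makes `Ext` vanish below degree d, so the second, a system of parameters, is
  -- regular too. Both socles are then the same Ext^d.
  have hreg' := isWeaklyRegular_of_pow_maximalIdeal_le (N := k) (List.ofFn z)
    (fun r hr => maximalIdeal_eq (m := m) (K := K) ▸ hmem z hz r hr) A
    (fun i hi => by
      rw [hres]
      exact h1 i (by simpa using hi))
    (by rw [hA, ofList_ofFn, maximalIdeal_eq]; exact hk)
  obtain ⟨-, h3⟩ := ext_of_isWeaklyRegular N (List.ofFn z)
    (fun r hr => hN ▸ hmem z hz r hr) A hreg'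
  rw [List.length_ofFn] at h3
  obtain ⟨e₁⟩ := h2
  obtain ⟨e₂⟩ := h3
  rw [← ofList_ofFn z, ← ofList_ofFn z₁]
  exact ⟨(LinearEquiv.congrRight (quotientOfListEquiv I _).symm).trans (e₂.symm.trans
    (e₁.trans (LinearEquiv.congrRight (quotientOfListEquiv I _))))⟩

variable {I : Ideal (MvPowerSeries (Fin m) K)} {a₁ a : Fin d × Fin m → MvPowerSeries (Fin m) K}
  {s n k : ℕ}

/-- Equal lengths force M^k into J + M^(k+1), where J is the ideal on the right; Nakayama's lemma
removes the second term. -/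
theorem pow_le_of_truncLength_eq (h : truncLength I a k = truncLength I a (k + 1)) :
    powerSeriesMaximal m K ^ k ≤ I ⊔ Ideal.span (Set.range (combination a)) := by
  have h1 := eq_of_finrank_eq (pow_le_truncIdeal I a (k + 1)) (truncIdeal_anti I a k.le_succ) h
  refine Submodule.le_of_le_smul_of_le_jacobson_bot (I := powerSeriesMaximal m K)
    (IsNoetherian.noetherian _) ?_ ?_
  · rw [← maximalIdeal_eq]
    exact maximalIdeal_le_jacobson _
  · rw [smul_eq_mul, ← pow_succ']
    exact (pow_le_truncIdeal I a k).trans h1.ge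

theorem truncIdeal_eq (h : powerSeriesMaximal m K ^ k ≤
    I ⊔ Ideal.span (Set.range (combination a))) :
    truncIdeal I a k = I ⊔ Ideal.span (Set.range (combination a)) :=
  sup_eq_left.mpr h

/-- Let J and J₁ be the ideals for `a` and `a₁`. They have equal colength, and their socles have
equal dimension, so their socle ideals have equal colength. For J₁ the socle ideal is J₁ + M^s, of
the same colength as J + M^s. Since J + M^s lies in the socle ideal of J, the two coincide. -/
theorem isArtinianLevel_of_truncLength_eq
    (hreg : IsWeaklyRegular (MvPowerSeries (Fin m) K ⧸ I) (List.ofFn (combination a₁)))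
    (h1 : powerSeriesMaximal m K ^ (s + 1) ≤ I ⊔ Ideal.span (Set.range (combination a₁)))
    (h2 : ¬ powerSeriesMaximal m K ^ s ≤ I ⊔ Ideal.span (Set.range (combination a₁)))
    (h3 : socleIdeal (I ⊔ Ideal.span (Set.range (combination a₁))) ≤
      I ⊔ Ideal.span (Set.range (combination a₁)) ⊔ powerSeriesMaximal m K ^ s)
    (heq : ∀ l ≤ n, truncLength I a l = truncLength I a₁ l) (hk : k < n)
    (hk' : truncLength I a k = truncLength I a (k + 1)) :
    IsArtinianLevel (I ⊔ Ideal.span (Set.range (combination a))) := by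
  have hka := pow_le_of_truncLength_eq hk'
  have hka₁ := pow_le_of_truncLength_eq
    ((heq k hk.le).symm.trans (hk'.trans (heq (k + 1) hk)))
  have hsk : s + 1 ≤ k := by
    by_contra hlt
    exact h2 ((Ideal.pow_le_pow_right (by omega)).trans hka₁)
  have hlen : truncLength I a (s + 1) = truncLength I a k := by
    rw [heq _ (by omega), heq _ hk.le]
    unfold truncLength
    rw [truncIdeal_eq h1, truncIdeal_eq hka₁]
  have h1a : powerSeriesMaximal m K ^ (s + 1) ≤ I ⊔ Ideal.span (Set.range (combination a)) := by
    have h4 := eq_of_finrank_eq (pow_le_truncIdeal I a k) (truncIdeal_anti I a hsk) hlen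
    rw [truncIdeal_eq hka] at h4
    exact (pow_le_truncIdeal I a (s + 1)).trans h4.ge
  have h2a : ¬ powerSeriesMaximal m K ^ s ≤ I ⊔ Ideal.span (Set.range (combination a)) := by
    intro h4
    refine h2 (pow_le_of_truncLength_eq ?_)
    rw [← heq s (by omega), ← heq (s + 1) (by omega)]
    unfold truncLength
    rw [truncIdeal_eq h4, truncIdeal_eq h1a]
  refine isArtinianLevel_of_socleIdeal_le h1a h2a ?_
  obtain ⟨E⟩ := nonempty_socle_equiv I (combination a₁) (combination a) (combination_mem a₁)
    (combination_mem a) hreg h1a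
  have hE := (E.restrictScalars K).finrank_eq
  have h5 := finrank_socle h1
  have h6 := finrank_socle h1a
  have h7 := heq (s + 1) (by omega)
  have h8 := heq s (by omega)
  unfold truncLength at h7 h8
  rw [truncIdeal_eq h1, truncIdeal_eq h1a] at h7
  have hle : ∀ a : Fin d × Fin m → MvPowerSeries (Fin m) K,
      powerSeriesMaximal m K ^ (s + 1) ≤ I ⊔ Ideal.span (Set.range (combination a)) →
      truncIdeal I a s ≤ socleIdeal (I ⊔ Ideal.span (Set.range (combination a))) := by
    intro a ha
    refine sup_le (le_socleIdeal _) fun g hg => mem_socleIdeal.mpr fun r hr => ha ?_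
    rw [pow_succ']
    exact Ideal.mul_mem_mul hr hg
  have h9 : truncIdeal I a₁ s = socleIdeal (I ⊔ Ideal.span (Set.range (combination a₁))) :=
    le_antisymm (hle a₁ h1) h3
  rw [h9] at h8
  have h10 := eq_of_finrank_eq (pow_le_truncIdeal I a s) (hle a h1a) (by omega)
  exact h10.ge

/-- A strictly increasing `h` satisfies h k ≥ k, so its sum is at least (2l + 2)(2l + 1)/2, which
exceeds (2l + 2) l by l + 1. -/
theorem exists_eq_succ_of_sum_le (h : ℕ → ℕ) {l : ℕ} (hmono : ∀ k < 2 * l + 1, h k ≤ h (k + 1))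
    (hsum : ∑ k ∈ Finset.range (2 * l + 2), h k ≤ (2 * l + 2) * l) :
    ∃ k < 2 * l + 1, h k = h (k + 1) := by
  by_contra! hne
  have h1 : ∀ k ≤ 2 * l + 1, k ≤ h k := by
    intro k
    induction k with
    | zero => intro _; exact Nat.zero_le _
    | succ k ih =>
      intro hk
      have := ih (by omega)
      have := hmono k (by omega)
      have := hne k (by omega)
      omega
  have h2 : ∑ k ∈ Finset.range (2 * l + 2), k ≤ ∑ k ∈ Finset.range (2 * l + 2), h k :=
    Finset.sum_le_sum fun k hk => h1 k (by rw [Finset.mem_range] at hk; omega)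
  have h3 := Finset.sum_range_id_mul_two (2 * l + 2)
  have h4 : (2 * l + 2) * (2 * l + 2 - 1) = (2 * l + 2) * l * 2 + (2 * l + 2) := by
    rw [show 2 * l + 2 - 1 = 2 * l + 1 by omega]
    ring
  omega

end PowerSeriesReduction

open PowerSeriesReduction RingTheory.Sequence in
theorem IsLocalAdmissible.isLocalLevel {m d τ : ℕ} {K : Type u} [Field K] [Infinite K]
    (hτ : 0 < τ) {W : Submodule (MvPowerSeries (Fin m) K) (DividedPower m K)}
    (hW : IsLocalAdmissible d τ W) : IsLocalLevel W.annihilator d τ := by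
  have hR := isContractionRing_powerSeries m K
  have hdual : ∀ r (g : Fin r → MvPowerSeries (Fin m) K), AnnihilatorDuality W g :=
    fun _ g => annihilatorDuality_powerSeries W g
  have key : ∀ U : Set (Fin d × Fin m → K), IsZariskiDenseOpen U →
      ∃ (a : Fin d × Fin m → MvPowerSeries (Fin m) K) (s : ℕ), residue a ∈ U ∧
        HasType ((powerSeriesMaximal m K).map (Ideal.Quotient.mk W.annihilator)) d τ ∧
        IsRegular (MvPowerSeries (Fin m) K ⧸ W.annihilator) (List.ofFn (combination a)) ∧
        powerSeriesMaximal m K ^ (s + 1) ≤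
          W.annihilator ⊔ Ideal.span (Set.range (combination a)) ∧
        ¬ powerSeriesMaximal m K ^ s ≤
          W.annihilator ⊔ Ideal.span (Set.range (combination a)) ∧
        socleIdeal (W.annihilator ⊔ Ideal.span (Set.range (combination a))) ≤
          W.annihilator ⊔ Ideal.span (Set.range (combination a)) ⊔ powerSeriesMaximal m K ^ s := by
    intro U hU
    obtain ⟨a, y, e, Z, H, s, ha, hy, hS⟩ := hW U hU
    have hy' : (fun i => y (e i)) = combination a := funext hy
    have h1 := hS.annihilator_levelSubmodule_one hR rfl (hdual _ _)
    have h2 := hS.isRegular hR rfl hτ fun r g _ => hdual r g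
    rw [hy'] at h1 h2
    have hn : ∀ i, 0 < (1 : Fin d → ℕ) i := fun _ => Nat.one_pos
    refine ⟨a, s 1, ha, hS.hasType hR rfl hτ fun r g _ => hdual r g, h2, ?_, ?_, ?_⟩
    · rw [← h1]
      exact hS.pow_le_annihilator hR rfl hn
    · obtain ⟨f, hf, hf'⟩ := hS.exists_mem_pow_notMem_annihilator hR rfl hn hτ
      rw [h1] at hf'
      exact fun h => hf' (h hf)
    · intro g hg
      obtain ⟨f, hf, hgf⟩ := hS.exists_sub_mem_of_socle hR rfl hn (g := g) (by
        rw [h1]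
        exact mem_socleIdeal.mp hg)
      rw [h1] at hgf
      rw [← sub_add_cancel g f]
      exact Submodule.add_mem_sup hgf hf
  -- Any dense open set serves here; it only produces one admissible sequence, from which the
  -- dimension, the type and the bound `l` are taken.
  obtain ⟨-, U₀, hU₀, -, -⟩ := exists_isZariskiDenseOpen_truncLength (d := d) (n := 0) (I := W.annihilator)
  obtain ⟨a₀, s₀, -, htype, hreg, h1, -, -⟩ := key U₀ hU₀
  refine ⟨⟨?_, _, ?_, ?_, isRegular_map_quotient_mk _ hreg⟩, htype, ?_⟩
  · exact ringKrullDim_quotient_of_isRegular _ _ hreg (N := s₀ + 1) (by rwa [maximalIdeal_eq])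
  · rw [List.length_map, List.length_ofFn]
  · intro r hr
    obtain ⟨t, ht, rfl⟩ := List.mem_map.mp hr
    obtain ⟨i, rfl⟩ := (List.mem_ofFn' _ _).mp ht
    exact Ideal.mem_map_of_mem _ (combination_mem a₀ i)
  · set l := Module.finrank K (MvPowerSeries (Fin m) K ⧸
      (W.annihilator ⊔ Ideal.span (Set.range (combination a₀))).restrictScalars K)
    -- All truncated lengths at `a₀` are at most `l`, so the general ones, of minimal sum, must
    -- become stationary before 2l + 1.
    obtain ⟨h, U, hU, hh, hmin⟩ :=
      exists_isZariskiDenseOpen_truncLength (d := d) (n := 2 * l + 1) (I := W.annihilator)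
    obtain ⟨a₁, s, ha₁, -, hreg₁, h1s, h2s, h3s⟩ := key U hU
    obtain ⟨k, hk, hk'⟩ := exists_eq_succ_of_sum_le h (l := l) (fun k hk => by
      rw [← hh a₁ ha₁ k (by omega), ← hh a₁ ha₁ (k + 1) (by omega)]
      exact truncLength_mono _ _ k.le_succ) ((hmin a₀).trans (by
        refine (Finset.sum_le_card_nsmul _ _ l fun k _ => ?_).trans (by simp)
        exact finrank_quotient_anti h1 le_sup_left))
    refine ⟨U, hU, fun a ha => isArtinianLevel_of_truncLength_eq hreg₁.toIsWeaklyRegular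
      h1s h2s h3s (n := 2 * l + 1) (fun j hj => ?_) hk ?_⟩
    · rw [hh a ha j hj, hh a₁ ha₁ j hj]
    · rw [hh a ha k (by omega), hh a ha (k + 1) (by omega), hk']

/-! ### Koszul complexes -/

namespace Koszul

open scoped Matrix

/-- The index set of the standard basis of the `c`-th module of the Koszul complex of `q` elements. -/
def Index : ℕ → ℕ → Type
  | _, 0 => Unit
  | 0, _ + 1 => Empty
  | q + 1, c + 1 => Index q (c + 1) ⊕ Index q c

instance instFintype : (q c : ℕ) → Fintype (Index q c)
  | 0, 0 => inferInstanceAs (Fintype Unit)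
  | _ + 1, 0 => inferInstanceAs (Fintype Unit)
  | 0, _ + 1 => inferInstanceAs (Fintype Empty)
  | q + 1, c + 1 =>
    letI := instFintype q (c + 1)
    letI := instFintype q c
    inferInstanceAs (Fintype (Index q (c + 1) ⊕ Index q c))

instance instDecidableEq : (q c : ℕ) → DecidableEq (Index q c)
  | 0, 0 => inferInstanceAs (DecidableEq Unit)
  | _ + 1, 0 => inferInstanceAs (DecidableEq Unit)
  | 0, _ + 1 => inferInstanceAs (DecidableEq Empty)
  | q + 1, c + 1 =>
    letI := instDecidableEq q (c + 1)
    letI := instDecidableEq q c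
    inferInstanceAs (DecidableEq (Index q (c + 1) ⊕ Index q c))

instance (q : ℕ) : Unique (Index q 0) := by
  cases q <;> exact inferInstanceAs (Unique Unit)

theorem isEmpty_index {q c : ℕ} (h : q < c) : IsEmpty (Index q c) := by
  induction q generalizing c with
  | zero =>
    obtain _ | c := c
    · omega
    · exact inferInstanceAs (IsEmpty Empty)
  | succ q ih =>
    obtain _ | c := c
    · omega
    · have := ih (c := c + 1) (by omega)
      have := ih (c := c) (by omega)
      exact inferInstanceAs (IsEmpty (Index q (c + 1) ⊕ Index q c))

theorem nonempty_unique_index (q : ℕ) : Nonempty (Unique (Index q q)) := by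
  induction q with
  | zero => exact ⟨inferInstanceAs (Unique Unit)⟩
  | succ q ih =>
    obtain ⟨h⟩ := ih
    have := isEmpty_index (Nat.lt_succ_self q)
    exact ⟨(Equiv.emptySum (Index q (q + 1)) (Index q q)).unique⟩

variable {N : Type*} [CommRing N] (t : ℕ → N)

/-- The differentials of the Koszul complex of `t 0, …, t (q - 1)`. -/
def d : (q c : ℕ) → Matrix (Index q c) (Index q (c + 1)) N
  | 0, _ => 0
  | q + 1, 0 => fun _ => Sum.elim (d q 0 default) fun _ => t q
  | q + 1, c + 1 => Matrix.fromBlocks (d q (c + 1)) (t q • (1 : Matrix _ _ N)) 0 (-d q c)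

variable {t}

theorem d_succ_zero_mulVec (q : ℕ) (v : Index q 1 → N) (w : Index q 0 → N) :
    d t (q + 1) 0 *ᵥ (Sum.elim v w : Index q 1 ⊕ Index q 0 → N) =
      fun _ => (d t q 0 *ᵥ v) default + t q * w default := by
  funext a
  change ∑ b : Index q 1 ⊕ Index q 0, _ = _
  rw [Fintype.sum_sum_type]
  congr 1
  exact Fintype.sum_unique _

/-- The complex on q + 1 elements is the mapping cone of multiplication by `t q` on the complex of
the first q; the sign in the lower block makes the composites vanish. -/
theorem d_succ_succ_mulVec (q c : ℕ) (v : Index q (c + 2) → N) (w : Index q (c + 1) → N) :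
    d t (q + 1) (c + 1) *ᵥ (Sum.elim v w : Index q (c + 2) ⊕ Index q (c + 1) → N) =
      (Sum.elim (d t q (c + 1) *ᵥ v + t q • w) (-(d t q c *ᵥ w)) :
        Index q (c + 1) ⊕ Index q c → N) := by
  refine (Matrix.fromBlocks_mulVec _ _ _ _ _).trans ?_
  simp only [Sum.elim_comp_inl, Sum.elim_comp_inr, Matrix.smul_mulVec, Matrix.one_mulVec,
    Matrix.zero_mulVec, zero_add, Matrix.neg_mulVec]

omit [CommRing N] in
theorem exists_eq_elim {q c : ℕ} (v : Index (q + 1) (c + 1) → N) :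
    ∃ v₁ v₂, v = (Sum.elim v₁ v₂ : Index q (c + 1) ⊕ Index q c → N) :=
  ⟨fun a => v (Sum.inl a), fun a => v (Sum.inr a), funext fun a => by
    rcases (a : Index q (c + 1) ⊕ Index q c) with a | a <;> rfl⟩

theorem d_mulVec_d (q c : ℕ) (v : Index q (c + 2) → N) : d t q c *ᵥ (d t q (c + 1) *ᵥ v) = 0 := by
  induction q generalizing c with
  | zero =>
    have := isEmpty_index (q := 0) (c := c + 2) (by omega)
    rw [Subsingleton.elim v 0, Matrix.mulVec_zero, Matrix.mulVec_zero]
  | succ q ih =>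
    obtain ⟨v₁, v₂, rfl⟩ := exists_eq_elim v
    rw [d_succ_succ_mulVec]
    obtain _ | c := c
    · rw [d_succ_zero_mulVec]
      funext a
      simp only [Matrix.mulVec_add, Matrix.mulVec_smul, ih, Pi.add_apply, Pi.smul_apply,
        Pi.neg_apply, Pi.zero_apply, zero_add, smul_eq_mul]
      rw [mul_neg]
      exact add_neg_cancel _
    · rw [d_succ_succ_mulVec, Matrix.mulVec_neg, ih, neg_zero, neg_zero, Matrix.mulVec_add, ih,
        Matrix.mulVec_smul, smul_neg, zero_add, add_neg_cancel]
      funext a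
      rcases a with a | a <;> rfl

/-- The image of the first differential of the Koszul complex. -/
theorem exists_d_zero_mulVec_iff (q : ℕ) (f : N) :
    (∃ v, (d t q 0 *ᵥ v) default = f) ↔ f ∈ Ideal.span (t '' {i | i < q}) := by
  induction q generalizing f with
  | zero =>
    constructor
    · rintro ⟨v, rfl⟩
      change ((0 : Matrix (Index 0 0) (Index 0 1) N) *ᵥ v) default ∈ _
      rw [Matrix.zero_mulVec]
      exact Submodule.zero_mem _
    · intro h
      refine ⟨0, ?_⟩
      rw [Matrix.mulVec_zero]
      simpa [eq_comm] using h
  | succ q ih =>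
    have hset : t '' {i | i < q + 1} = insert (t q) (t '' {i | i < q}) := by
      ext x
      constructor
      · rintro ⟨i, hi, rfl⟩
        rcases Nat.lt_succ_iff_lt_or_eq.mp hi with h | rfl
        · exact Or.inr ⟨i, h, rfl⟩
        · exact Or.inl rfl
      · rintro (rfl | ⟨i, hi, rfl⟩)
        · exact ⟨q, Nat.lt_succ_self q, rfl⟩
        · exact ⟨i, Nat.lt_succ_of_lt hi, rfl⟩
    rw [hset, Ideal.span_insert]
    constructor
    · rintro ⟨v, rfl⟩
      obtain ⟨v₁, v₂, rfl⟩ := exists_eq_elim v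
      rw [d_succ_zero_mulVec]
      refine Submodule.add_mem _ (Ideal.mem_sup_right ((ih _).mp ⟨v₁, rfl⟩)) ?_
      exact Ideal.mem_sup_left (Ideal.mul_mem_right _ _ (Ideal.mem_span_singleton_self _))
    · intro h
      obtain ⟨a, ha, b, hb, rfl⟩ := Submodule.mem_sup.mp h
      obtain ⟨a, rfl⟩ := Ideal.mem_span_singleton'.mp ha
      obtain ⟨v, hv⟩ := (ih _).mpr hb
      refine ⟨(Sum.elim v fun _ => a : Index q 1 ⊕ Index q 0 → N), ?_⟩
      rw [d_succ_zero_mulVec]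
      simp only [hv]
      ring

/-- The Koszul complex of a regular sequence is exact in positive degrees. -/
theorem exists_d_mulVec_eq (q : ℕ)
    (hreg : ∀ i < q, ∀ f, t i * f ∈ Ideal.span (t '' {j | j < i}) →
      f ∈ Ideal.span (t '' {j | j < i})) (c : ℕ) (v : Index q (c + 1) → N)
    (hv : d t q c *ᵥ v = 0) : ∃ u, d t q (c + 1) *ᵥ u = v := by
  induction q generalizing c with
  | zero =>
    have := isEmpty_index (q := 0) (c := c + 1) (by omega)
    exact ⟨0, Subsingleton.elim _ _⟩
  | succ q ih =>
    have ih' := ih fun i hi => hreg i (by omega)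
    obtain ⟨v₁, v₂, rfl⟩ := exists_eq_elim v
    -- The second component is a boundary: by regularity of `t q` modulo its predecessors in the
    -- lowest degree, and by induction above it.
    obtain ⟨w, hw⟩ : ∃ w, -(d t q c *ᵥ w) = v₂ := by
      obtain _ | c := c
      · rw [d_succ_zero_mulVec] at hv
        have h1 : (d t q 0 *ᵥ v₁) default + t q * v₂ default = 0 := congrFun hv default
        have h2 : t q * v₂ default ∈ Ideal.span (t '' {j | j < q}) := by
          rw [← exists_d_zero_mulVec_iff]
          exact ⟨-v₁, by rw [Matrix.mulVec_neg, Pi.neg_apply, eq_comm, eq_neg_iff_add_eq_zero,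
            add_comm, h1]⟩
        obtain ⟨w, hw⟩ := (exists_d_zero_mulVec_iff q _).mpr (hreg q (by omega) _ h2)
        refine ⟨-w, funext fun a => ?_⟩
        rw [Matrix.mulVec_neg, neg_neg, Unique.eq_default a, hw]
      · rw [d_succ_succ_mulVec] at hv
        have h1 : -(d t q c *ᵥ v₂) = 0 := funext fun a => congrFun hv (Sum.inr a)
        obtain ⟨w, hw⟩ := ih' c v₂ (neg_eq_zero.mp h1)
        exact ⟨-w, by rw [Matrix.mulVec_neg, neg_neg, hw]⟩
    -- Subtracting `t q • w` turns the first component into a cycle of the smaller complex.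
    have h3 : d t q c *ᵥ (v₁ - t q • w) = 0 := by
      rw [Matrix.mulVec_sub, Matrix.mulVec_smul, ← neg_neg (d t q c *ᵥ w), hw, smul_neg,
        sub_neg_eq_add]
      obtain _ | c := c
      · rw [d_succ_zero_mulVec] at hv
        funext a
        rw [Unique.eq_default a]
        exact congrFun hv default
      · rw [d_succ_succ_mulVec] at hv
        exact funext fun a => congrFun hv (Sum.inl a)
    obtain ⟨u, hu⟩ := ih' c _ h3
    refine ⟨(Sum.elim u w : Index q (c + 2) ⊕ Index q (c + 1) → N), ?_⟩
    rw [d_succ_succ_mulVec, hu, hw, sub_add_cancel]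

variable (t) in
theorem d_apply (q c : ℕ) (a : Index q c) (b : Index q (c + 1)) :
    d t q c a b = 0 ∨ ∃ i < q, d t q c a b = t i ∨ d t q c a b = -t i := by
  induction q generalizing c with
  | zero => exact Or.inl rfl
  | succ q ih =>
    have lift : ∀ {x : N}, (x = 0 ∨ ∃ i < q, x = t i ∨ x = -t i) →
        (x = 0 ∨ ∃ i < q + 1, x = t i ∨ x = -t i) := by
      rintro x (h | ⟨i, hi, h⟩)
      · exact Or.inl h
      · exact Or.inr ⟨i, by omega, h⟩
    obtain _ | c := c
    · rcases (b : Index q 1 ⊕ Index q 0) with b | b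
      · exact lift (ih 0 default b)
      · exact Or.inr ⟨q, by omega, Or.inl rfl⟩
    · rcases (a : Index q (c + 1) ⊕ Index q c) with a | a <;>
        rcases (b : Index q (c + 2) ⊕ Index q (c + 1)) with b | b
      · exact lift (ih (c + 1) a b)
      · change (t q • (1 : Matrix _ _ N)) a b = 0 ∨ ∃ i < q + 1,
          (t q • (1 : Matrix _ _ N)) a b = t i ∨ (t q • (1 : Matrix _ _ N)) a b = -t i
        rw [Matrix.smul_apply, smul_eq_mul, Matrix.one_apply]
        split_ifs
        · exact Or.inr ⟨q, by omega, Or.inl (mul_one _)⟩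
        · exact Or.inl (mul_zero _)
      · exact Or.inl rfl
      · refine lift (x := -d t q c a b) ?_
        rcases ih c a b with h | ⟨i, hi, h | h⟩
        · exact Or.inl (by rw [h, neg_zero])
        · exact Or.inr ⟨i, hi, Or.inr (by rw [h])⟩
        · exact Or.inr ⟨i, hi, Or.inl (by rw [h, neg_neg])⟩

variable (t) in
-- The last module has rank one, so the last differential is a column whose entries include every `t
-- i` up to sign.
theorem exists_d_last_apply (c i : ℕ) (hi : i < c + 1) : ∃ a : Index (c + 1) c, ∀ b,
    d t (c + 1) c a b = t i ∨ d t (c + 1) c a b = -t i := by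
  induction c generalizing i with
  | zero =>
    obtain rfl : i = 0 := by omega
    refine ⟨default, fun b => ?_⟩
    rcases (b : Index 0 1 ⊕ Index 0 0) with b | b
    · exact b.elim
    · exact Or.inl rfl
  | succ c ih =>
    have hempty := isEmpty_index (q := c + 1) (c := c + 2) (by omega)
    obtain ⟨hu⟩ := nonempty_unique_index (c + 1)
    rcases Nat.lt_succ_iff_lt_or_eq.mp hi with h | rfl
    · obtain ⟨a, ha⟩ := ih i h
      refine ⟨Sum.inr a, fun b => ?_⟩
      rcases (b : Index (c + 1) (c + 2) ⊕ Index (c + 1) (c + 1)) with b | b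
      · exact hempty.elim b
      · change -d t (c + 1) c a b = t i ∨ -d t (c + 1) c a b = -t i
        rcases ha b with h | h <;> simp [h]
    · refine ⟨Sum.inl hu.default, fun b => ?_⟩
      rcases (b : Index (c + 1) (c + 2) ⊕ Index (c + 1) (c + 1)) with b | b
      · exact hempty.elim b
      · left
        change (t (c + 1) • (1 : Matrix _ _ N)) hu.default b = t (c + 1)
        rw [hu.eq_default b, Matrix.smul_apply, Matrix.one_apply_eq, smul_eq_mul, mul_one]

end Koszul

/-! ### Homogeneous bases of graded algebras over a polynomial subring -/

namespace GradedAlgebraBasis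

open MvPolynomial

variable {m d : ℕ} {K : Type u} [Field K]

theorem _root_.IsHomogeneousOfDegree.isHomogeneous {p : MvPolynomial (Fin m) K} {t : ℕ}
    (h : IsHomogeneousOfDegree p t) : p.IsHomogeneous t := fun k hk => by
  have hw : Finsupp.weight (1 : Fin m → ℕ) k = k.degree := by
    rw [Finsupp.degree_eq_weight_one]
    rfl
  rw [hw]
  exact_mod_cast h k (mem_support_iff.mpr hk)

theorem _root_.MvPolynomial.IsHomogeneous.isHomogeneousOfDegree {p : MvPolynomial (Fin m) K}
    {t : ℕ} (h : p.IsHomogeneous t) : IsHomogeneousOfDegree p t := fun k hk => by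
  have hw : Finsupp.weight (1 : Fin m → ℕ) k = k.degree := by
    rw [Finsupp.degree_eq_weight_one]
    rfl
  rw [← hw]
  exact_mod_cast h (mem_support_iff.mp hk)

theorem isHomogeneousOfDegree_zero (t : ℤ) :
    IsHomogeneousOfDegree (0 : MvPolynomial (Fin m) K) t := fun k hk => by simp at hk

theorem _root_.IsHomogeneousOfDegree.eq_zero {p : MvPolynomial (Fin m) K} {t : ℤ}
    (h : IsHomogeneousOfDegree p t) (ht : t < 0) : p = 0 := by
  by_contra hp
  obtain ⟨k, hk⟩ := support_nonempty.mpr hp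
  have := h k hk
  omega

theorem _root_.IsHomogeneousOfDegree.eq_C {p : MvPolynomial (Fin m) K} {t : ℤ}
    (h : IsHomogeneousOfDegree p t) (ht : t = 0) : p = C (constantCoeff p) := by
  subst ht
  have h1 := h.isHomogeneous (t := 0)
  exact (totalDegree_eq_zero_iff_eq_C.mp (Nat.le_zero.mp h1.totalDegree_le))

theorem _root_.IsHomogeneousOfDegree.add {p q : MvPolynomial (Fin m) K} {t : ℤ}
    (hp : IsHomogeneousOfDegree p t) (hq : IsHomogeneousOfDegree q t) :
    IsHomogeneousOfDegree (p + q) t := by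
  classical
  intro k hk
  rcases Finset.mem_union.mp (support_add hk) with h | h
  · exact hp k h
  · exact hq k h

theorem _root_.IsHomogeneousOfDegree.neg {p : MvPolynomial (Fin m) K} {t : ℤ}
    (hp : IsHomogeneousOfDegree p t) : IsHomogeneousOfDegree (-p) t := fun k hk =>
  hp k (by rwa [support_neg] at hk)

theorem _root_.IsHomogeneousOfDegree.sum {ι : Type*} (s : Finset ι)
    {p : ι → MvPolynomial (Fin m) K} {t : ℤ} (hp : ∀ i ∈ s, IsHomogeneousOfDegree (p i) t) :
    IsHomogeneousOfDegree (∑ i ∈ s, p i) t :=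
  Finset.sum_induction p (fun q => IsHomogeneousOfDegree q t)
    (fun _ _ => IsHomogeneousOfDegree.add) (isHomogeneousOfDegree_zero t) hp

theorem _root_.IsHomogeneousOfDegree.mul {p q : MvPolynomial (Fin m) K} {t t' : ℤ}
    (hp : IsHomogeneousOfDegree p t) (hq : IsHomogeneousOfDegree q t') :
    IsHomogeneousOfDegree (p * q) (t + t') := by
  classical
  intro k hk
  obtain ⟨a, ha, b, hb, rfl⟩ := Finset.mem_add.mp (support_mul p q hk)
  rw [map_add]
  push_cast
  rw [hp a ha, hq b hb]

theorem _root_.IsHomogeneousOfDegree.aeval {p : MvPolynomial (Fin d) K} {t : ℤ}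
    (hp : IsHomogeneousOfDegree p t) {z : Fin d → MvPolynomial (Fin m) K}
    (hz : ∀ i, (z i).IsHomogeneous 1) : IsHomogeneousOfDegree (MvPolynomial.aeval z p) t := by
  rcases lt_or_ge t 0 with ht | ht
  · rw [hp.eq_zero ht, map_zero]
    exact isHomogeneousOfDegree_zero t
  · lift t to ℕ using ht
    have := hp.isHomogeneous.aeval z hz
    rw [one_mul] at this
    exact this.isHomogeneousOfDegree

theorem homogeneousComponent_succ_mul {z : MvPolynomial (Fin m) K} (hz : z.IsHomogeneous 1)
    (h : MvPolynomial (Fin m) K) (t : ℕ) :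
    homogeneousComponent (t + 1) (h * z) = homogeneousComponent t h * z := by
  conv_lhs => rw [← sum_homogeneousComponent h, Finset.sum_mul, map_sum]
  have h1 : ∀ i, homogeneousComponent (t + 1) (homogeneousComponent i h * z) =
      if i = t then homogeneousComponent t h * z else 0 := by
    intro i
    rw [homogeneousComponent_of_mem ((homogeneousComponent_isHomogeneous i h).mul hz)]
    by_cases hi : i = t
    · simp [hi]
    · rw [if_neg (by omega), if_neg hi]
  simp only [h1]
  rw [Finset.sum_ite_eq']
  split_ifs with hmem
  · rfl
  · rw [homogeneousComponent_eq_zero t h (by rw [Finset.mem_range] at hmem; omega), zero_mul]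

theorem homogeneousComponent_zero_mul {z : MvPolynomial (Fin m) K} (hz : z.IsHomogeneous 1)
    (h : MvPolynomial (Fin m) K) : homogeneousComponent 0 (h * z) = 0 := by
  rw [homogeneousComponent_zero, ← constantCoeff_eq, map_mul, constantCoeff_eq, hz.coeff_eq_zero (d := 0) (by simp), mul_zero,
    map_zero]

/-- A homogeneous family of polynomials whose classes form a `K`-basis of `R / J`. -/
structure IsQuotientBasis {κ : Type*} [Fintype κ] (J : Ideal (MvPolynomial (Fin m) K))
    (b : κ → MvPolynomial (Fin m) K) (δ : κ → ℕ) : Prop where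
  homogeneous : ∀ k, (b k).IsHomogeneous (δ k)
  span : ∀ f, ∃ l : κ → K, f - ∑ k, C (l k) * b k ∈ J
  indep : ∀ l : κ → K, ∑ k, C (l k) * b k ∈ J → l = 0

/-- Monomials of degree above `s` vanish in the quotient, so a basis can be extracted from the
finitely many others. -/
theorem exists_isQuotientBasis {J : Ideal (MvPolynomial (Fin m) K)} {s : ℕ}
    (hs : polynomialMaximal m K ^ (s + 1) ≤ J) :
    ∃ (κ : Type u) (_ : Fintype κ) (b : κ → MvPolynomial (Fin m) K) (δ : κ → ℕ),
      IsQuotientBasis J b δ ∧ ∀ k, δ k ≤ s := by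
  classical
  let V := MvPolynomial (Fin m) K ⧸ J.restrictScalars K
  let T : Set (Fin m →₀ ℕ) := {k | k.degree ≤ s}
  have hT : T.Finite := Finsupp.finite_of_degree_le s
  let μ : (Fin m →₀ ℕ) → V := fun k => Submodule.Quotient.mk (monomial k 1)
  obtain ⟨B, hBT, hBspan, hBli⟩ := exists_linearIndependent K (μ '' T)
  have hBfin : B.Finite := (hT.image μ).subset hBT
  have : Fintype B := hBfin.fintype
  choose ν hν hνμ using fun v : B => hBT v.2
  refine ⟨B, inferInstance, fun v => monomial (ν v) 1, fun v => (ν v).degree,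
    ⟨fun v => isHomogeneous_monomial _ rfl, fun f => ?_, fun l hl => ?_⟩, hν⟩
  · have h1 : (Submodule.Quotient.mk f : V) ∈ Submodule.span K B := by
      rw [hBspan, f.as_sum, ← Submodule.mkQ_apply, map_sum]
      refine Submodule.sum_mem _ fun k _ => ?_
      have h2 : (monomial k (coeff k f) : MvPolynomial (Fin m) K) =
          coeff k f • monomial k 1 := by rw [smul_monomial, smul_eq_mul, mul_one]
      rw [h2, map_smul]
      refine Submodule.smul_mem _ _ ?_
      by_cases hk : k ∈ T
      · exact Submodule.subset_span ⟨k, hk, rfl⟩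
      · have h3 : (monomial k 1 : MvPolynomial (Fin m) K) ∈ J := by
          refine hs (Ideal.pow_le_pow_right (Nat.lt_of_not_le hk) ?_)
          rw [monomial_eq, C_1, one_mul]
          exact IsContractionRing.monomial_mem_pow
            (fun i => Ideal.subset_span (Set.mem_range_self i)) k
        have h4 : μ k = 0 := (Submodule.Quotient.mk_eq_zero _).mpr h3
        change μ k ∈ _
        rw [h4]
        exact Submodule.zero_mem _
    have h4 : B = Set.range ((↑) : B → V) := Subtype.range_coe.symm
    rw [h4, Submodule.mem_span_range_iff_exists_fun] at h1
    obtain ⟨l, hl⟩ := h1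
    refine ⟨l, ?_⟩
    have h5 : (Submodule.Quotient.mk (f - ∑ v, C (l v) * monomial (ν v) 1) : V) = 0 := by
      rw [← Submodule.mkQ_apply, map_sub, map_sum, sub_eq_zero, Submodule.mkQ_apply, ← hl]
      refine Finset.sum_congr rfl fun v _ => ?_
      rw [← smul_eq_C_mul, map_smul, ← hνμ v]
      rfl
    exact (Submodule.Quotient.mk_eq_zero _).mp h5
  · refine funext fun v => Fintype.linearIndependent_iff.mp hBli l ?_ v
    have h5 : (Submodule.Quotient.mk (∑ v, C (l v) * monomial (ν v) 1) : V) = 0 :=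
      (Submodule.Quotient.mk_eq_zero _).mpr hl
    rw [← h5, ← Submodule.mkQ_apply, map_sum]
    refine Finset.sum_congr rfl fun v _ => ?_
    rw [← smul_eq_C_mul, map_smul, ← hνμ v]
    rfl

section

variable {κ : Type*} [Fintype κ] {J : Ideal (MvPolynomial (Fin m) K)}
  {b : κ → MvPolynomial (Fin m) K} {δ : κ → ℕ}

theorem IsQuotientBasis.exists_of_isHomogeneous (hb : IsQuotientBasis J b δ)
    (hJ : ∀ f ∈ J, ∀ i, homogeneousComponent i f ∈ J) {f : MvPolynomial (Fin m) K} {t : ℕ}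
    (hf : f.IsHomogeneous t) : ∃ l : κ → K, (∀ k, δ k ≠ t → l k = 0) ∧
      f - ∑ k, C (l k) * b k ∈ J := by
  obtain ⟨l, hl⟩ := hb.span f
  refine ⟨fun k => if δ k = t then l k else 0, fun k hk => if_neg hk, ?_⟩
  have h1 := hJ _ hl t
  rw [map_sub, homogeneousComponent_eq_self hf, map_sum] at h1
  refine (congrArg (· ∈ J) ?_).mp h1
  congr 1
  refine Finset.sum_congr rfl fun k _ => ?_
  rw [homogeneousComponent_C_mul, homogeneousComponent_of_mem (hb.homogeneous k)]
  dsimp only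
  by_cases h : δ k = t
  · rw [if_pos h.symm, if_pos h]
  · rw [if_neg (Ne.symm h), if_neg h, map_zero, mul_zero, zero_mul]

/-- A homogeneous family of polynomials whose classes form a basis of `R / I` over the polynomial
ring in `d` variables, which acts through the linear forms `z`. -/
structure IsGradedBasis (I : Ideal (MvPolynomial (Fin m) K)) (z : Fin d → MvPolynomial (Fin m) K)
    (b : κ → MvPolynomial (Fin m) K) (δ : κ → ℕ) : Prop where
  homogeneous : ∀ k, (b k).IsHomogeneous (δ k)
  span : ∀ (t : ℕ) f, f.IsHomogeneous t → ∃ c : κ → MvPolynomial (Fin d) K,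
    (∀ k, IsHomogeneousOfDegree (c k) ((t : ℤ) - δ k)) ∧ f - ∑ k, aeval z (c k) * b k ∈ I
  indep : ∀ c : κ → MvPolynomial (Fin d) K, ∑ k, aeval z (c k) * b k ∈ I → c = 0

variable {I : Ideal (MvPolynomial (Fin m) K)} {z : Fin d → MvPolynomial (Fin m) K}

theorem exists_homogeneous_sum (hI : ∀ f ∈ I, ∀ i, homogeneousComponent i f ∈ I)
    (hz : ∀ i, (z i).IsHomogeneous 1) {f : MvPolynomial (Fin m) K}
    (hf : f ∈ I ⊔ Ideal.span (Set.range z)) (t : ℕ) :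
    ∃ h : Fin d → MvPolynomial (Fin m) K, (∀ i, (h i).IsHomogeneous t) ∧
      homogeneousComponent (t + 1) f - ∑ i, h i * z i ∈ I := by
  obtain ⟨g, hg, g', hg', rfl⟩ := Submodule.mem_sup.mp hf
  obtain ⟨h, rfl⟩ := (Submodule.mem_span_range_iff_exists_fun _).mp hg'
  refine ⟨fun i => homogeneousComponent t (h i), fun i => homogeneousComponent_isHomogeneous _ _, ?_⟩
  rw [map_add, map_sum]
  simp only [smul_eq_mul, homogeneousComponent_succ_mul (hz _), add_sub_cancel_right]
  exact hI g hg _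

theorem homogeneousComponent_zero_mem (hI : ∀ f ∈ I, ∀ i, homogeneousComponent i f ∈ I)
    (hz : ∀ i, (z i).IsHomogeneous 1) {f : MvPolynomial (Fin m) K}
    (hf : f ∈ I ⊔ Ideal.span (Set.range z)) : homogeneousComponent 0 f ∈ I := by
  obtain ⟨g, hg, g', hg', rfl⟩ := Submodule.mem_sup.mp hf
  obtain ⟨h, rfl⟩ := (Submodule.mem_span_range_iff_exists_fun _).mp hg'
  rw [map_add, map_sum]
  simp only [smul_eq_mul, homogeneousComponent_zero_mul (hz _), Finset.sum_const_zero, add_zero]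
  exact hI g hg _

/-- A homogeneous `K`-basis of `R / (I, z_1, …, z_d)` lifts to a basis of `R / I` over
`K[z_1, …, z_d]` if `z_1, …, z_d` is quasi-regular. -/
theorem IsQuotientBasis.isGradedBasis
    (hb : IsQuotientBasis (I ⊔ Ideal.span (Set.range z)) b δ)
    (hI : ∀ f ∈ I, ∀ i, homogeneousComponent i f ∈ I)
    (hJ : ∀ f ∈ I ⊔ Ideal.span (Set.range z), ∀ i,
      homogeneousComponent i f ∈ I ⊔ Ideal.span (Set.range z))
    (hz : ∀ i, (z i).IsHomogeneous 1)
    (hquasi : ∀ (T : Finset (Fin d →₀ ℕ)) (g : (Fin d →₀ ℕ) → MvPolynomial (Fin m) K),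
      ∑ α ∈ T, (∏ i, z i ^ α i) * g α ∈ I → ∀ α₀ ∈ T, (∀ α ∈ T, α ≤ α₀ → α = α₀) →
        g α₀ ∈ I ⊔ Ideal.span (Set.range z)) : IsGradedBasis I z b δ := by
  classical
  refine ⟨hb.homogeneous, fun t => ?_, fun c hc => ?_⟩
  · have lift : ∀ (t : ℕ) (l : κ → K), (∀ k, δ k ≠ t → l k = 0) → ∀ k,
        IsHomogeneousOfDegree (C (l k) : MvPolynomial (Fin d) K) ((t : ℤ) - δ k) := by
      intro t l hl k
      by_cases hk : δ k = t
      · rw [hk, sub_self]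
        exact_mod_cast (isHomogeneous_C (Fin d) (l k)).isHomogeneousOfDegree
      · rw [hl k hk, map_zero]
        exact isHomogeneousOfDegree_zero _
    -- Induction on the degree: modulo `I`, what remains after a K-combination of the `b k` is a
    -- combination of the `z i` with homogeneous coefficients of degree one less.
    induction t with
    | zero =>
      intro f hf
      obtain ⟨l, hl, hfl⟩ := hb.exists_of_isHomogeneous hJ hf
      refine ⟨fun k => C (l k), lift 0 l hl, ?_⟩
      have h1 := homogeneousComponent_zero_mem hI hz hfl
      have h2 : (f - ∑ k, C (l k) * b k).IsHomogeneous 0 := by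
        refine hf.sub (IsHomogeneous.sum _ _ _ fun k _ => ?_)
        by_cases hk : δ k = 0
        · have := (isHomogeneous_C (Fin m) (l k)).mul (hb.homogeneous k)
          rwa [hk] at this
        · rw [hl k hk, map_zero, zero_mul]
          exact isHomogeneous_zero _ _ _
      rw [homogeneousComponent_eq_self h2] at h1
      simp only [aeval_C]
      exact h1
    | succ t ih =>
      intro f hf
      obtain ⟨l, hl, hfl⟩ := hb.exists_of_isHomogeneous hJ hf
      have h2 : (f - ∑ k, C (l k) * b k).IsHomogeneous (t + 1) := by
        refine hf.sub (IsHomogeneous.sum _ _ _ fun k _ => ?_)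
        by_cases hk : δ k = t + 1
        · have := (isHomogeneous_C (Fin m) (l k)).mul (hb.homogeneous k)
          rwa [hk, zero_add] at this
        · rw [hl k hk, map_zero, zero_mul]
          exact isHomogeneous_zero _ _ _
      obtain ⟨h, hh, hfh⟩ := exists_homogeneous_sum hI hz hfl t
      rw [homogeneousComponent_eq_self h2] at hfh
      choose c' hc' hhc' using fun i => ih (h i) (hh i)
      refine ⟨fun k => C (l k) + ∑ i, X i * c' i k, fun k => ?_, ?_⟩
      · refine (lift (t + 1) l hl k).add (IsHomogeneousOfDegree.sum _ fun i _ => ?_)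
        have := (isHomogeneous_X K i).isHomogeneousOfDegree.mul (hc' i k)
        convert this using 1
        push_cast
        ring
      · have h3 : f - ∑ k, aeval z (C (l k) + ∑ i, X i * c' i k) * b k =
            (f - ∑ k, C (l k) * b k - ∑ i, h i * z i) +
              ∑ i, (h i - ∑ k, aeval z (c' i k) * b k) * z i := by
          simp only [map_add, map_sum, map_mul, aeval_C, aeval_X, add_mul, sub_mul,
            Finset.sum_add_distrib, Finset.sum_sub_distrib, Finset.sum_mul]
          rw [Finset.sum_comm (s := (Finset.univ : Finset κ))]
          have h4 : ∀ i k, z i * aeval z (c' i k) * b k = aeval z (c' i k) * b k * z i :=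
            fun i k => by ring
          simp only [h4]
          rw [show (algebraMap K (MvPolynomial (Fin m) K)) = C from rfl]
          ring
        rw [h3]
        exact Submodule.add_mem _ hfh (Ideal.sum_mem _ fun i _ =>
          Ideal.mul_mem_right _ _ (hhc' i))
  · by_contra hne
    let T : Finset (Fin d →₀ ℕ) := Finset.univ.biUnion fun k => (c k).support
    have hTne : T.Nonempty := by
      obtain ⟨k, hk⟩ := Function.ne_iff.mp hne
      obtain ⟨α, hα⟩ := support_nonempty.mpr hk
      exact ⟨α, Finset.mem_biUnion.mpr ⟨k, Finset.mem_univ k, hα⟩⟩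
    -- A minimal exponent in a nontrivial relation: quasi-regularity gives a K-linear relation among
    -- the `b k` with the coefficients at that exponent.
    obtain ⟨α₀, hα₀, hmin⟩ := T.exists_minimal hTne
    have hexp : ∀ k, aeval z (c k) = ∑ α ∈ T, C (coeff α (c k)) * ∏ i, z i ^ α i := by
      intro k
      rw [aeval_def, eval₂_eq']
      refine Finset.sum_subset
        (fun α hα => Finset.mem_biUnion.mpr ⟨k, Finset.mem_univ k, hα⟩) fun α _ hα => ?_
      rw [notMem_support_iff.mp hα, map_zero, zero_mul]
    have h1 := hquasi T (fun α => ∑ k, C (coeff α (c k)) * b k) (by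
      refine (congrArg (· ∈ I) ?_).mp hc
      simp only [hexp, Finset.sum_mul, Finset.mul_sum]
      rw [Finset.sum_comm]
      refine Finset.sum_congr rfl fun α _ => Finset.sum_congr rfl fun k _ => ?_
      ring) α₀ hα₀ fun α hα hle => le_antisymm hle (hmin hα hle)
    have h2 := hb.indep (fun k => coeff α₀ (c k)) h1
    obtain ⟨k, -, hk⟩ := Finset.mem_biUnion.mp hα₀
    exact (mem_support_iff.mp hk) (congrFun h2 k)

end

end GradedAlgebraBasis

/-! ### Linear coordinates and R ⊗ (R/I) as a polynomial ring -/

namespace GradedAlgebraBasis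

open MvPolynomial

variable {m d p : ℕ} {K : Type u} [Field K]

/-- Linear forms generating the maximal homogeneous ideal are coordinates. -/
theorem bijective_aeval {y : Fin m → MvPolynomial (Fin m) K} (hy : ∀ i, (y i).IsHomogeneous 1)
    (hspan : Ideal.span (Set.range y) = polynomialMaximal m K) :
    Function.Bijective (aeval (R := K) y) := by
  have hsurj : Function.Surjective (aeval (R := K) y) := by
    rw [← AlgHom.range_eq_top, eq_top_iff, ← adjoin_range_X, Algebra.adjoin_le_iff]
    rintro _ ⟨i, rfl⟩
    have h1 : (X i : MvPolynomial (Fin m) K) ∈ Ideal.span (Set.range y) := by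
      rw [hspan]
      exact Ideal.subset_span ⟨i, rfl⟩
    obtain ⟨r, hr⟩ := (Submodule.mem_span_range_iff_exists_fun _).mp h1
    -- In degree one, the coefficients may be replaced by their constant terms.
    have h2 := congrArg (homogeneousComponent 1) hr
    rw [homogeneousComponent_eq_self (isHomogeneous_X K i), map_sum] at h2
    simp only [smul_eq_mul] at h2
    refine ⟨∑ j, C (coeff 0 (r j)) * X j, ?_⟩
    change aeval (R := K) y _ = _
    rw [← h2]
    simp only [map_sum, map_mul, aeval_C, aeval_X]
    refine Finset.sum_congr rfl fun j _ => ?_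
    rw [homogeneousComponent_succ_mul (hy j), homogeneousComponent_zero]
    rfl
  refine ⟨?_, hsurj⟩
  rw [injective_iff_map_eq_zero]
  intro r hr
  by_contra hne
  -- A nonzero element in the kernel of a surjective endomorphism of this domain would make its
  -- dimension smaller than itself.
  have h1 := ringKrullDim_succ_le_of_surjective (aeval (R := K) y).toRingHom hsurj
    (mem_nonZeroDivisors_of_ne_zero hne) hr
  rw [MvPolynomial.ringKrullDim_of_isNoetherianRing, ringKrullDim_eq_zero_of_field] at h1
  have h2 : ((Nat.card (Fin m) + 1 : ℕ) : WithBot ℕ∞) ≤ (Nat.card (Fin m) : ℕ) := by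
    push_cast
    simpa using h1
  have h3 : Nat.card (Fin m) + 1 ≤ Nat.card (Fin m) := by exact_mod_cast h2
  omega

theorem bijective_eval₂Hom {y : Fin m → MvPolynomial (Fin m) K}
    (hy : ∀ i, (y i).IsHomogeneous 1) (hspan : Ideal.span (Set.range y) = polynomialMaximal m K)
    (η : Fin p ⊕ Fin d ≃ Fin m) :
    Function.Bijective (eval₂Hom (aeval (R := K) fun i => y (η (Sum.inr i))).toRingHom
      fun i => y (η (Sum.inl i))) := by
  set f := eval₂Hom (aeval (R := K) fun i => y (η (Sum.inr i))).toRingHom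
      fun i => y (η (Sum.inl i))
  have h1 : f.comp (sumRingEquiv K (Fin p) (Fin d)).toRingHom =
      (aeval (R := K) y).toRingHom.comp (renameEquiv K η).toRingEquiv.toRingHom := by
    refine ringHom_ext (fun r => ?_) fun i => ?_
    · simp [f]
    · rcases i with i | i <;> simp [f]
  have h2 : ∀ q, f (sumRingEquiv K (Fin p) (Fin d) q) = aeval (R := K) y (renameEquiv K η q) :=
    fun q => DFunLike.congr_fun h1 q
  have h3 : ⇑f = aeval (R := K) y ∘ renameEquiv K η ∘ (sumRingEquiv K (Fin p) (Fin d)).symm := by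
    funext q
    rw [Function.comp_apply, Function.comp_apply, ← h2, RingEquiv.apply_symm_apply]
  rw [h3]
  exact (bijective_aeval hy hspan).comp
    ((renameEquiv K η).bijective.comp (sumRingEquiv K (Fin p) (Fin d)).symm.bijective)

theorem bijective_translation {A : Type*} [CommRing A] (a : Fin p → A) :
    Function.Bijective (aeval (R := A) fun i => (X i + C (a i) : MvPolynomial (Fin p) A)) := by
  have h : ∀ a : Fin p → A,
      (aeval (R := A) fun i => (X i - C (a i) : MvPolynomial (Fin p) A)).comp
        (aeval (R := A) fun i => (X i + C (a i) : MvPolynomial (Fin p) A)) = AlgHom.id A _ := by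
    intro a
    refine MvPolynomial.algHom_ext fun i => ?_
    simp [← algebraMap_eq]
  have h' : ∀ a : Fin p → A,
      (aeval (R := A) fun i => (X i + C (a i) : MvPolynomial (Fin p) A)).comp
        (aeval (R := A) fun i => (X i - C (a i) : MvPolynomial (Fin p) A)) = AlgHom.id A _ := by
    intro a
    refine MvPolynomial.algHom_ext fun i => ?_
    simp [← algebraMap_eq]
  exact Function.bijective_iff_has_inverse.mpr
    ⟨_, fun x => DFunLike.congr_fun (h a) x, fun x => DFunLike.congr_fun (h' a) x⟩

variable {κ : Type*} [Fintype κ] {S A : Type*} [CommRing S] [CommRing A]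

/-- A basis remains a basis after adjoining variables. -/
theorem bijective_sum_map (π : S →+* A) (β : κ → A)
    (h : Function.Bijective fun c : κ → S => ∑ k, π (c k) * β k) :
    Function.Bijective fun w : κ → MvPolynomial (Fin p) S =>
      ∑ k, map π (w k) * (C (β k) : MvPolynomial (Fin p) A) := by
  classical
  have hcoeff : ∀ (w : κ → MvPolynomial (Fin p) S) (α : Fin p →₀ ℕ),
      coeff α (∑ k, map π (w k) * (C (β k) : MvPolynomial (Fin p) A)) =
        ∑ k, π (coeff α (w k)) * β k := by
    intro w α
    rw [coeff_sum]
    refine Finset.sum_congr rfl fun k _ => ?_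
    rw [mul_comm, coeff_C_mul, coeff_map, mul_comm]
  constructor
  · intro w w' hw
    funext k
    ext α
    have h1 := congrArg (coeff α) hw
    simp only [hcoeff] at h1
    exact congrFun (h.1 h1) k
  · intro n
    choose g hg using fun α => h.2 (coeff α n)
    refine ⟨fun k => ∑ α ∈ n.support, monomial α (g α k), ?_⟩
    ext α
    simp only [hcoeff, coeff_sum, coeff_monomial]
    simp only [Finset.sum_ite_eq']
    by_cases hα : α ∈ n.support
    · simp only [if_pos hα]
      exact hg α
    · simp only [if_neg hα, map_zero, zero_mul, Finset.sum_const_zero]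
      exact (notMem_support_iff.mp hα).symm

variable {I : Ideal (MvPolynomial (Fin m) K)} {z : Fin d → MvPolynomial (Fin m) K}
  {b : κ → MvPolynomial (Fin m) K} {δ : κ → ℕ}

theorem IsGradedBasis.bijective (hb : IsGradedBasis I z b δ) :
    Function.Bijective fun c : κ → MvPolynomial (Fin d) K =>
      ∑ k, Ideal.Quotient.mk I (aeval z (c k)) * Ideal.Quotient.mk I (b k) := by
  have hsum : ∀ c : κ → MvPolynomial (Fin d) K,
      ∑ k, Ideal.Quotient.mk I (aeval z (c k)) * Ideal.Quotient.mk I (b k) =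
        Ideal.Quotient.mk I (∑ k, aeval z (c k) * b k) := by
    intro c
    simp only [map_sum, map_mul]
  simp only [hsum]
  constructor
  · intro c c' h
    rw [← sub_eq_zero]
    refine hb.indep _ ?_
    have h1 := Ideal.Quotient.eq.mp h
    rw [← Finset.sum_sub_distrib] at h1
    refine (congrArg (· ∈ I) (Finset.sum_congr rfl fun k _ => ?_)).mp h1
    rw [Pi.sub_apply, map_sub, sub_mul]
  · intro a
    obtain ⟨f, rfl⟩ := Ideal.Quotient.mk_surjective a
    choose c hc using fun i => hb.span i _ (homogeneousComponent_isHomogeneous i f)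
    refine ⟨fun k => ∑ i ∈ Finset.range (f.totalDegree + 1), c i k, ?_⟩
    refine (Ideal.Quotient.eq.mpr ?_).symm
    conv => enter [2, 1]; rw [← sum_homogeneousComponent f]
    simp only [map_sum, Finset.sum_mul]
    rw [Finset.sum_comm, ← Finset.sum_sub_distrib]
    exact Ideal.sum_mem _ fun i _ => (hc i).2

/-- `R ⊗ (R / I)`, the tensor product over `K[z_1, …, z_d]`, as a polynomial ring over `R / I`. -/
theorem IsGradedBasis.exists_ringHom (hb : IsGradedBasis I z b δ)
    {y : Fin p → MvPolynomial (Fin m) K}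
    (hy : Function.Bijective (eval₂Hom (aeval (R := K) z).toRingHom y)) :
    ∃ φ : MvPolynomial (Fin m) K →+* MvPolynomial (Fin p) (MvPolynomial (Fin m) K ⧸ I),
      (∀ i, φ (y i) = X i + C (Ideal.Quotient.mk I (y i))) ∧
      (∀ q, φ (aeval (R := K) z q) = C (Ideal.Quotient.mk I (aeval (R := K) z q))) ∧
      (∀ r, constantCoeff (φ r) = Ideal.Quotient.mk I r) ∧
      Function.Bijective fun w : κ → MvPolynomial (Fin m) K =>
        ∑ k, φ (w k) * C (Ideal.Quotient.mk I (b k)) := by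
  let R := MvPolynomial (Fin m) K
  let A := R ⧸ I
  let π : MvPolynomial (Fin d) K →+* A := (Ideal.Quotient.mk I).comp (aeval (R := K) z).toRingHom
  let ψ := RingEquiv.ofBijective _ hy
  let σ := aeval (R := A) fun i => (X i + C (Ideal.Quotient.mk I (y i)) : MvPolynomial (Fin p) A)
  -- Read `R` as K[z][y], reduce the coefficients to `A`, then translate, so that X_i stands for y_i
  -- ⊗ 1 - 1 ⊗ y_i.
  let φ : R →+* MvPolynomial (Fin p) A := (σ.toRingHom.comp (map π)).comp ψ.symm.toRingHom
  have hφ : ∀ q, φ (ψ q) = σ (map π q) := fun q =>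
    congrArg (fun q => σ (map π q)) (ψ.symm_apply_apply q)
  have hψX : ∀ i, ψ (X i) = y i := fun i => by simp [ψ]
  have hψC : ∀ q, ψ (C q) = aeval z q := fun q => by simp [ψ]
  have h1 : ∀ i, φ (y i) = X i + C (Ideal.Quotient.mk I (y i)) := fun i => by
    rw [← hψX, hφ, map_X, hψX]
    exact aeval_X _ _
  have h2 : ∀ q, φ (aeval z q) = C (Ideal.Quotient.mk I (aeval z q)) := fun q => by
    rw [← hψC, hφ, map_C, hψC]
    exact aeval_C _ _
  refine ⟨φ, h1, h2, fun r => ?_, ?_⟩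
  · have h3 : ((constantCoeff (R := A) (σ := Fin p)).comp φ).comp ψ.toRingHom =
        (Ideal.Quotient.mk I).comp ψ.toRingHom := by
      refine ringHom_ext (fun q => ?_) fun i => ?_
      · change constantCoeff (φ (ψ (C q))) = Ideal.Quotient.mk I (ψ (C q))
        rw [hψC, h2, constantCoeff_C]
      · change constantCoeff (φ (ψ (X i))) = Ideal.Quotient.mk I (ψ (X i))
        rw [hψX, h1, map_add, constantCoeff_C, constantCoeff_X, zero_add]
    obtain ⟨q, rfl⟩ := ψ.surjective r
    exact congrArg (fun g : MvPolynomial (Fin p) (MvPolynomial (Fin d) K) →+* A => g q) h3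
  · have h3 := bijective_sum_map (p := p) π (fun k => Ideal.Quotient.mk I (b k)) hb.bijective
    have h4 : (fun w : κ → R => ∑ k, φ (w k) * C (Ideal.Quotient.mk I (b k))) =
        σ ∘ (fun w : κ → MvPolynomial (Fin p) (MvPolynomial (Fin d) K) =>
          ∑ k, map π (w k) * (C (Ideal.Quotient.mk I (b k)) : MvPolynomial (Fin p) A)) ∘
          fun w k => ψ.symm (w k) := by
      funext w
      simp only [Function.comp_apply, map_sum, map_mul]
      refine Finset.sum_congr rfl fun k _ => ?_
      congr 1
      exact (aeval_C _ _).symm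
    rw [h4]
    refine (bijective_translation _).comp (h3.comp ?_)
    exact (Equiv.piCongrRight fun _ : κ => ψ.symm.toEquiv).bijective

end GradedAlgebraBasis

/-! ### Graded free resolutions -/

namespace GradedFreeResolution

open scoped Matrix

variable {m : ℕ} {K : Type u} [Field K] {I : Ideal (MvPolynomial (Fin m) K)}
  {ξ : ℕ → Type*} [∀ c, Fintype (ξ c)]

/-- A graded free resolution with bases indexed by arbitrary finite types. -/
noncomputable def ofFintype (sh : ∀ c, ξ c → ℤ)
    (D : ∀ c, Matrix (ξ c) (ξ (c + 1)) (MvPolynomial (Fin m) K))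
    (au : ξ 0 → MvPolynomial (Fin m) K)
    (hD : ∀ c k l, IsHomogeneousOfDegree (D c k l) (sh (c + 1) l - sh c k))
    (hau : ∀ k, IsHomogeneousOfDegree (au k) (sh 0 k))
    (hsurj : I ⊔ Ideal.span (Set.range au) = ⊤)
    (hzero : ∀ v : ξ 0 → MvPolynomial (Fin m) K, (∑ k, v k * au k ∈ I) ↔ ∃ u, D 0 *ᵥ u = v)
    (hsucc : ∀ c v, D c *ᵥ v = 0 ↔ ∃ u, D (c + 1) *ᵥ u = v) : GradedFreeResolution I where
  rank c := Fintype.card (ξ c)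
  shift c k := sh c ((Fintype.equivFin (ξ c)).symm k)
  diff c := (D c).submatrix (Fintype.equivFin (ξ c)).symm (Fintype.equivFin (ξ (c + 1))).symm
  aug k := au ((Fintype.equivFin (ξ 0)).symm k)
  diff_homogeneous c k l := hD c _ _
  aug_homogeneous k := hau _
  aug_surjective := by
    rw [← hsurj]
    congr 2
    exact (Fintype.equivFin (ξ 0)).symm.surjective.range_comp au
  exact_zero v := by
    rw [← (Fintype.equivFin (ξ 0)).sum_comp]
    simp only [Equiv.symm_apply_apply]
    rw [hzero fun k => v (Fintype.equivFin (ξ 0) k)]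
    constructor
    · rintro ⟨u, hu⟩
      refine ⟨u ∘ (Fintype.equivFin (ξ 1)).symm, ?_⟩
      rw [Matrix.mulVecLin_apply, Matrix.submatrix_mulVec_equiv]
      funext k
      simp only [Function.comp_assoc, Equiv.symm_symm, Equiv.symm_comp_self, Function.comp_id]
      rw [Function.comp_apply, hu]
      exact congrArg v (Equiv.apply_symm_apply _ k)
    · rintro ⟨u, rfl⟩
      refine ⟨u ∘ Fintype.equivFin (ξ 1), ?_⟩
      rw [Matrix.mulVecLin_apply, Matrix.submatrix_mulVec_equiv]
      funext k
      simp
  exact_succ c := by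
    ext v
    rw [LinearMap.mem_ker, Matrix.mulVecLin_apply, Matrix.submatrix_mulVec_equiv, Equiv.symm_symm]
    have h1 : (D c *ᵥ (v ∘ Fintype.equivFin (ξ (c + 1)))) ∘ (Fintype.equivFin (ξ c)).symm = 0 ↔
        D c *ᵥ (v ∘ Fintype.equivFin (ξ (c + 1))) = 0 := by
      constructor
      · intro h
        funext k
        simpa using congrFun h (Fintype.equivFin (ξ c) k)
      · intro h
        rw [h]
        rfl
    rw [h1, hsucc]
    constructor
    · rintro ⟨u, hu⟩
      refine ⟨u ∘ (Fintype.equivFin (ξ (c + 2))).symm, ?_⟩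
      rw [Matrix.mulVecLin_apply, Matrix.submatrix_mulVec_equiv]
      simp only [Function.comp_assoc, Equiv.symm_symm, Equiv.symm_comp_self, Function.comp_id]
      rw [hu]
      funext k
      simp
    · rintro ⟨u, rfl⟩
      refine ⟨u ∘ Fintype.equivFin (ξ (c + 2)), ?_⟩
      rw [Matrix.mulVecLin_apply, Matrix.submatrix_mulVec_equiv]
      funext k
      simp

/-- The coboundaries of the dual of a sequence of matrices. -/
noncomputable def dualCoboundaries (D : ∀ c, Matrix (ξ c) (ξ (c + 1)) (MvPolynomial (Fin m) K)) :
    (p : ℕ) → Submodule (MvPolynomial (Fin m) K) (ξ p → MvPolynomial (Fin m) K)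
  | 0 => ⊥
  | p + 1 => LinearMap.range (D p)ᵀ.mulVecLin

/-- The resolution has no basis elements in degree p + 1, so every cochain of degree p is a cocycle
and Ext^p is the full free module modulo coboundaries. -/
theorem span_extDegree_ofFintype (sh : ∀ c, ξ c → ℤ)
    (D : ∀ c, Matrix (ξ c) (ξ (c + 1)) (MvPolynomial (Fin m) K))
    (au : ξ 0 → MvPolynomial (Fin m) K)
    (hD : ∀ c k l, IsHomogeneousOfDegree (D c k l) (sh (c + 1) l - sh c k))
    (hau : ∀ k, IsHomogeneousOfDegree (au k) (sh 0 k))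
    (hsurj : I ⊔ Ideal.span (Set.range au) = ⊤)
    (hzero : ∀ v : ξ 0 → MvPolynomial (Fin m) K, (∑ k, v k * au k ∈ I) ↔ ∃ u, D 0 *ᵥ u = v)
    (hsucc : ∀ c v, D c *ᵥ v = 0 ↔ ∃ u, D (c + 1) *ᵥ u = v) (p : ℕ) [IsEmpty (ξ (p + 1))] (c : ℤ)
    (h : Submodule.span (MvPolynomial (Fin m) K) {v : ξ p → MvPolynomial (Fin m) K |
      ∀ k, IsHomogeneousOfDegree (v k) (c + sh p k - m)} ⊔ dualCoboundaries D p = ⊤) :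
    Submodule.span (MvPolynomial (Fin m) K)
      ((ofFintype sh D au hD hau hsurj hzero hsucc).extDegree p c) = ⊤ := by
  set F := ofFintype sh D au hD hau hsurj hzero hsucc with hF
  let E := Fintype.equivFin (ξ p)
  have hcoc : ∀ v : Fin (F.rank p) → MvPolynomial (Fin m) K, v ∈ F.cocycles p := by
    intro v
    have : IsEmpty (Fin (F.rank (p + 1))) := (Fintype.equivFin (ξ (p + 1))).symm.isEmpty
    exact LinearMap.mem_ker.mpr (Subsingleton.elim _ _)
  let L : (ξ p → MvPolynomial (Fin m) K) →ₗ[MvPolynomial (Fin m) K] F.ExtModule p :=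
    (Submodule.mkQ _).comp
      ((LinearMap.funLeft (MvPolynomial (Fin m) K) (MvPolynomial (Fin m) K) E.symm).codRestrict
        (F.cocycles p) fun v => hcoc _)
  have hL : Function.Surjective L := by
    intro w
    obtain ⟨v, rfl⟩ := Submodule.mkQ_surjective _ w
    refine ⟨fun k => v.1 (E k), ?_⟩
    refine congrArg _ (Subtype.ext (funext fun k => ?_))
    exact congrArg v.1 (E.apply_symm_apply k)
  rw [← top_le_iff, ← LinearMap.range_eq_top.mpr hL, ← Submodule.map_top, ← h, Submodule.map_sup,
    Submodule.map_span]
  refine sup_le (Submodule.span_mono ?_) ?_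
  · rintro _ ⟨v, hv, rfl⟩
    exact ⟨⟨_, hcoc (v ∘ E.symm)⟩, fun k => hv _, rfl⟩
  · rintro _ ⟨v, hv, rfl⟩
    have h0 : L v = 0 := by
      refine (Submodule.Quotient.mk_eq_zero _).mpr ?_
      change v ∘ E.symm ∈ F.coboundaries p
      obtain _ | p := p
      · rw [show v = 0 from hv]
        exact Submodule.zero_mem _
      · obtain ⟨u, rfl⟩ := hv
        refine ⟨u ∘ (Fintype.equivFin (ξ p)).symm, ?_⟩
        refine (Matrix.submatrix_mulVec_equiv (D p)ᵀ (u ∘ (Fintype.equivFin (ξ p)).symm)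
          (Fintype.equivFin (ξ (p + 1))).symm (Fintype.equivFin (ξ p)).symm).trans ?_
        simp only [Function.comp_assoc, Equiv.symm_symm, Equiv.symm_comp_self, Function.comp_id]
        rfl
    rw [h0]
    exact Submodule.zero_mem _

end GradedFreeResolution

/-! ### Multiplication matrices and blocks of the Koszul differentials -/

namespace GradedAlgebraBasis

open MvPolynomial

open scoped Matrix

variable {m d p : ℕ} {K : Type u} [Field K] {κ : Type*} [Fintype κ] [DecidableEq κ]
  {I : Ideal (MvPolynomial (Fin m) K)} {z : Fin d → MvPolynomial (Fin m) K}
  {y : Fin p → MvPolynomial (Fin m) K} {b : κ → MvPolynomial (Fin m) K} {δ : κ → ℕ}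

/-- `T i` is the matrix of the multiplication by `y i` on `R / I` with respect to the basis `b`. -/
structure IsMultiplicationMatrix (I : Ideal (MvPolynomial (Fin m) K))
    (z : Fin d → MvPolynomial (Fin m) K) (y : Fin p → MvPolynomial (Fin m) K)
    (b : κ → MvPolynomial (Fin m) K) (δ : κ → ℕ)
    (T : Fin p → Matrix κ κ (MvPolynomial (Fin d) K)) : Prop where
  homogeneous : ∀ i k l, IsHomogeneousOfDegree (T i k l) ((1 : ℤ) + δ l - δ k)
  sub_mem : ∀ i l, y i * b l - ∑ k, aeval z (T i k l) * b k ∈ I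

omit [DecidableEq κ] in
theorem IsGradedBasis.exists_isMultiplicationMatrix (hb : IsGradedBasis I z b δ)
    (hy : ∀ i, (y i).IsHomogeneous 1) : ∃ T, IsMultiplicationMatrix I z y b δ T := by
  choose c hc hc' using fun i l => hb.span _ _ ((hy i).mul (hb.homogeneous l))
  refine ⟨fun i => Matrix.of fun k l => c i l k, fun i k l => ?_, hc'⟩
  have := hc i l k
  push_cast at this
  exact this

/-- The matrix of `y i ⊗ 1 - 1 ⊗ y i`. -/
noncomputable def differenceMatrix (z : Fin d → MvPolynomial (Fin m) K)
    (y : Fin p → MvPolynomial (Fin m) K) (T : Fin p → Matrix κ κ (MvPolynomial (Fin d) K))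
    (i : Fin p) : Matrix κ κ (MvPolynomial (Fin m) K) :=
  y i • (1 : Matrix κ κ (MvPolynomial (Fin m) K)) - (T i).map (aeval z)

variable {T : Fin p → Matrix κ κ (MvPolynomial (Fin d) K)}

omit [Fintype κ] in
theorem differenceMatrix_apply (i : Fin p) (k l : κ) :
    differenceMatrix z y T i k l = (if k = l then y i else 0) - aeval z (T i k l) := by
  unfold differenceMatrix
  rw [Matrix.sub_apply, Matrix.smul_apply, Matrix.one_apply, Matrix.map_apply, smul_eq_mul,
    mul_ite, mul_one, mul_zero]

theorem IsMultiplicationMatrix.isHomogeneousOfDegree (hT : IsMultiplicationMatrix I z y b δ T)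
    (hz : ∀ i, (z i).IsHomogeneous 1) (hy : ∀ i, (y i).IsHomogeneous 1) (i : Fin p) (k l : κ) :
    IsHomogeneousOfDegree (differenceMatrix z y T i k l) ((1 : ℤ) + δ l - δ k) := by
  rw [differenceMatrix_apply, sub_eq_add_neg]
  refine IsHomogeneousOfDegree.add ?_ ((hT.homogeneous i k l).aeval hz).neg
  split_ifs with h
  · subst h
    rw [add_sub_cancel_right]
    exact_mod_cast (hy i).isHomogeneousOfDegree
  · exact isHomogeneousOfDegree_zero _

variable {A : Type*} [CommRing A] {π : MvPolynomial (Fin m) K →+* A}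
  {φ : MvPolynomial (Fin m) K →+* MvPolynomial (Fin p) A}

/-- Multiplication by a variable, in terms of the basis. -/
theorem IsMultiplicationMatrix.sum_mulVec (hT : IsMultiplicationMatrix I z y b δ T)
    (hπ : ∀ f ∈ I, π f = 0) (hφy : ∀ i, φ (y i) = X i + C (π (y i)))
    (hφz : ∀ q, φ (aeval (R := K) z q) = C (π (aeval (R := K) z q)))
    (i : Fin p) (w : κ → MvPolynomial (Fin m) K) :
    ∑ k, φ ((differenceMatrix z y T i *ᵥ w) k) * C (π (b k)) =
      X i * ∑ k, φ (w k) * C (π (b k)) := by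
  have h1 : ∀ l, ∑ k, φ (differenceMatrix z y T i k l) * C (π (b k)) =
      X i * C (π (b l)) := by
    intro l
    have h2 : (C (π (y i)) : MvPolynomial (Fin p) A) *
        C (π (b l)) =
          ∑ k, C (π (aeval (R := K) z (T i k l))) *
            C (π (b k)) := by
      simp only [← map_mul, ← map_sum]
      congr 1
      rw [← sub_eq_zero, ← map_sub]
      exact hπ _ (hT.sub_mem i l)
    simp only [differenceMatrix_apply, map_sub, sub_mul, Finset.sum_sub_distrib, hφz]
    rw [← h2, Finset.sum_eq_single l, if_pos rfl, hφy]
    · ring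
    · intro k _ hk
      rw [if_neg hk, map_zero, zero_mul]
    · simp
  simp only [Matrix.mulVec, dotProduct, map_sum, map_mul, Finset.sum_mul]
  rw [Finset.sum_comm, Finset.mul_sum]
  refine Finset.sum_congr rfl fun l _ => ?_
  rw [mul_left_comm, ← h1, Finset.mul_sum]
  refine Finset.sum_congr rfl fun k _ => ?_
  ring

/-- The variables of a polynomial ring as a sequence. -/
noncomputable def coordinate (p : ℕ) (A : Type*) [CommRing A] (i : ℕ) : MvPolynomial (Fin p) A :=
  if h : i < p then X ⟨i, h⟩ else 0

theorem coordinate_image {i : ℕ} (hi : i ≤ p) :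
    coordinate p A '' {j | j < i} = X '' {j : Fin p | (j : ℕ) < i} := by
  ext x
  constructor
  · rintro ⟨j, hj, rfl⟩
    exact ⟨⟨j, lt_of_lt_of_le hj hi⟩, hj, by rw [coordinate, dif_pos (lt_of_lt_of_le hj hi)]⟩
  · rintro ⟨j, hj, rfl⟩
    exact ⟨j, hj, by rw [coordinate, dif_pos j.2]⟩

/-- Membership in an ideal generated by variables is read off the exponents, and multiplying by
another variable does not change those that matter. -/
theorem coordinate_regular (i : ℕ) (hi : i < p)
    (f : MvPolynomial (Fin p) A)
    (hf : coordinate p A i * f ∈ Ideal.span (coordinate p A '' {j | j < i})) :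
    f ∈ Ideal.span (coordinate p A '' {j | j < i}) := by
  rw [coordinate_image hi.le, mem_ideal_span_X_image] at hf ⊢
  intro k hk
  rw [coordinate, dif_pos hi] at hf
  obtain ⟨j, hj, hjk⟩ := hf (Finsupp.single ⟨i, hi⟩ 1 + k) (by
    rw [mem_support_iff, coeff_X_mul]
    exact mem_support_iff.mp hk)
  refine ⟨j, hj, ?_⟩
  rw [Finsupp.add_apply, Finsupp.single_eq_of_ne, zero_add] at hjk
  · exact hjk
  · rintro rfl
    exact lt_irrefl i hj

theorem mem_span_coordinate_iff (f : MvPolynomial (Fin p) A) :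
    f ∈ Ideal.span (coordinate p A '' {j | j < p}) ↔ constantCoeff f = 0 := by
  rw [coordinate_image le_rfl, mem_ideal_span_X_image]
  constructor
  · intro h
    by_contra h0
    obtain ⟨i, -, hi⟩ := h 0 (mem_support_iff.mpr h0)
    exact hi rfl
  · intro h k hk
    by_contra! h0
    have : k = 0 := Finsupp.ext fun i => h0 i i.2
    subst this
    exact (mem_support_iff.mp hk) h

/-- The matrices which represent, with respect to the basis, the multiplication by the entries of
the Koszul differentials. -/
theorem IsMultiplicationMatrix.exists_blocks (hT : IsMultiplicationMatrix I z y b δ T)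
    (hz : ∀ i, (z i).IsHomogeneous 1) (hy : ∀ i, (y i).IsHomogeneous 1)
    (hπ : ∀ f ∈ I, π f = 0) (hφy : ∀ i, φ (y i) = X i + C (π (y i)))
    (hφz : ∀ q, φ (aeval (R := K) z q) = C (π (aeval (R := K) z q)))
    (c : ℕ) (α : Koszul.Index p c) (β : Koszul.Index p (c + 1)) :
    ∃ Ψ : Matrix κ κ (MvPolynomial (Fin m) K),
      (∀ k l, IsHomogeneousOfDegree (Ψ k l) ((1 : ℤ) + δ l - δ k)) ∧
      ∀ w, ∑ k, φ ((Ψ *ᵥ w) k) * C (π (b k)) =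
        Koszul.d (coordinate p A) p c α β *
          ∑ k, φ (w k) * C (π (b k)) := by
  rcases Koszul.d_apply (coordinate p A) p c α β with h | ⟨i, hi, h⟩
  · refine ⟨0, fun k l => isHomogeneousOfDegree_zero _, fun w => ?_⟩
    rw [h, zero_mul, Matrix.zero_mulVec]
    simp
  · have hv : coordinate p A i = X ⟨i, hi⟩ := dif_pos hi
    rw [hv] at h
    rcases h with h | h
    · refine ⟨_, hT.isHomogeneousOfDegree hz hy ⟨i, hi⟩, fun w => ?_⟩
      rw [h, hT.sum_mulVec hπ hφy hφz]
    · refine ⟨-differenceMatrix z y T ⟨i, hi⟩, fun k l =>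
        (hT.isHomogeneousOfDegree hz hy ⟨i, hi⟩ k l).neg, fun w => ?_⟩
      rw [h, neg_mul, ← hT.sum_mulVec hπ hφy hφz, Matrix.neg_mulVec]
      simp only [Pi.neg_apply, map_neg, neg_mul, Finset.sum_neg_distrib]

end GradedAlgebraBasis

/-! ### Elimination of the dual generators of lower degree -/

namespace GradedAlgebraBasis

open MvPolynomial

open scoped Matrix

variable {m d p : ℕ} {K : Type u} [Field K] {κ : Type*} [Fintype κ] [DecidableEq κ]
  {I J : Ideal (MvPolynomial (Fin m) K)} {z : Fin d → MvPolynomial (Fin m) K}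
  {y : Fin p → MvPolynomial (Fin m) K} {b : κ → MvPolynomial (Fin m) K} {δ : κ → ℕ}
  {T : Fin p → Matrix κ κ (MvPolynomial (Fin d) K)} {s : ℕ}

theorem homogeneousComponent_eq_zero_of_mem_pow {h : MvPolynomial (Fin m) K}
    (hh : h ∈ polynomialMaximal m K ^ s) {t : ℕ} (ht : t < s) : homogeneousComponent t h = 0 := by
  refine homogeneousComponent_eq_zero' _ _ fun k hk hkt => ?_
  have := (mem_pow_idealOfVars_iff s h).mp hh k hk
  omega

theorem aeval_sub_C_mem (q : MvPolynomial (Fin d) K) :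
    aeval z q - C (constantCoeff q) ∈ Ideal.span (Set.range z) := by
  induction q using MvPolynomial.induction_on with
  | C a => simp [algebraMap_eq]
  | add f g hf hg =>
    rw [map_add, map_add, C_add, add_sub_add_comm]
    exact Submodule.add_mem _ hf hg
  | mul_X f i hf =>
    rw [map_mul, map_mul, constantCoeff_X, mul_zero, C_0, sub_zero, aeval_X]
    exact Ideal.mul_mem_left _ _ (Ideal.subset_span ⟨i, rfl⟩)

omit [DecidableEq κ] in
/-- In degrees below the socle degree, the multiplications by the `y i` have no common kernel. -/
theorem eq_zero_of_level (hT : IsMultiplicationMatrix I z y b δ T) (hb : IsQuotientBasis J b δ)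
    (hIJ : I ≤ J) (hzJ : ∀ i, z i ∈ J)
    (hgen : polynomialMaximal m K = Ideal.span (Set.range y) ⊔ Ideal.span (Set.range z))
    (hJ : ∀ f ∈ J, ∀ i, homogeneousComponent i f ∈ J)
    (hsoc : ∀ g, (∀ r ∈ polynomialMaximal m K, r * g ∈ J) → g ∈ J ⊔ polynomialMaximal m K ^ s)
    {t : ℕ} (ht : t < s) (l : κ → K) (hl : ∀ k, δ k ≠ t → l k = 0)
    (h0 : ∀ i k, ∑ k', constantCoeff (T i k k') * l k' = 0) : l = 0 := by
  have hzJ' : Ideal.span (Set.range z) ≤ J := by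
    rw [Ideal.span_le]
    rintro _ ⟨i, rfl⟩
    exact hzJ i
  refine hb.indep l ?_
  set g := ∑ k, C (l k) * b k with hg
  have hgt : g.IsHomogeneous t := by
    refine IsHomogeneous.sum _ _ _ fun k _ => ?_
    by_cases hk : δ k = t
    · have := (isHomogeneous_C (Fin m) (l k)).mul (hb.homogeneous k)
      rwa [hk, zero_add] at this
    · rw [hl k hk, map_zero, zero_mul]
      exact isHomogeneous_zero _ _ _
  -- Expand by the multiplication matrix: modulo `J` only the constant terms of its entries survive,
  -- and these kill `l` by assumption.
  have hyg : ∀ i, y i * g ∈ J := by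
    intro i
    have h1 : y i * g = ∑ k', C (l k') * (y i * b k' - ∑ k, aeval z (T i k k') * b k) +
        ∑ k', C (l k') * ∑ k, (aeval z (T i k k') - C (constantCoeff (T i k k'))) * b k +
          ∑ k, C (∑ k', constantCoeff (T i k k') * l k') * b k := by
      have h2 : ∑ k, C (∑ k', constantCoeff (T i k k') * l k') * b k =
          ∑ k', C (l k') * ∑ k, C (constantCoeff (T i k k')) * b k := by
        simp only [map_sum, map_mul, Finset.sum_mul, Finset.mul_sum]
        rw [Finset.sum_comm]
        refine Finset.sum_congr rfl fun k' _ => Finset.sum_congr rfl fun k _ => ?_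
        ring
      rw [h2, hg, Finset.mul_sum, ← Finset.sum_add_distrib, ← Finset.sum_add_distrib]
      refine Finset.sum_congr rfl fun k' _ => ?_
      simp only [sub_mul, Finset.sum_sub_distrib]
      ring
    rw [h1]
    refine Submodule.add_mem _ (Submodule.add_mem _ ?_ ?_) ?_
    · exact Ideal.sum_mem _ fun k' _ => Ideal.mul_mem_left _ _ (hIJ (hT.sub_mem i k'))
    · exact Ideal.sum_mem _ fun k' _ => Ideal.mul_mem_left _ _ (Ideal.sum_mem _ fun k _ =>
        Ideal.mul_mem_right _ _ (hzJ' (aeval_sub_C_mem _)))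
    · simp only [h0, map_zero, zero_mul, Finset.sum_const_zero]
      exact Submodule.zero_mem _
  have hMg : ∀ r ∈ polynomialMaximal m K, r * g ∈ J := by
    have h1 : polynomialMaximal m K ≤ J.colon {g} := by
      rw [hgen]
      refine sup_le ?_ ?_ <;> rw [Ideal.span_le]
      · rintro _ ⟨i, rfl⟩
        exact Submodule.mem_colon_singleton.mpr (hyg i)
      · rintro _ ⟨i, rfl⟩
        exact Submodule.mem_colon_singleton.mpr (Ideal.mul_mem_right _ _ (hzJ i))
    exact fun r hr => Submodule.mem_colon_singleton.mp (h1 hr)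
  obtain ⟨j, hj, h, hh, hjh⟩ := Submodule.mem_sup.mp (hsoc g hMg)
  rw [← homogeneousComponent_eq_self hgt, ← hjh, map_add,
    homogeneousComponent_eq_zero_of_mem_pow hh ht, add_zero]
  exact hJ j hj t

/-- Downward induction on `δ k`. Below degree `s` the multiplications by the `y i` are jointly
injective on the quotient by `J`, so a left inverse expresses each dual basis vector through rows of
the difference matrices and basis vectors of higher degree. -/
theorem single_mem_of_level (hT : IsMultiplicationMatrix I z y b δ T)
    (hb : IsQuotientBasis J b δ) (hIJ : I ≤ J) (hzJ : ∀ i, z i ∈ J)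
    (hgen : polynomialMaximal m K = Ideal.span (Set.range y) ⊔ Ideal.span (Set.range z))
    (hJ : ∀ f ∈ J, ∀ i, homogeneousComponent i f ∈ J)
    (hsoc : ∀ g, (∀ r ∈ polynomialMaximal m K, r * g ∈ J) → g ∈ J ⊔ polynomialMaximal m K ^ s)
    (hδ : ∀ k, δ k ≤ s) (Q : Submodule (MvPolynomial (Fin m) K) (κ → MvPolynomial (Fin m) K))
    (hQ : ∀ i k, differenceMatrix z y T i k ∈ Q)
    (hQs : ∀ k, δ k = s → Pi.single k 1 ∈ Q) (k : κ) : Pi.single k 1 ∈ Q := by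
  induction hj : s - δ k using Nat.strong_induction_on generalizing k with
  | _ j ih =>
  rcases (hδ k).eq_or_lt with h | hlt
  · exact hQs k h
  set t := δ k with ht
  have ih' : ∀ k', t < δ k' → Pi.single k' 1 ∈ Q := fun k' hk' =>
    ih (s - δ k') (by have := hδ k'; omega) k' rfl
  -- Joint multiplication by the `y i` on the degree `t` part of the quotient by `J`.
  let 𝒯 : ({l // δ l = t} → K) →ₗ[K] (Fin p × κ → K) :=
    (Matrix.of fun (a : Fin p × κ) (l : {l // δ l = t}) =>
      constantCoeff (T a.1 a.2 l)).mulVecLin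
  have h𝒯 : LinearMap.ker 𝒯 = ⊥ := by
    rw [LinearMap.ker_eq_bot']
    intro v hv
    have h1 := eq_zero_of_level hT hb hIJ hzJ hgen hJ hsoc hlt
      (fun l => if h : δ l = t then v ⟨l, h⟩ else 0) (fun l hl => dif_neg hl) fun i k' => by
        have h2 := congrFun hv (i, k')
        refine Eq.trans ?_ h2
        change _ = ∑ l : {l // δ l = t}, constantCoeff (T i k' l) * v l
        refine (Finset.sum_subset (Finset.filter_subset (fun l => δ l = t) Finset.univ) ?_).symm.trans
          ((Finset.sum_subtype _ (by simp) _).trans (Finset.sum_congr rfl fun l _ => ?_))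
        · intro l _ hl
          rw [dif_neg (by simpa using hl), mul_zero]
        · rw [dif_pos l.2]
    funext l
    have h2 := congrFun h1 l
    rwa [dif_pos l.2] at h2
  obtain ⟨G, hG⟩ := LinearMap.exists_leftInverse_of_injective 𝒯 h𝒯
  -- The component at `k` of the left inverse `G`; the other entries can be discarded because
  -- multiplication by a linear form raises the degree by exactly one.
  let μ : Fin p → κ → K := fun i k' =>
    if δ k' = t + 1 then G (Pi.single (i, k') 1) ⟨k, rfl⟩ else 0
  have hdeg : ∀ i k' l, δ k' ≠ δ l + 1 → constantCoeff (T i k' l) = 0 := by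
    intro i k' l hne
    by_contra h
    have h2 := hT.homogeneous i k' l 0 (mem_support_iff.mpr h)
    rw [map_zero] at h2
    push_cast at h2
    omega
  have hμ : ∀ l, δ l = t → ∑ i, ∑ k', μ i k' * constantCoeff (T i k' l) =
      if l = k then 1 else 0 := by
    intro l hl
    have h1 := congrFun (LinearMap.congr_fun hG (Pi.single ⟨l, hl⟩ 1)) ⟨k, rfl⟩
    rw [LinearMap.id_apply, LinearMap.comp_apply] at h1
    have h2 : 𝒯 (Pi.single ⟨l, hl⟩ 1) =
        ∑ a : Fin p × κ, constantCoeff (T a.1 a.2 l) • Pi.single a 1 := by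
      funext a
      rw [Finset.sum_apply]
      simp [𝒯, Pi.single_apply]
    rw [h2, map_sum, Finset.sum_apply, Fintype.sum_prod_type] at h1
    have h3 : (Pi.single (⟨l, hl⟩ : {l // δ l = t}) (1 : K) : {l // δ l = t} → K) ⟨k, rfl⟩ =
        if l = k then 1 else 0 := by
      rw [Pi.single_apply]
      simp only [Subtype.mk.injEq, eq_comm]
    rw [← h3, ← h1]
    refine Finset.sum_congr rfl fun i _ => Finset.sum_congr rfl fun k' _ => ?_
    rw [map_smul, Pi.smul_apply, smul_eq_mul, mul_comm]
    by_cases hk' : δ k' = t + 1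
    · rw [show μ i k' = _ from if_pos hk']
    · rw [hdeg i k' l (by rwa [hl]), zero_mul, zero_mul]
  -- After the rows are subtracted, the coefficients at basis elements of degree below `t` vanish
  -- since their degree is negative, those of degree `t` give `Pi.single k 1` by `hμ`, and those
  -- above `t` are removed by the last sum.
  have key : (Pi.single k 1 : κ → MvPolynomial (Fin m) K) =
      ∑ i, ∑ k', (C (μ i k') * y i) • Pi.single k' 1 -
        ∑ i, ∑ k', (C (μ i k') : MvPolynomial (Fin m) K) • differenceMatrix z y T i k' -
          ∑ l, (if t < δ l then ∑ i, ∑ k', C (μ i k') * aeval z (T i k' l) else 0) •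
            Pi.single l 1 := by
    funext l
    simp only [Pi.sub_apply, Finset.sum_apply, Pi.smul_apply, smul_eq_mul, Pi.single_apply,
      mul_ite, mul_one, mul_zero, differenceMatrix_apply, mul_sub, Finset.sum_sub_distrib]
    rw [Finset.sum_ite_eq, if_pos (Finset.mem_univ l)]
    have h1 : ∀ i k', (if l = k' then C (μ i k') * y i else 0) =
        if k' = l then C (μ i k') * y i else 0 := fun i k' => by simp only [eq_comm]
    simp only [h1, sub_sub_cancel]
    rcases lt_trichotomy t (δ l) with h | h | h
    · rw [if_pos h, sub_self, if_neg]
      rintro rfl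
      exact lt_irrefl _ h
    · have h2 : ∀ i k', C (μ i k') * aeval z (T i k' l) =
          (C (μ i k' * constantCoeff (T i k' l)) : MvPolynomial (Fin m) K) := by
        intro i k'
        by_cases hk' : δ k' = t + 1
        · rw [(hT.homogeneous i k' l).eq_C (by rw [hk', ← h]; push_cast; ring), aeval_C,
            constantCoeff_C, C_mul]
          rfl
        · rw [show μ i k' = 0 from if_neg hk', C_0, zero_mul, zero_mul, C_0]
      simp only [h2]
      rw [if_neg h.not_lt, sub_zero]
      simp only [← map_sum]
      rw [hμ l h.symm]
      split_ifs <;> simp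
    · have h2 : ∀ i k', C (μ i k') * aeval z (T i k' l) = (0 : MvPolynomial (Fin m) K) := by
        intro i k'
        by_cases hk' : δ k' = t + 1
        · rw [(hT.homogeneous i k' l).eq_zero (by rw [hk']; push_cast; omega), map_zero, mul_zero]
        · rw [show μ i k' = 0 from if_neg hk', C_0, zero_mul]
      simp only [h2, Finset.sum_const_zero]
      rw [if_neg h.not_gt, sub_zero, if_neg]
      rintro rfl
      exact lt_irrefl _ h
  rw [key]
  refine Submodule.sub_mem _ (Submodule.sub_mem _ ?_ ?_) ?_
  · refine Submodule.sum_mem _ fun i _ => Submodule.sum_mem _ fun k' _ => ?_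
    by_cases hk' : δ k' = t + 1
    · exact Submodule.smul_mem _ _ (ih' k' (by omega))
    · rw [show μ i k' = 0 from if_neg hk', C_0, zero_mul, zero_smul]
      exact Submodule.zero_mem _
  · exact Submodule.sum_mem _ fun i _ => Submodule.sum_mem _ fun k' _ =>
      Submodule.smul_mem _ _ (hQ i k')
  · refine Submodule.sum_mem _ fun l _ => ?_
    split_ifs with h
    · exact Submodule.smul_mem _ _ (ih' l h)
    · rw [zero_smul]
      exact Submodule.zero_mem _

end GradedAlgebraBasis

/-! ### The Koszul resolution over the polynomial ring -/

namespace GradedAlgebraBasis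

open MvPolynomial

open scoped Matrix

variable {m d p : ℕ} {K : Type u} [Field K] {κ : Type*} [Fintype κ] [DecidableEq κ]
  {I J : Ideal (MvPolynomial (Fin m) K)} {z : Fin d → MvPolynomial (Fin m) K}
  {y : Fin p → MvPolynomial (Fin m) K} {b : κ → MvPolynomial (Fin m) K} {δ : κ → ℕ}
  {T : Fin p → Matrix κ κ (MvPolynomial (Fin d) K)} {s : ℕ}

/-- The block matrix with blocks `Ψ α β`. -/
def blockMatrix {ι ι' R : Type*} (Ψ : ι → ι' → Matrix κ κ R) : Matrix (ι × κ) (ι' × κ) R :=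
  fun a b => Ψ a.1 b.1 a.2 b.2

omit [DecidableEq κ] in
theorem blockMatrix_mulVec {ι ι' R : Type*} [Fintype ι'] [CommRing R]
    (Ψ : ι → ι' → Matrix κ κ R) (w : ι' × κ → R) (a : ι × κ) :
    (blockMatrix Ψ *ᵥ w) a = ∑ β, (Ψ a.1 β *ᵥ fun k => w (β, k)) a.2 := by
  change ∑ b : ι' × κ, _ = _
  rw [Fintype.sum_prod_type]
  rfl

omit [DecidableEq κ] in
theorem combine_blockMatrix_mulVec {ι ι' R N : Type*} [Fintype ι'] [CommRing R] [CommRing N]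
    (φ : R →+* N) (β : κ → N) (Ψ : ι → ι' → Matrix κ κ R) (D : Matrix ι ι' N)
    (hΨ : ∀ i j w, ∑ k, φ ((Ψ i j *ᵥ w) k) * β k = D i j * ∑ k, φ (w k) * β k)
    (w : ι' × κ → R) (i : ι) :
    ∑ k, φ ((blockMatrix Ψ *ᵥ w) (i, k)) * β k =
      (D *ᵥ fun j => ∑ k, φ (w (j, k)) * β k) i := by
  simp only [blockMatrix_mulVec, map_sum, Finset.sum_mul]
  rw [Finset.sum_comm]
  exact Finset.sum_congr rfl fun j _ => hΨ i j _

section Complex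

variable {A : Type*} [CommRing A] {π : MvPolynomial (Fin m) K →+* A}
  {φ : MvPolynomial (Fin m) K →+* MvPolynomial (Fin p) A}
  {Ψ : ∀ c, Koszul.Index p c → Koszul.Index p (c + 1) → Matrix κ κ (MvPolynomial (Fin m) K)}

omit [DecidableEq κ] in
theorem exists_blockMatrix_mulVec_iff
    (hφ : Function.Bijective fun w : κ → MvPolynomial (Fin m) K => ∑ k, φ (w k) * C (π (b k)))
    (hΨ : ∀ c α β w, ∑ k, φ ((Ψ c α β *ᵥ w) k) * C (π (b k)) =
      Koszul.d (coordinate p A) p c α β * ∑ k, φ (w k) * C (π (b k)))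
    (c : ℕ) (w : Koszul.Index p c × κ → MvPolynomial (Fin m) K) :
    (∃ u, blockMatrix (Ψ c) *ᵥ u = w) ↔
      ∃ n, Koszul.d (coordinate p A) p c *ᵥ n = fun i => ∑ k, φ (w (i, k)) * C (π (b k)) := by
  constructor
  · rintro ⟨u, rfl⟩
    exact ⟨_, _root_.funext fun i => (combine_blockMatrix_mulVec φ _ (Ψ c) _ (hΨ c) u i).symm⟩
  · rintro ⟨n, hn⟩
    choose u hu using fun i => hφ.2 (n i)
    refine ⟨fun a => u a.1 a.2, _root_.funext fun a => ?_⟩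
    refine congrFun (f := fun k => (blockMatrix (Ψ c) *ᵥ fun a => u a.1 a.2) (a.1, k))
      (g := fun k => w (a.1, k)) (hφ.1 ?_) a.2
    refine (combine_blockMatrix_mulVec φ _ (Ψ c) _ (hΨ c) (fun a => u a.1 a.2) a.1).trans ?_
    refine Eq.trans ?_ (congrFun hn a.1)
    exact congrArg (fun v => (Koszul.d (coordinate p A) p c *ᵥ v) a.1) (_root_.funext hu)

omit [DecidableEq κ] in
-- The identification of R^κ with A[X] carries the block matrices to the Koszul differentials of the
-- variables, which form a regular sequence.
theorem blockMatrix_mulVec_eq_zero_iff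
    (hφ : Function.Bijective fun w : κ → MvPolynomial (Fin m) K => ∑ k, φ (w k) * C (π (b k)))
    (hΨ : ∀ c α β w, ∑ k, φ ((Ψ c α β *ᵥ w) k) * C (π (b k)) =
      Koszul.d (coordinate p A) p c α β * ∑ k, φ (w k) * C (π (b k)))
    (c : ℕ) (w : Koszul.Index p (c + 1) × κ → MvPolynomial (Fin m) K) :
    blockMatrix (Ψ c) *ᵥ w = 0 ↔ ∃ u, blockMatrix (Ψ (c + 1)) *ᵥ u = w := by
  rw [exists_blockMatrix_mulVec_iff hφ hΨ]
  have h1 : blockMatrix (Ψ c) *ᵥ w = 0 ↔ Koszul.d (coordinate p A) p c *ᵥ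
      (fun i => ∑ k, φ (w (i, k)) * C (π (b k))) = 0 := by
    constructor
    · intro h
      funext i
      rw [← combine_blockMatrix_mulVec φ _ (Ψ c) _ (hΨ c) w i, h]
      simp
    · intro h
      funext a
      refine congrFun (f := fun k => (blockMatrix (Ψ c) *ᵥ w) (a.1, k)) (g := fun _ => 0) (hφ.1 ?_) a.2
      refine (combine_blockMatrix_mulVec φ _ (Ψ c) _ (hΨ c) w a.1).trans ?_
      rw [h]
      simp
  rw [h1]
  refine ⟨Koszul.exists_d_mulVec_eq p coordinate_regular c _, ?_⟩
  rintro ⟨n, hn⟩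
  rw [← hn, Koszul.d_mulVec_d]

omit [DecidableEq κ] in
-- In degree zero the cokernel is A[X]/(X) = A, and the constant coefficient of `φ` is the
-- projection from `R` to `A`.
theorem sum_mem_iff_exists_blockMatrix_mulVec (hπ : ∀ f, π f = 0 ↔ f ∈ I)
    (hφ0 : ∀ r, constantCoeff (φ r) = π r)
    (hφ : Function.Bijective fun w : κ → MvPolynomial (Fin m) K => ∑ k, φ (w k) * C (π (b k)))
    (hΨ : ∀ c α β w, ∑ k, φ ((Ψ c α β *ᵥ w) k) * C (π (b k)) =
      Koszul.d (coordinate p A) p c α β * ∑ k, φ (w k) * C (π (b k)))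
    (w : Koszul.Index p 0 × κ → MvPolynomial (Fin m) K) :
    (∑ k, w k * b k.2 ∈ I) ↔ ∃ u, blockMatrix (Ψ 0) *ᵥ u = w := by
  rw [exists_blockMatrix_mulVec_iff hφ hΨ]
  have h1 : constantCoeff (∑ k, φ (w (default, k)) * C (π (b k))) = π (∑ k, w k * b k.2) := by
    rw [Fintype.sum_prod_type,
      Fintype.sum_unique fun i : Koszul.Index p 0 => ∑ k, w (i, k) * b k]
    simp only [map_sum, map_mul, hφ0, constantCoeff_C]
  rw [← hπ, ← h1, ← mem_span_coordinate_iff, ← Koszul.exists_d_zero_mulVec_iff]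
  refine exists_congr fun n => ⟨fun h => _root_.funext fun i => ?_, fun h => congrFun h default⟩
  rw [Unique.eq_default i, h]

theorem block_eq (hT : IsMultiplicationMatrix I z y b δ T) (hπ : ∀ f ∈ I, π f = 0)
    (hφy : ∀ i, φ (y i) = X i + C (π (y i)))
    (hφz : ∀ q, φ (aeval (R := K) z q) = C (π (aeval (R := K) z q)))
    (hφ : Function.Bijective fun w : κ → MvPolynomial (Fin m) K => ∑ k, φ (w k) * C (π (b k)))
    {B : Matrix κ κ (MvPolynomial (Fin m) K)} (i : Fin p)
    (hB : ∀ w, ∑ k, φ ((B *ᵥ w) k) * C (π (b k)) = X i * ∑ k, φ (w k) * C (π (b k))) :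
    B = differenceMatrix z y T i := by
  refine Matrix.ext_of_mulVec_single fun l => hφ.1 ?_
  exact (hB _).trans (hT.sum_mulVec hπ hφy hφz i _).symm

end Complex

theorem differenceMatrix_mem_dualCoboundaries {q : ℕ} {y : Fin (q + 1) → MvPolynomial (Fin m) K}
    {T : Fin (q + 1) → Matrix κ κ (MvPolynomial (Fin d) K)}
    {Ψ : ∀ c, Koszul.Index (q + 1) c → Koszul.Index (q + 1) (c + 1) →
      Matrix κ κ (MvPolynomial (Fin m) K)} (i : Fin (q + 1)) (α : Koszul.Index (q + 1) q)
    (hα : ∀ β, Ψ q α β = differenceMatrix z y T i ∨ Ψ q α β = -differenceMatrix z y T i) (k : κ) :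
    (fun a : Koszul.Index (q + 1) (q + 1) × κ => differenceMatrix z y T i k a.2) ∈
      GradedFreeResolution.dualCoboundaries (fun c => blockMatrix (Ψ c)) (q + 1) := by
  obtain ⟨hu⟩ := Koszul.nonempty_unique_index (q + 1)
  have h1 : (fun a : Koszul.Index (q + 1) (q + 1) × κ => Ψ q α a.1 k a.2) ∈
      GradedFreeResolution.dualCoboundaries (fun c => blockMatrix (Ψ c)) (q + 1) := by
    refine ⟨Pi.single (α, k) 1, ?_⟩
    rw [Matrix.mulVecLin_apply, Matrix.mulVec_single_one]
    rfl
  rcases hα hu.default with h | h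
  · convert h1 using 2 with a
    rw [hu.eq_default a.1, h]
  · convert Submodule.neg_mem _ h1 using 2 with a
    rw [Pi.neg_apply, hu.eq_default a.1, h, Matrix.neg_apply, neg_neg]

theorem exists_koszul_blocks (hg : IsGradedBasis I z b δ) (hT : IsMultiplicationMatrix I z y b δ T)
    (hz : ∀ i, (z i).IsHomogeneous 1) (hy : ∀ i, (y i).IsHomogeneous 1)
    (hbij : Function.Bijective (eval₂Hom (aeval (R := K) z).toRingHom y)) :
    ∃ Ψ : ∀ c, Koszul.Index p c → Koszul.Index p (c + 1) → Matrix κ κ (MvPolynomial (Fin m) K),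
      (∀ c α β k l, IsHomogeneousOfDegree (Ψ c α β k l) ((1 : ℤ) + δ l - δ k)) ∧
      (∀ w : Koszul.Index p 0 × κ → MvPolynomial (Fin m) K,
        (∑ k, w k * b k.2 ∈ I) ↔ ∃ u, blockMatrix (Ψ 0) *ᵥ u = w) ∧
      (∀ c (w : Koszul.Index p (c + 1) × κ → MvPolynomial (Fin m) K),
        blockMatrix (Ψ c) *ᵥ w = 0 ↔ ∃ u, blockMatrix (Ψ (c + 1)) *ᵥ u = w) ∧
      ∀ i k, (fun a : Koszul.Index p p × κ => differenceMatrix z y T i k a.2) ∈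
        GradedFreeResolution.dualCoboundaries (fun c => blockMatrix (Ψ c)) p := by
  obtain ⟨φ, hφy, hφz, hφ0, hφ⟩ := hg.exists_ringHom hbij
  have hπ : ∀ f ∈ I, Ideal.Quotient.mk I f = 0 := fun f hf => Ideal.Quotient.eq_zero_iff_mem.mpr hf
  choose Ψ hΨhom hΨ using fun c α β => hT.exists_blocks hz hy hπ hφy hφz c α β
  refine ⟨Ψ, hΨhom, sum_mem_iff_exists_blockMatrix_mulVec
    (fun f => Ideal.Quotient.eq_zero_iff_mem) hφ0 hφ hΨ, blockMatrix_mulVec_eq_zero_iff hφ hΨ,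
    fun i k => ?_⟩
  obtain _ | q := p
  · exact i.elim0
  obtain ⟨α, hα⟩ := Koszul.exists_d_last_apply
    (coordinate (q + 1) (MvPolynomial (Fin m) K ⧸ I)) q i i.2
  have hi : coordinate (q + 1) (MvPolynomial (Fin m) K ⧸ I) i = X i := dif_pos i.2
  rw [hi] at hα
  refine differenceMatrix_mem_dualCoboundaries i α (fun β => ?_) k
  rcases hα β with h | h
  · left
    refine block_eq hT hπ hφy hφz hφ i fun w => ?_
    rw [hΨ, h]
  · right
    rw [← block_eq hT hπ hφy hφz hφ i (B := -Ψ q α β) fun w => ?_, neg_neg]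
    have h1 := hΨ q α β w
    rw [h] at h1
    rw [Matrix.neg_mulVec]
    simp only [Pi.neg_apply, map_neg, neg_mul, Finset.sum_neg_distrib]
    rw [h1, neg_mul, neg_neg]

/-- A graded free resolution of a level algebra whose canonical module is generated in a single
degree. -/
theorem exists_gradedFreeResolution (hg : IsGradedBasis I z b δ) (hb : IsQuotientBasis J b δ)
    (hz : ∀ i, (z i).IsHomogeneous 1) (hy : ∀ i, (y i).IsHomogeneous 1)
    (hbij : Function.Bijective (eval₂Hom (aeval (R := K) z).toRingHom y))
    (hIJ : I ≤ J) (hzJ : ∀ i, z i ∈ J)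
    (hgen : polynomialMaximal m K = Ideal.span (Set.range y) ⊔ Ideal.span (Set.range z))
    (hJ : ∀ f ∈ J, ∀ i, homogeneousComponent i f ∈ J)
    (hsoc : ∀ g, (∀ r ∈ polynomialMaximal m K, r * g ∈ J) → g ∈ J ⊔ polynomialMaximal m K ^ s)
    (hδ : ∀ k, δ k ≤ s) : ∃ (F : GradedFreeResolution I) (c : ℤ),
      Submodule.span (MvPolynomial (Fin m) K) (F.extDegree p c) = ⊤ := by
  obtain ⟨T, hT⟩ := hg.exists_isMultiplicationMatrix hy
  obtain ⟨Ψ, hΨhom, hzero, hsucc, hrow⟩ := exists_koszul_blocks hg hT hz hy hbij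
  let R := MvPolynomial (Fin m) K
  have hsurj : I ⊔ Ideal.span (Set.range fun a : Koszul.Index p 0 × κ => b a.2) = ⊤ := by
    obtain ⟨c, -, hc⟩ := hg.span 0 1 (isHomogeneous_one _ _)
    rw [Ideal.eq_top_iff_one, ← sub_add_cancel (1 : R) (∑ k, aeval z (c k) * b k)]
    exact Submodule.add_mem_sup hc (Ideal.sum_mem _ fun k _ =>
      Ideal.mul_mem_left _ _ (Ideal.subset_span ⟨(default, k), rfl⟩))
  have hD : ∀ c k l, IsHomogeneousOfDegree (blockMatrix (Ψ c) k l)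
      ((((c + 1 : ℕ) : ℤ) + δ l.2) - ((c : ℤ) + δ k.2)) := by
    intro c k l
    have h1 : (((c + 1 : ℕ) : ℤ) + δ l.2) - ((c : ℤ) + δ k.2) = (1 : ℤ) + δ l.2 - δ k.2 := by
      push_cast
      ring
    rw [h1]
    exact hΨhom c k.1 l.1 k.2 l.2
  have hempty : IsEmpty (Koszul.Index p (p + 1) × κ) :=
    have := Koszul.isEmpty_index (Nat.lt_succ_self p)
    inferInstance
  obtain ⟨hu⟩ := Koszul.nonempty_unique_index p
  -- With this degree the entry at `k` must be homogeneous of degree δ k - s, so the basis vectors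
  -- dual to degree `s` qualify with the entry 1.
  refine ⟨_, (m : ℤ) - p - s, GradedFreeResolution.span_extDegree_ofFintype
    (fun c (a : Koszul.Index p c × κ) => (c : ℤ) + δ a.2) (fun c => blockMatrix (Ψ c)) (fun a => b a.2) hD
    (fun k => by simpa using (hb.homogeneous k.2).isHomogeneousOfDegree) hsurj hzero hsucc p _ ?_⟩
  set Q := Submodule.span R {w : Koszul.Index p p × κ → R | ∀ k, IsHomogeneousOfDegree (w k)
    ((m : ℤ) - p - s + ((p : ℤ) + δ k.2) - m)} ⊔ GradedFreeResolution.dualCoboundaries (fun c => blockMatrix (Ψ c)) p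
  let L : (κ → R) →ₗ[R] (Koszul.Index p p × κ → R) := LinearMap.funLeft R R Prod.snd
  have hL : Function.Surjective L := by
    intro w
    refine ⟨fun k => w (hu.default, k), _root_.funext fun a => ?_⟩
    change w (hu.default, a.2) = w a
    rw [← hu.eq_default a.1]
  have hmem := single_mem_of_level hT hb hIJ hzJ hgen hJ hsoc hδ (Q.comap L) (fun i k => ?_)
    fun k hk => ?_
  · have htop : Q.comap L = ⊤ := by
      rw [eq_top_iff]
      intro w _
      have h1 : w = ∑ k, w k • (Pi.single k 1 : κ → R) := by
        funext l
        simp [Finset.sum_apply, Pi.single_apply]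
      rw [h1]
      exact Submodule.sum_mem _ fun k _ => Submodule.smul_mem _ _ (hmem k)
    rw [eq_top_iff]
    intro w _
    obtain ⟨w, rfl⟩ := hL w
    exact (htop.ge Submodule.mem_top : w ∈ Q.comap L)
  · exact Submodule.mem_sup_right (hrow i k)
  · refine Submodule.mem_sup_left (Submodule.subset_span fun a => ?_)
    change IsHomogeneousOfDegree ((Pi.single k 1 : κ → R) a.2) _
    rw [Pi.single_apply]
    split_ifs with h
    · have h1 := (isHomogeneous_one (Fin m) K).isHomogeneousOfDegree
      convert h1 using 1
      rw [h, hk]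
      push_cast
      ring
    · exact isHomogeneousOfDegree_zero _

end GradedAlgebraBasis

/-! ### Graded level algebras -/

section Dimension

open RingTheory.Sequence

/-- Dividing by a nonzerodivisor lowers the dimension by at least one. -/
theorem length_le_ringKrullDim_of_isRegular {A : Type u} [CommRing A] (rs : List A)
    (h : IsRegular A rs) : (rs.length : WithBot ℕ∞) ≤ ringKrullDim A := by
  induction hn : rs.length generalizing A rs with
  | zero =>
    have : Nontrivial A := by
      have h1 := h.top_ne_smul
      by_contra hA
      rw [not_nontrivial_iff_subsingleton] at hA
      exact h1 (Subsingleton.elim _ _)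
    exact ringKrullDim_nonneg_of_nontrivial
  | succ n ih =>
    obtain _ | ⟨r, rs⟩ := rs
    · simp at hn
    obtain ⟨hr, hrs⟩ := (isRegular_cons_iff A r rs).mp h
    have h1 : IsRegular (A ⧸ Ideal.span {r}) rs := by
      refine (LinearEquiv.isRegular_congr (Submodule.quotEquivOfEq _ _ ?_) rs).mp hrs
      rw [← Submodule.ideal_span_singleton_smul, smul_eq_mul, Ideal.mul_top]
    have h2 := ih _ (isRegular_map_quotient_mk _ h1) (by simpa using hn)
    refine le_trans ?_ (ringKrullDim_quotient_succ_le_of_nonZeroDivisor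
      (mem_nonZeroDivisors_iff_left.mpr fun x hx => hr (hx.trans (smul_zero r).symm)))
    push_cast
    gcongr

/-- `B` is integral over `A`, so contraction of primes is strictly monotone by incomparability. -/
theorem ringKrullDim_le_of_finite_span {A B κ : Type*} [CommRing A] [CommRing B] [Fintype κ]
    (φ : A →+* B) (b : κ → B) (h : ∀ x, ∃ c : κ → A, x = ∑ k, φ (c k) * b k) :
    ringKrullDim B ≤ ringKrullDim A := by
  let := φ.toAlgebra
  have hfin : Module.Finite A B := by
    refine Module.Finite.of_fg_top (Submodule.fg_def.mpr ⟨_, Set.finite_range b, ?_⟩)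
    rw [eq_top_iff]
    intro x _
    obtain ⟨c, rfl⟩ := h x
    exact Submodule.sum_mem _ fun k _ => Submodule.smul_mem _ (c k) (Submodule.subset_span ⟨k, rfl⟩)
  have := Algebra.IsIntegral.of_finite A B
  exact Order.krullDim_le_of_strictMono (PrimeSpectrum.comap φ) fun _ _ h =>
    Ideal.IsIntegral.comap_lt_comap h

end Dimension

instance {m : ℕ} {K : Type u} [Field K] : (polynomialMaximal m K).IsMaximal := by
  have h : polynomialMaximal m K = RingHom.ker (MvPolynomial.constantCoeff (σ := Fin m)) := by
    refine le_antisymm (Ideal.span_le.mpr ?_) fun f hf => ?_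
    · rintro _ ⟨i, rfl⟩
      exact RingHom.mem_ker.mpr (MvPolynomial.constantCoeff_X K i)
    · have h1 := (isContractionRing_polynomial m K).sub_mem f
      have h2 : MvPowerSeries.constantCoeff
          (MvPolynomial.coeToMvPowerSeries.ringHom f : MvPowerSeries (Fin m) K) = 0 := by
        rw [← (RingHom.mem_ker.mp hf : MvPolynomial.constantCoeff f = 0)]
        exact MvPolynomial.coeff_coe f 0
      rwa [h2, map_zero, sub_zero] at h1
  rw [h]
  exact RingHom.ker_isMaximal_of_surjective _ fun c => ⟨MvPolynomial.C c, MvPolynomial.constantCoeff_C _ c⟩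

namespace GradedAlgebraBasis

open MvPolynomial

theorem IsGradedBasis.ringKrullDim_le {m d : ℕ} {K : Type u} [Field K] {κ : Type*} [Fintype κ]
    {I : Ideal (MvPolynomial (Fin m) K)} {z : Fin d → MvPolynomial (Fin m) K}
    {b : κ → MvPolynomial (Fin m) K} {δ : κ → ℕ} (hg : IsGradedBasis I z b δ) :
    ringKrullDim (MvPolynomial (Fin m) K ⧸ I) ≤ d := by
  have h : ∀ x : MvPolynomial (Fin m) K ⧸ I, ∃ c : κ → MvPolynomial (Fin d) K,
      x = ∑ k, (Ideal.Quotient.mk I).comp (aeval (R := K) z).toRingHom (c k) *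
        Ideal.Quotient.mk I (b k) := by
    intro x
    obtain ⟨f, rfl⟩ := Ideal.Quotient.mk_surjective x
    choose c _ hc using fun t =>
      hg.span t (homogeneousComponent t f) (homogeneousComponent_isHomogeneous t f)
    refine ⟨fun k => ∑ t ∈ Finset.range (f.totalDegree + 1), c t k, ?_⟩
    simp only [map_sum, Finset.sum_mul]
    rw [Finset.sum_comm]
    conv_lhs => rw [← sum_homogeneousComponent f, map_sum]
    refine Finset.sum_congr rfl fun t _ => ?_
    rw [Ideal.Quotient.eq.mpr (hc t), map_sum]
    exact Finset.sum_congr rfl fun k _ => map_mul _ _ _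
  refine (ringKrullDim_le_of_finite_span _ _ h).trans ?_
  rw [ringKrullDim_of_isNoetherianRing, ringKrullDim_eq_zero_of_field, zero_add, Nat.card_fin]

end GradedAlgebraBasis

/-! ### Quasi-regularity of z_1, …, z_d -/

namespace IsAdmissibleSystem

variable {m d τ : ℕ} {K : Type u} [Field K] {R : Type u} [CommRing R]
  [Module R (DividedPower m K)] {M : Ideal R} {W : Submodule R (DividedPower m K)}
  {y : Fin m → R} {e : Fin d ↪ Fin m} {Z : (Fin m →₀ ℕ) → DividedPower m K}
  {H : (Fin d → ℕ) → Fin τ → DividedPower m K} {s : (Fin d → ℕ) → ℕ}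
  (hS : IsAdmissibleSystem M W y e Z H s)

include hS

/-- Apply the relation to `H (1 + α₀) j`. A term with another exponent α has some α_i > α₀_i by
minimality, and that power of z_i kills the element. The surviving term is the contraction of `H 1
j` by `g α₀`. -/
theorem mem_annihilator_levelSubmodule_one_of_sum_mem (T : Finset (Fin d →₀ ℕ))
    (g : (Fin d →₀ ℕ) → R) (hsum : ∑ α ∈ T, (∏ i, y (e i) ^ α i) * g α ∈ W.annihilator)
    {α₀ : Fin d →₀ ℕ} (hα₀ : α₀ ∈ T) (hmin : ∀ α ∈ T, α ≤ α₀ → α = α₀) :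
    g α₀ ∈ (levelSubmodule R H 1).annihilator := by
  rw [mem_annihilator_iff]
  intro j
  have hn : ∀ i, 0 < (1 : Fin d → ℕ) i := fun _ => Nat.one_pos
  have hn' : ∀ i, 0 < ((1 : Fin d → ℕ) + α₀) i := fun i => Nat.add_pos_left (hn i) _
  have hW : H (1 + α₀) j ∈ W := by
    rw [hS.generators]
    exact Submodule.subset_span ⟨_, hn', j, rfl⟩
  have h0 := Submodule.mem_annihilator.mp hsum _ hW
  rw [Finset.sum_smul, Finset.sum_eq_single_of_mem α₀ hα₀ fun α hα hne => ?_, mul_comm, mul_smul,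
    hS.prod_pow_smul hn] at h0
  · exact h0
  · obtain ⟨i, hi⟩ : ∃ i, α₀ i < α i := by
      by_contra! h
      exact hne (hmin α hα fun i => h i)
    have h1 : y (e i) ^ (α₀ i + 1) • H (1 + α₀) j = 0 := by
      have := hS.pow_smul hn' i j
      rwa [Pi.add_apply, Pi.one_apply, add_comm] at this
    obtain ⟨q, hq⟩ : y (e i) ^ (α₀ i + 1) ∣ (∏ i, y (e i) ^ α i) * g α :=
      ((pow_dvd_pow _ hi).trans
        (Finset.dvd_prod_of_mem (fun i => y (e i) ^ α i) (Finset.mem_univ i))).mul_right _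
    rw [hq, mul_comm, mul_smul, h1, smul_zero]

end IsAdmissibleSystem

theorem exists_sum_equiv_extending {m d : ℕ} (e : Fin d ↪ Fin m) :
    ∃ η : Fin (m - d) ⊕ Fin d ≃ Fin m, ∀ i, η (Sum.inr i) = e i := by
  classical
  have hcard : Fintype.card ((Set.range e)ᶜ : Set (Fin m)) = m - d := by
    rw [Fintype.card_compl_set, Fintype.card_fin, Set.card_range_of_injective e.injective,
      Fintype.card_fin]
  exact ⟨(Equiv.sumComm _ _).trans (((Equiv.ofInjective e e.injective).sumCongr
    (Fintype.equivFinOfCardEq hcard).symm).trans (Equiv.Set.sumCompl _)), fun _ => rfl⟩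

/-! ### Level algebras from graded admissible systems -/

namespace IsGradedAdmissibleSystem

open MvPolynomial DividedPower GradedAlgebraBasis RingTheory.Sequence

variable {m d τ : ℕ} {K : Type u} [Field K]
  {W : Submodule (MvPolynomial (Fin m) K) (DividedPower m K)} {y : Fin m → MvPolynomial (Fin m) K}
  {e : Fin d ↪ Fin m} {Z : (Fin m →₀ ℕ) → DividedPower m K}
  {H : (Fin d → ℕ) → Fin τ → DividedPower m K} {s : (Fin d → ℕ) → ℕ}
  (hS : IsGradedAdmissibleSystem W y e Z H s)

include hS

theorem isHomogeneousSubmodule : IsHomogeneousSubmodule W := by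
  rw [hS.generators]
  refine isHomogeneousSubmodule_span ?_
  rintro _ ⟨n, hn, j, rfl⟩
  exact ⟨_, hS.homogeneous n hn j⟩

theorem isHomogeneousSubmodule_levelSubmodule {n : Fin d → ℕ} (hn : ∀ i, 0 < n i) :
    IsHomogeneousSubmodule (levelSubmodule (MvPolynomial (Fin m) K) H n) := by
  refine isHomogeneousSubmodule_span ?_
  rintro _ ⟨j, rfl⟩
  exact ⟨_, hS.homogeneous n hn j⟩

theorem annihilatorDuality {r : ℕ} (g : Fin r → MvPolynomial (Fin m) K)
    (hg : Set.range g ⊆ Set.range fun i => y (e i)) : AnnihilatorDuality W g := by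
  refine annihilatorDuality_polynomial hS.isHomogeneousSubmodule g (fun _ => 1) fun i => ?_
  obtain ⟨j, hj⟩ := hg ⟨i, rfl⟩
  rw [← hj]
  exact hS.linear _

theorem annihilatorDuality_pow (n : Fin d → ℕ) : AnnihilatorDuality W fun i => y (e i) ^ n i :=
  annihilatorDuality_polynomial hS.isHomogeneousSubmodule _ (fun i => 1 * n i) fun _ =>
    (hS.linear _).pow _

theorem isGradedLevel (hτ : 0 < τ) : IsGradedLevel W.annihilator d τ := by
  classical
  have hR := isContractionRing_polynomial m K
  have hA := hS.toIsAdmissibleSystem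
  set z : Fin d → MvPolynomial (Fin m) K := fun i => y (e i) with hz
  have hn : ∀ i, 0 < (1 : Fin d → ℕ) i := fun _ => Nat.one_pos
  have hreg := hA.isRegular hR rfl hτ fun r g hg => hS.annihilatorDuality g hg
  have h1 := hA.annihilator_levelSubmodule_one hR rfl (hS.annihilatorDuality _ subset_rfl)
  have hI : ∀ f ∈ W.annihilator, ∀ i, homogeneousComponent i f ∈ W.annihilator := fun f hf i =>
    homogeneousComponent_mem_annihilator hS.isHomogeneousSubmodule hf i
  have hJ : ∀ f ∈ W.annihilator ⊔ Ideal.span (Set.range z), ∀ i,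
      homogeneousComponent i f ∈ W.annihilator ⊔ Ideal.span (Set.range z) := by
    rw [← h1]
    exact fun f hf i =>
      homogeneousComponent_mem_annihilator (hS.isHomogeneousSubmodule_levelSubmodule hn) hf i
  obtain ⟨κ, _, b, δ, hb, hδ⟩ := exists_isQuotientBasis (hA.pow_le_annihilator hR rfl hn)
  rw [h1] at hb
  have hg := hb.isGradedBasis hI hJ (fun i => hS.linear _) fun T g hsum α₀ hα₀ hmin =>
    h1.le (hA.mem_annihilator_levelSubmodule_one_of_sum_mem T g hsum hα₀ hmin)
  have hreg' := isRegular_map_quotient_mk _ hreg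
  have hzJ : ∀ i, z i ∈ Ideal.span (Set.range z) := fun i => Ideal.subset_span ⟨i, rfl⟩
  -- The dimension is at most d by finiteness over K[z_1, …, z_d], and at least d by the regular
  -- sequence.
  refine ⟨hI, ⟨le_antisymm hg.ringKrullDim_le ?_, _, ?_, ?_, hreg'⟩, ?_, ?_⟩
  · simpa using length_le_ringKrullDim_of_isRegular _ hreg'
  · rw [List.length_map, List.length_ofFn]
  · intro r hr
    obtain ⟨t, ht, rfl⟩ := List.mem_map.mp hr
    obtain ⟨i, rfl⟩ := (List.mem_ofFn' _ _).mp ht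
    refine Ideal.mem_map_of_mem _ ?_
    rw [← hS.generators_maximal]
    exact Ideal.subset_span ⟨_, rfl⟩
  · exact hA.hasType hR rfl hτ fun r g hg => hS.annihilatorDuality g hg
  · obtain ⟨η, hη⟩ := exists_sum_equiv_extending e
    have hbij := bijective_eval₂Hom hS.linear hS.generators_maximal η
    simp only [hη] at hbij
    refine exists_gradedFreeResolution hg hb (fun i => hS.linear _) (fun i => hS.linear _) hbij
      le_sup_left (fun i => Ideal.mem_sup_right (hzJ i)) ?_ hJ (s := s 1) (fun g hg => ?_) hδ
    · rw [← hS.generators_maximal, ← Ideal.span_union, ← η.surjective.range_comp y]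
      have h2 : y ∘ η = Sum.elim (fun i => y (η (Sum.inl i))) z := by
        funext i
        obtain i | i := i
        · rfl
        · exact congrArg y (hη i)
      rw [h2, Set.Sum.elim_range]
    · rw [← h1] at hg ⊢
      obtain ⟨f, hf, hgf⟩ := hA.exists_sub_mem_of_socle hR rfl hn hg
      rw [← sub_add_cancel g f]
      exact Submodule.add_mem_sup hgf hf

end IsGradedAdmissibleSystem

theorem mainTheorem3 {K : Type u} [Field K] [Infinite K] (m d τ : ℕ) (hd : 0 < d) (hτ : 0 < τ) :
    -- local case
    (∀ W : Submodule (MvPowerSeries (Fin m) K) (DividedPower m K), W ≠ ⊥ →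
      (IsLocalAdmissible d τ W → IsLocalLevel W.annihilator d τ) ∧
      (∀ (y : Fin m → MvPowerSeries (Fin m) K) (e : Fin d ↪ Fin m)
        (Z : (Fin m →₀ ℕ) → DividedPower m K)
        (H : (Fin d → ℕ) → Fin τ → DividedPower m K) (s : (Fin d → ℕ) → ℕ),
        IsAdmissibleSystem (powerSeriesMaximal m K) W y e Z H s →
        (∀ n : Fin d → ℕ, (∀ i, 0 < n i) →
          (levelSubmodule (MvPowerSeries (Fin m) K) H n).annihilator =
            W.annihilator ⊔ Ideal.span (Set.range fun i => y (e i) ^ n i)) ∧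
        RingTheory.Sequence.IsRegular (MvPowerSeries (Fin m) K ⧸ W.annihilator)
          (List.ofFn fun i => y (e i)))) ∧
    -- graded case
    (∀ W : Submodule (MvPolynomial (Fin m) K) (DividedPower m K), W ≠ ⊥ →
      (IsGradedAdmissible d τ W → IsGradedLevel W.annihilator d τ) ∧
      (∀ (y : Fin m → MvPolynomial (Fin m) K) (e : Fin d ↪ Fin m)
        (Z : (Fin m →₀ ℕ) → DividedPower m K)
        (H : (Fin d → ℕ) → Fin τ → DividedPower m K) (s : (Fin d → ℕ) → ℕ),
        IsGradedAdmissibleSystem W y e Z H s →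
        (∀ n : Fin d → ℕ, (∀ i, 0 < n i) →
          (levelSubmodule (MvPolynomial (Fin m) K) H n).annihilator =
            W.annihilator ⊔ Ideal.span (Set.range fun i => y (e i) ^ n i)) ∧
        RingTheory.Sequence.IsRegular (MvPolynomial (Fin m) K ⧸ W.annihilator)
          (List.ofFn fun i => y (e i)))) := by
  refine ⟨fun W _ => ⟨fun hW => hW.isLocalLevel hτ, fun y e Z H s hS => ⟨fun n hn => ?_, ?_⟩⟩,
    fun W _ => ⟨?_, fun y e Z H s hS => ⟨fun n hn => ?_, ?_⟩⟩⟩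
  · exact hS.annihilator_levelSubmodule (isContractionRing_powerSeries m K) rfl hn
      (annihilatorDuality_powerSeries W _)
  · exact hS.isRegular (isContractionRing_powerSeries m K) rfl hτ fun _ g _ =>
      annihilatorDuality_powerSeries W g
  · rintro ⟨y, e, Z, H, s, hS⟩
    exact hS.isGradedLevel hτ
  · exact hS.annihilator_levelSubmodule (isContractionRing_polynomial m K) rfl hn
      (hS.annihilatorDuality_pow n)
  · exact hS.isRegular (isContractionRing_polynomial m K) rfl hτ fun _ g hg =>
      hS.annihilatorDuality g hg
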